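/- **Definitions.** All codes are binary. Sequences $v=(v_t)_{t\in\mathbb Z}$, $v_t\in\mathbb F_2^N$, are assumed to be zero in the far past (vectors of Laurent series). A (possibly time-varying) *generator matrix* with $k$ inputs, $N$ outputs and memory at most $m$ consists of matrices $G_a(t)\in\mathbb F_2^{k\times N}$ ($0\le a\le m$, $t\in\mathbb Z$) for which the encoding map $u\mapsto v$, $v_t=\sum_{a=0}^m u_{t-a}G_a(t)$, is injective. A *convolutional code of rate $k/N$* is the image of such a map; its *memory* is the smallest memory of a generator matrix with $k$ inputs that generates it, and its *free distance* $d_{\rm free}$ is the smallest Hamming weight of a nonzero codeword. (In particular the bound below applies to every codeword of every zero-tail terminated version of the code.) Consider an $s$-partite, $s$-uniform, $c$-regular hypergraph with $n$ vertices in each of its $s$ parts, hence with $nc$ hyperedges (parallel hyperedges allowed). At each vertex number the $c$ hyperedges containing it and choose a convolutional code of rate $R^c=b/c$ (different vertices may have different codes). The *woven graph code* determined by these data consists of all sequences, with symbols indexed by the $nc$ hyperedges, whose restriction to the $c$ hyperedges at each vertex is, in the chosen order, a codeword of the constituent code of that vertex. **Theorem (Costello lower bound).** Let $n\ge 1$,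 $0<R_{\rm wg}<1$ and $\varepsilon>0$. There is an integer $s\ge 2$ such that for all integers $b\ge 0$, $c\ge 1$ with $s(R^c-1)+1=R_{\rm wg}$, where $R^c=b/c$, there is $m_0>0$ such that for every integer $m_{\rm wg}>m_0$ there exists a woven graph code over an $s$-partite, $s$-uniform, $c$-regular hypergraph with $n$ vertices in each part and with constituent convolutional codes of rate $R^c$, which is a convolutional code of rate exactly $R_{\rm wg}$ and of memory exactly $m_{\rm wg}$, and whose free distance is finite and satisfies $$\frac{d_{\rm free}}{n\,c\,m_{\rm wg}}\;\ge\;-\frac{R_{\rm wg}}{\log_2\!\left(2^{1-R_{\rm wg}}-1\right)}-\varepsilon .$$ -/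

import Mathlib

namespace WovenGraph

/-- Binary (two-sided) sequences of tuples indexed by `ι`: `v t e` is the symbol at time `t` in
position `e`. -/
abbrev BinSeq (ι : Type) : Type := ℤ → ι → ZMod 2

/-- The sequence is zero in the far past, i.e. it is a (vector of) binary Laurent series. -/
def IsLaurent {ι : Type} (v : BinSeq ι) : Prop :=
  ∃ t₀ : ℤ, ∀ t < t₀, v t = 0

/-- The feedforward encoder of memory at most `m` with (possibly time-varying) coefficient matrices
`G a t`, `0 ≤ a ≤ m`: the output at time `t` is `∑ₐ u (t - a) · G a t`. The encoder is
time-invariant, with polynomial generator matrix `∑ₐ G a Dᵃ`, if `G a t` does not depend on `t`. -/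
def encode {ι : Type} {k : ℕ} (m : ℕ) (G : ℕ → ℤ → Matrix (Fin k) ι (ZMod 2))
    (u : BinSeq (Fin k)) : BinSeq ι :=
  fun t => ∑ a ∈ Finset.range (m + 1), Matrix.vecMul (u (t - (a : ℤ))) (G a t)

/-- `G` is a generator matrix, with `k` input symbols per time unit and memory at most `m`,
of the code `C`: encoding is one-to-one and the codewords are exactly the encoded sequences. -/
structure IsGenerator {ι : Type} {k : ℕ} (m : ℕ) (G : ℕ → ℤ → Matrix (Fin k) ι (ZMod 2))
    (C : Submodule (ZMod 2) (BinSeq ι)) : Prop where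
  eq_zero : ∀ u : BinSeq (Fin k), IsLaurent u → encode m G u = 0 → u = 0
  mem_iff : ∀ v : BinSeq ι, v ∈ C ↔ ∃ u : BinSeq (Fin k), IsLaurent u ∧ encode m G u = v

/-- `C` is a binary convolutional code with `k` information symbols per tuple
(so of rate `k / |ι|`). -/
def IsConvolutional {ι : Type} (k : ℕ) (C : Submodule (ZMod 2) (BinSeq ι)) : Prop :=
  ∃ (m : ℕ) (G : ℕ → ℤ → Matrix (Fin k) ι (ZMod 2)), IsGenerator m G C

/-- `C` is a binary convolutional code with `k` information symbols per tuple and memory exactly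
`m`: the smallest memory of its generator matrices is `m`. -/
def HasMemory {ι : Type} (k : ℕ) (C : Submodule (ZMod 2) (BinSeq ι)) (m : ℕ) : Prop :=
  IsLeast {M : ℕ | ∃ G : ℕ → ℤ → Matrix (Fin k) ι (ZMod 2), IsGenerator M G C} m

/-- Hamming weight of a sequence (possibly infinite). -/
noncomputable def weight {ι : Type} (v : BinSeq ι) : ℕ∞ :=
  Set.encard {p : ℤ × ι | v p.1 p.2 ≠ 0}

/-- Free distance: the smallest Hamming weight of a nonzero codeword. -/
noncomputable def freeDistance {ι : Type} (C : Submodule (ZMod 2) (BinSeq ι)) : ℕ∞ :=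
  ⨅ v ∈ {v : BinSeq ι | v ∈ C ∧ v ≠ 0}, weight v

/-- An `s`-partite, `s`-uniform, `c`-regular hypergraph with `n` vertices in each of the `s` parts.
It has `n * c` hyperedges; the hyperedge `e` consists of the vertices `vertex i e`, one in each
part `i`. Parallel hyperedges are allowed. -/
structure PartiteHypergraph (s n c : ℕ) where
  vertex : Fin s → Fin (n * c) → Fin n
  regular : ∀ (i : Fin s) (t : Fin n), Fintype.card {e : Fin (n * c) // vertex i e = t} = c

/-- The data of a woven graph code: a hypergraph, at each vertex a numbering of the `c` hyperedges
that contain it, and at each vertex a constituent convolutional code of rate `b / c`. -/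
structure WovenGraphCode (s n b c : ℕ) where
  graph : PartiteHypergraph s n c
  port : ∀ (i : Fin s) (t : Fin n), Fin c ≃ {e : Fin (n * c) // graph.vertex i e = t}
  constituent : Fin s → Fin n → Submodule (ZMod 2) (BinSeq (Fin c))
  isConvolutional : ∀ (i : Fin s) (t : Fin n), IsConvolutional b (constituent i t)

/-- The part of a sequence on the hyperedges that is seen from the vertex `t` of part `i`. -/
def WovenGraphCode.localWord {s n b c : ℕ} (W : WovenGraphCode s n b c) (i : Fin s) (t : Fin n)
    (v : BinSeq (Fin (n * c))) : BinSeq (Fin c) :=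
  fun τ j => v τ (W.port i t j).1

/-- The woven graph code: the sequences on the hyperedges whose part at each vertex is a codeword
of the constituent code of that vertex. -/
def WovenGraphCode.code {s n b c : ℕ} (W : WovenGraphCode s n b c) :
    Submodule (ZMod 2) (BinSeq (Fin (n * c))) where
  carrier := {v | ∀ (i : Fin s) (t : Fin n), W.localWord i t v ∈ W.constituent i t}
  add_mem' := fun hv hw i t => (W.constituent i t).add_mem (hv i t) (hw i t)
  zero_mem' := fun i t => (W.constituent i t).zero_mem
  smul_mem' := fun a _ hv i t => (W.constituent i t).smul_mem a (hv i t)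

end WovenGraph

/-! The proof is a random coding argument on parity checks. Put r = c - b, so that s r = c(1 - R),
and ℓ = -log₂(2^(1-R) - 1); the target is R/ℓ. Time is cut into blocks of B units. At each time
every vertex has r checks, each equating the symbol of its own pivot edge with a random combination
of the symbols on its edges in the K preceding blocks. Pivots are distinct and the current block is
not in the window, so the symbols off the pivots can be chosen freely and determine the codeword. A
check involves only edges of one vertex, so the code of all checks is a woven graph code
(`code_woven`).

Distance. Let S be the set of active cells (block, edge) of a word. Each pair (block, vertex) that
sees S imposes rB independent random conditions, while at most 2^(dℓ + (1-R)B|S|) words of weight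
below d live on S (`card_light_words_le`). If S terminates, a touched vertex sees at least K - 1
more blocks than it is active in (`le_card_seen_of_terminated`). If almost all s n vertices are
touched, the conditions therefore outnumber (1-R)B|S| by about B K s n r = B K n c(1-R), which
permits d ≈ B K n c(1-R)/ℓ. The hypergraph is an expander for large s: a set touching fewer vertices
has at most s r edges, and then the conditions exceed B|S| (`le_card_seen_of_card_le`). A word
without a gap of K blocks has so many active cells that the boundary loss is negligible
(`le_card_seen`, `le_weight_of_not_lightWord`).

Memory. Systematic encoding is recursive, so a feedforward encoder needs responses that can be
driven to zero. By duality this is possible within L blocks when no combination of the checks of L +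
K blocks vanishes on the first L of them. Random checks have this property as soon as s r(L+K) < cL,
because a pattern of checks sees more cells than it has (`card_lt_card_columns`). Hence L ≈ K(1-R)/R
and the memory is at most (L+1)B, so d/(n c m) ≈ R/ℓ.

With K, L and the window sizes fixed, all failure probabilities decay like 2^(-B/2). Coefficients
periodic in time leave finitely many translates to control, so a union bound succeeds for large B.
The exact memory is reached by inserting zero tuples at time 0, which leaves all weights unchanged
and raises the memory in steps of at most one (`exists_hasMemory_map_gap`). -/

namespace WovenGraph

/-! ### Causal recursions -/

section Causal

/-- Solutions of causal recursions started at a finite time exist. -/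
theorem exists_causal {α : Type} [Zero α] (t₀ : ℤ) (Ψ : ℤ → (ℤ → α) → α)
    (hΨ : ∀ t u u', (∀ τ < t, u τ = u' τ) → Ψ t u = Ψ t u') :
    ∃ u : ℤ → α, (∀ t < t₀, u t = 0) ∧ ∀ t, t₀ ≤ t → u t = Ψ t u := by
  -- The n-th iterate is final at all times before t₀ + n; each step fills in one more time.
  let U : ℕ → ℤ → α := fun n => Nat.rec (fun _ => 0)
    (fun n w t => if t = t₀ + n then Ψ t w else w t) n
  have hU : ∀ n t, U (n + 1) t = if t = t₀ + n then Ψ t (U n) else U n t := fun n t => rfl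
  have hlt : ∀ n, ∀ t < t₀, U n t = 0 := by
    intro n
    induction n with
    | zero => intro t _; rfl
    | succ n ih => intro t ht; rw [hU, if_neg (by omega), ih t ht]
  have hst : ∀ j n : ℕ, ∀ t < t₀ + n, U (n + j) t = U n t := by
    intro j
    induction j with
    | zero => intro n t _; rfl
    | succ j ih => intro n t ht; rw [← add_assoc, hU, if_neg (by push_cast; omega), ih n t ht]
  refine ⟨fun t => U ((t - t₀).toNat + 1) t, fun t ht => hlt ((t - t₀).toNat + 1) t ht, fun t ht => ?_⟩
  have h1 : t = t₀ + ((t - t₀).toNat : ℕ) := by omega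
  change U ((t - t₀).toNat + 1) t = _
  rw [hU, if_pos h1]
  refine hΨ t _ _ fun τ hτ => ?_
  by_cases h : τ < t₀
  · exact (hlt _ _ h).trans (hlt ((τ - t₀).toNat + 1) _ h).symm
  · obtain ⟨j, hj⟩ : ∃ j, (t - t₀).toNat = ((τ - t₀).toNat + 1) + j :=
      ⟨(t - t₀).toNat - ((τ - t₀).toNat + 1), by omega⟩
    rw [hj, hst j _ τ (by push_cast; omega)]

/-- A sequence vanishing in the far past vanishes if each term vanishes once the earlier ones do. -/
theorem eq_zero_of_causal {α : Type} [Zero α] {u : ℤ → α} (hu : ∃ t₀ : ℤ, ∀ t < t₀, u t = 0)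
    (h : ∀ t, (∀ τ < t, u τ = 0) → u t = 0) : u = 0 := by
  obtain ⟨t₀, ht₀⟩ := hu
  have key : ∀ n : ℕ, ∀ t < t₀ + n, u t = 0 := by
    intro n
    induction n with
    | zero => intro t ht; exact ht₀ t (by simpa using ht)
    | succ n ih =>
      intro t ht
      exact h t fun τ hτ => ih τ (by push_cast at ht; omega)
  funext t
  exact key ((t - t₀).toNat + 1) t (by push_cast; omega)

end Causal

/-! ### Encoders given by the responses to single input symbols -/

section Rows

variable {E : Type} {k : ℕ}

/-- The coefficient matrices of the encoder with rows `g τ j`. -/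
def rowMatrix (g : ℤ → Fin k → BinSeq E) : ℕ → ℤ → Matrix (Fin k) E (ZMod 2) :=
  fun a t => Matrix.of fun j e => g (t - a) j t e

theorem encode_rowMatrix (g : ℤ → Fin k → BinSeq E) (m : ℕ) (u : BinSeq (Fin k)) (t : ℤ) (e : E) :
    encode m (rowMatrix g) u t e = ∑ τ ∈ Finset.Icc (t - m) t, ∑ j, u τ j * g τ j t e := by
  simp only [encode, Finset.sum_apply, Matrix.vecMul, dotProduct, rowMatrix, Matrix.of_apply]
  refine Finset.sum_nbij' (fun a : ℕ => t - (a : ℤ)) (fun τ => (t - τ).toNat) ?_ ?_ ?_ ?_ ?_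
  · intro a ha; simp only [Finset.mem_range, Finset.mem_Icc] at *; omega
  · intro a ha; simp only [Finset.mem_range, Finset.mem_Icc] at *; omega
  · intro a ha; simp only [Finset.mem_range] at *; omega
  · intro a ha; simp only [Finset.mem_Icc] at *; omega
  · intro a ha; rfl

theorem encode_rowMatrix_eq_sum (g : ℤ → Fin k → BinSeq E) (m : ℕ)
    (hg : ∀ (τ : ℤ) j (t : ℤ), (t < τ ∨ τ + m < t) → g τ j t = 0) (u : BinSeq (Fin k)) (t lo hi : ℤ) (e : E)
    (hlo : lo ≤ t - m) (hhi : t ≤ hi) :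
    encode m (rowMatrix g) u t e = ∑ τ ∈ Finset.Icc lo hi, ∑ j, u τ j * g τ j t e := by
  rw [encode_rowMatrix]
  refine Finset.sum_subset (Finset.Icc_subset_Icc hlo hhi) fun τ _ hτ => ?_
  refine Finset.sum_eq_zero fun j _ => ?_
  rw [hg τ j t (by simp only [Finset.mem_Icc] at hτ; omega)]
  simp

end Rows

/-! ### Codes defined by systematic checks, and their feedforward encoders -/

section CheckCode

variable {E P : Type} [Fintype E]

/-- The sequence whose only nonzero symbol is at time `t` in position `e`. -/
def impulse {E : Type} [DecidableEq E] (t : ℤ) (e : E) : BinSeq E := Pi.single t (Pi.single e 1)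

theorem impulse_of_ne {E : Type} [DecidableEq E] {t τ : ℤ} (h : τ ≠ t) (e : E) :
    impulse t e τ = 0 := Pi.single_eq_of_ne h _

theorem impulse_apply {E : Type} [DecidableEq E] (t τ : ℤ) (e e' : E) :
    impulse t e τ e' = if τ = t ∧ e' = e then 1 else 0 := by
  unfold impulse
  by_cases h : τ = t
  · subst h; by_cases h' : e' = e
    · subst h'; simp
    · simp [h']
  · simp [h]

/-- The syndrome at time `t` of the check `p`: the symbol at `piv p` plus a combination, with
coefficients `h t p`, of the symbols in the `K` preceding blocks of `B` time units. -/
noncomputable def syndrome (B K : ℕ) (piv : P → E) (h : ℤ → P → ℤ → E → ZMod 2) (t : ℤ) (p : P) :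
    BinSeq E →ₗ[ZMod 2] ZMod 2 where
  toFun v := v t (piv p) +
    ∑ t' ∈ Finset.Ico ((t / B - K) * B) (t / B * B), ∑ e, h t p t' e * v t' e
  map_add' v w := by
    simp only [Pi.add_apply, mul_add, Finset.sum_add_distrib]; ring
  map_smul' a v := by
    simp only [Pi.smul_apply, smul_eq_mul, RingHom.id_apply, mul_add, Finset.mul_sum]
    congr 1
    exact Finset.sum_congr rfl fun _ _ => Finset.sum_congr rfl fun _ _ => by ring

theorem syndrome_apply (B K : ℕ) (piv : P → E) (h : ℤ → P → ℤ → E → ZMod 2) (t : ℤ) (p : P)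
    (v : BinSeq E) : syndrome B K piv h t p v = v t (piv p) +
    ∑ t' ∈ Finset.Ico ((t / B - K) * B) (t / B * B), ∑ e, h t p t' e * v t' e := rfl

/-- The code of the sequences all of whose syndromes vanish. -/
noncomputable def checkCode (B K : ℕ) (piv : P → E) (h : ℤ → P → ℤ → E → ZMod 2) :
    Submodule (ZMod 2) (BinSeq E) where
  carrier := {v | IsLaurent v ∧ ∀ t p, syndrome B K piv h t p v = 0}
  add_mem' := by
    rintro v w ⟨⟨a, ha⟩, hv⟩ ⟨⟨b, hb⟩, hw⟩
    refine ⟨⟨min a b, fun t ht => ?_⟩, fun t p => by rw [map_add, hv, hw, add_zero]⟩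
    rw [Pi.add_apply, ha t (by omega), hb t (by omega), add_zero]
  zero_mem' := ⟨⟨0, fun _ _ => rfl⟩, fun t p => map_zero _⟩
  smul_mem' := by
    rintro a v ⟨⟨b, hb⟩, hv⟩
    refine ⟨⟨b, fun t ht => ?_⟩, fun t p => by rw [map_smul, hv, smul_zero]⟩
    rw [Pi.smul_apply, hb t ht, smul_zero]

/-- Each single symbol off the pivots, preceded by zeros, extends to a solution of all checks that
vanishes after `L` further blocks. -/
def Controllable [DecidableEq E] (B K L : ℕ) (piv : P → E) (h : ℤ → P → ℤ → E → ZMod 2) : Prop :=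
  ∀ (t : ℤ) (f : E), f ∉ Set.range piv → ∃ g : BinSeq E,
    (∀ τ p, syndrome B K piv h τ p g = 0) ∧
    (∀ τ < (t / B + 1) * B, g τ = impulse t f τ) ∧
    ∀ τ, (t / B + L + 1) * B ≤ τ → g τ = 0

theorem syndrome_congr {B K : ℕ} (hB : 0 < B) (piv : P → E) (h : ℤ → P → ℤ → E → ZMod 2) (t : ℤ)
    (p : P) {v w : BinSeq E} (hvw : ∀ τ, (t / B - K) * B ≤ τ → τ ≤ t → v τ = w τ) :
    syndrome B K piv h t p v = syndrome B K piv h t p w := by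
  have hb : (0 : ℤ) < B := by exact_mod_cast hB
  have h1 := Int.ediv_mul_le t hb.ne'
  have h2 : (t / B - K) * (B : ℤ) ≤ t / B * B :=
    mul_le_mul_of_nonneg_right (by omega) hb.le
  rw [syndrome_apply, syndrome_apply, hvw t (h2.trans h1) le_rfl]
  congr 1
  refine Finset.sum_congr rfl fun τ hτ => ?_
  rw [Finset.mem_Ico] at hτ
  rw [hvw τ hτ.1 (by omega)]

/-- A check expresses its pivot symbol through strictly earlier symbols, so induction on time
applies. -/
theorem eq_zero_of_free_eq_zero {B K : ℕ} (hB : 0 < B) (piv : P → E)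
    (h : ℤ → P → ℤ → E → ZMod 2) {v : BinSeq E} (hv : v ∈ checkCode B K piv h)
    (hfree : ∀ t, ∀ f ∉ Set.range piv, v t f = 0) : v = 0 := by
  refine eq_zero_of_causal hv.1 fun t ht => ?_
  have hb : (0 : ℤ) < B := by exact_mod_cast hB
  have h1 := Int.ediv_mul_le t hb.ne'
  funext e
  by_cases he : e ∈ Set.range piv
  · obtain ⟨p, rfl⟩ := he
    have := hv.2 t p
    rw [syndrome_apply, Finset.sum_eq_zero, add_zero] at this
    · exact this
    · intro τ hτ
      rw [Finset.mem_Ico] at hτ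
      rw [ht τ (by omega)]
      simp
  · exact hfree t e he

/-- A controllable check code is a convolutional code. -/
theorem Controllable.exists_isGenerator [DecidableEq E] {B K L k : ℕ} (hB : 0 < B) {piv : P → E}
    {h : ℤ → P → ℤ → E → ZMod 2} (hc : Controllable B K L piv h)
    (φ : Fin k ≃ {e : E // e ∉ Set.range piv}) :
    ∃ G : ℕ → ℤ → Matrix (Fin k) E (ZMod 2),
      IsGenerator ((L + 1) * B) G (checkCode B K piv h) := by
  have hb : (0 : ℤ) < B := by exact_mod_cast hB
  choose! γ hγ0 hγ1 hγ2 using hc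
  let g : ℤ → Fin k → BinSeq E := fun τ j => γ τ (φ j)
  have g0 : ∀ τ j t p, syndrome B K piv h t p (g τ j) = 0 := fun τ j t p =>
    hγ0 τ (φ j) (φ j).2 t p
  have hblk : ∀ t : ℤ, t / B * B ≤ t ∧ t < (t / B + 1) * B := fun t =>
    ⟨Int.ediv_mul_le t hb.ne', Int.lt_ediv_add_one_mul_self t hb⟩
  have hsupp : ∀ (τ : ℤ) j (t : ℤ), (t < τ ∨ τ + ((L + 1) * B : ℕ) < t) → g τ j t = 0 := by
    intro τ j t ht
    obtain ⟨h1, h2⟩ := hblk τ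
    rcases ht with ht | ht
    · exact (hγ1 τ (φ j) (φ j).2 t (by omega)).trans (impulse_of_ne (by omega) _)
    · refine hγ2 τ (φ j) (φ j).2 t ?_
      push_cast at ht
      nlinarith
  -- A response agrees with its impulse until the end of the block, since corrections start only in
  -- the next block. This makes the encoder unitriangular.
  have hdiag : ∀ (τ : ℤ) j (t : ℤ) i, τ ≤ t → t < (τ / B + 1) * B →
      g τ j t (φ i) = if t = τ ∧ i = j then 1 else 0 := by
    intro τ j t i h1 h2
    change γ τ (φ j) t (φ i) = _
    rw [hγ1 τ (φ j) (φ j).2 t h2]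
    rw [impulse_apply]
    simp only [Subtype.ext_iff.symm, φ.injective.eq_iff]
  set m := (L + 1) * B with hm
  -- on the free positions the encoder is unitriangular
  have htri : ∀ u : BinSeq (Fin k), ∀ t i, encode m (rowMatrix g) u t (φ i) =
      u t i + ∑ τ ∈ Finset.Ico (t - m) t, ∑ j, u τ j * g τ j t (φ i) := by
    intro u t i
    rw [encode_rowMatrix, ← Finset.Ico_insert_right (by omega),
      Finset.sum_insert (by simp)]
    congr 1
    rw [Finset.sum_eq_single i]
    · rw [hdiag t i t i le_rfl (hblk t).2]; simp
    · intro j _ hj; rw [hdiag t j t i le_rfl (hblk t).2]; simp [hj.symm]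
    · simp
  have hlaur : ∀ u : BinSeq (Fin k), ∀ t₀, (∀ t < t₀, u t = 0) →
      ∀ t < t₀, encode m (rowMatrix g) u t = 0 := by
    intro u t₀ hu t ht
    funext e
    rw [encode_rowMatrix]
    refine Finset.sum_eq_zero fun τ hτ => Finset.sum_eq_zero fun j _ => ?_
    rw [hu τ (by rw [Finset.mem_Icc] at hτ; omega)]; simp
  have hmem : ∀ u : BinSeq (Fin k), IsLaurent u →
      encode m (rowMatrix g) u ∈ checkCode B K piv h := by
    rintro u ⟨t₀, ht₀⟩
    refine ⟨⟨t₀, hlaur u t₀ ht₀⟩, fun t p => ?_⟩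
    have : syndrome B K piv h t p (encode m (rowMatrix g) u) = syndrome B K piv h t p
        (∑ τ ∈ Finset.Icc ((t / B - K) * B - m) t, ∑ j, u τ j • g τ j) := by
      refine syndrome_congr hB piv h t p fun τ h1 h2 => ?_
      funext e
      rw [encode_rowMatrix_eq_sum g m hsupp u τ ((t / B - K) * B - m) t e (by omega) h2]
      simp [Finset.sum_apply]
    rw [this, map_sum]
    refine Finset.sum_eq_zero fun τ _ => ?_
    rw [map_sum]
    refine Finset.sum_eq_zero fun j _ => ?_
    rw [map_smul, g0, smul_zero]
  refine ⟨rowMatrix g, ⟨fun u hu h0 => ?_, fun v => ⟨fun hv => ?_, ?_⟩⟩⟩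
  · refine eq_zero_of_causal hu fun t ht => ?_
    funext i
    have := htri u t i
    rw [h0, Finset.sum_eq_zero, add_zero] at this
    · exact this.symm
    · intro τ hτ
      refine Finset.sum_eq_zero fun j _ => ?_
      rw [ht τ (Finset.mem_Ico.1 hτ).2]; simp
  -- The input is found by solving the unitriangular system on the free positions. The encoded word
  -- then differs from v by a codeword that vanishes there, hence by zero.
  · obtain ⟨t₀, ht₀⟩ := hv.1
    obtain ⟨u, hu0, hu⟩ := exists_causal t₀
      (fun t (u : BinSeq (Fin k)) i => v t (φ i) - ∑ τ ∈ Finset.Ico (t - m) t,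
        ∑ j, u τ j * g τ j t (φ i)) (by
        intro t u u' huu
        funext i
        congr 1
        refine Finset.sum_congr rfl fun τ hτ => Finset.sum_congr rfl fun j _ => ?_
        rw [huu τ (Finset.mem_Ico.1 hτ).2])
    refine ⟨u, ⟨t₀, hu0⟩, ?_⟩
    rw [← sub_eq_zero]
    refine eq_zero_of_free_eq_zero hB piv h
      (Submodule.sub_mem _ (hmem u ⟨t₀, hu0⟩) hv) fun t f hf => ?_
    obtain ⟨i, hi⟩ := φ.surjective ⟨f, hf⟩
    have hi' : f = φ i := by rw [hi]
    rw [hi', Pi.sub_apply, Pi.sub_apply]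
    by_cases ht : t < t₀
    · rw [hlaur u t₀ hu0 t ht, ht₀ t ht]; simp
    · rw [htri, congrFun (hu t (by omega)) i]; ring
  · rintro ⟨u, hu, rfl⟩
    exact hmem u hu

/-- No combination of the checks of `L + K` consecutive blocks vanishes on the first `L` of them. -/
def DualInjective [Fintype P] [DecidableEq E] (B K L : ℕ) (piv : P → E) (h : ℤ → P → ℤ → E → ZMod 2) : Prop :=
  ∀ (β : ℤ) (y : ℤ → P → ZMod 2),
    (∀ τ ∈ Finset.Ico (β * B) ((β + L) * B), ∀ e,
      ∑ t ∈ Finset.Ico (β * B) ((β + L + K) * B), ∑ p,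
        y t p * syndrome B K piv h t p (impulse τ e) = 0) →
    ∀ t ∈ Finset.Ico (β * B) ((β + L + K) * B), ∀ p, y t p = 0

/-- A proper subspace of a finite-dimensional coordinate space is annihilated by a nonzero
functional. -/
theorem surjective_of_forall_dotProduct {ι V F : Type} [Fintype ι] [DecidableEq ι] [Field F]
    [AddCommGroup V]
    [Module F V] (A : V →ₗ[F] (ι → F)) (hA : ∀ y : ι → F, (∀ z, ∑ i, y i * A z i = 0) → y = 0) :
    Function.Surjective A := by
  by_contra hs
  have hlt : LinearMap.range A < ⊤ := lt_top_iff_ne_top.2 fun h => hs (LinearMap.range_eq_top.1 h)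
  obtain ⟨f, hf, hle⟩ := Submodule.exists_le_ker_of_lt_top _ hlt
  apply hf
  have hfx : ∀ x : ι → F, f x = ∑ i, f (Pi.single i 1) * x i := by
    intro x
    conv_lhs => rw [← Finset.univ_sum_single x, map_sum]
    refine Finset.sum_congr rfl fun i _ => ?_
    have : (Pi.single i (x i) : ι → F) = x i • Pi.single i 1 := by
      rw [← Pi.single_smul]; simp
    rw [this, map_smul, smul_eq_mul, mul_comm]
  have h0 := hA (fun i => f (Pi.single i 1)) fun z => by
    rw [← hfx]; exact hle ⟨z, rfl⟩
  ext i
  simpa using congrFun h0 i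

/-- The unknowns are the symbols of the L blocks after that of the impulse, and the only checks in
doubt are those of the next L + K blocks. Earlier checks see zeros and have their pivot off f; later
ones see only zeros. The finite system is solvable for every right-hand side because its rows are
independent. -/
theorem DualInjective.controllable [Fintype P] [DecidableEq P] [DecidableEq E] {B K L : ℕ} (hB : 0 < B)
    {piv : P → E}
    {h : ℤ → P → ℤ → E → ZMod 2} (hd : DualInjective B K L piv h) :
    Controllable B K L piv h := by
  intro t f hf
  have hb : (0 : ℤ) < B := by exact_mod_cast hB
  have hblk : ∀ t : ℤ, t / B * B ≤ t ∧ t < (t / B + 1) * B := fun t =>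
    ⟨Int.ediv_mul_le t hb.ne', Int.lt_ediv_add_one_mul_self t hb⟩
  set β := t / B + 1 with hβ
  let W := Finset.Ico (β * B) ((β + L) * B)
  let Y := Finset.Ico (β * B) ((β + L + K) * B)
  let ext : ((W × E) → ZMod 2) →ₗ[ZMod 2] BinSeq E :=
    { toFun := fun z τ e => if hτ : τ ∈ W then z (⟨τ, hτ⟩, e) else 0
      map_add' := fun a b => by funext τ e; simp only [Pi.add_apply]; split_ifs <;> simp
      map_smul' := fun a b => by
        funext τ e; simp only [Pi.smul_apply, RingHom.id_apply]; split_ifs <;> simp }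
  let A : ((W × E) → ZMod 2) →ₗ[ZMod 2] ((Y × P) → ZMod 2) :=
    { toFun := fun z i => syndrome B K piv h i.1 i.2 (ext z)
      map_add' := fun a b => by funext i; simp
      map_smul' := fun a b => by funext i; simp }
  have hsurj : Function.Surjective A := by
    refine surjective_of_forall_dotProduct A fun y hy => ?_
    have := hd β (fun t p => if ht : t ∈ Y then y (⟨t, ht⟩, p) else 0) ?_
    · funext i
      have := this i.1 i.1.2 i.2
      rwa [dif_pos i.1.2] at this
    · intro τ hτ e
      have h1 := hy (Pi.single (⟨τ, hτ⟩, e) 1)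
      have h2 : ext (Pi.single (⟨τ, hτ⟩, e) 1) = impulse τ e := by
        funext τ' e'
        change (if hτ : τ' ∈ W then _ else _) = _
        rw [impulse_apply]
        by_cases h3 : τ' ∈ W
        · rw [dif_pos h3, Pi.single_apply]
          simp only [Prod.mk.injEq, Subtype.mk.injEq]
        · rw [dif_neg h3, if_neg (fun h4 : τ' = τ ∧ e' = e => h3 (h4.1 ▸ hτ))]
      rw [Fintype.sum_prod_type] at h1
      rw [← h1, ← Finset.sum_coe_sort Y]
      refine Finset.sum_congr rfl fun i _ => Finset.sum_congr rfl fun p _ => ?_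
      rw [dif_pos i.2]
      change _ = _ * syndrome B K piv h i p (ext _)
      rw [h2]
  obtain ⟨z, hz⟩ := hsurj fun i =>
    syndrome B K piv h i.1 i.2 (impulse t f)
  have hext : ∀ τ ∉ W, ext z τ = 0 := fun τ hτ => by
    funext e; change (if hτ : τ ∈ W then _ else _) = _; rw [dif_neg hτ]; rfl
  have hgt : ∀ τ, (β + L) * B ≤ τ → τ ≠ t := by
    intro τ h1 h2
    subst h2
    have := (hblk τ).2
    nlinarith [mul_nonneg (Nat.cast_nonneg (α := ℤ) L) hb.le]
  have hlow : ∀ τ < β * B,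
      (impulse t f + ext z) τ = impulse t f τ := by
    intro τ hτ
    rw [Pi.add_apply, hext τ (by rw [Finset.mem_Ico]; omega), add_zero]
  have hhigh : ∀ τ, (β + L) * B ≤ τ → (impulse t f + ext z : BinSeq E) τ = 0 := by
    intro τ hτ
    rw [Pi.add_apply, hext τ (by rw [Finset.mem_Ico]; omega), impulse_of_ne (hgt τ hτ),
      add_zero]
  refine ⟨impulse t f + ext z, fun τ p => ?_, hlow, fun τ hτ => ?_⟩
  · by_cases h1 : τ < β * B
    · -- the checks of the first block see only zeros
      have hq : τ / B ≤ t / B := by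
        have := Int.ediv_lt_of_lt_mul hb h1
        omega
      have h0 : τ / B * B ≤ t := le_trans (mul_le_mul_of_nonneg_right hq hb.le) (hblk t).1
      rw [syndrome_congr hB piv h τ p (w := impulse t f)
        (fun τ' _ h3 => hlow τ' (by omega)), syndrome_apply, Finset.sum_eq_zero, add_zero]
      · rw [impulse_apply, if_neg (fun hh => hf ⟨p, hh.2⟩)]
      · intro τ' hτ'
        rw [Finset.mem_Ico] at hτ'
        rw [impulse_of_ne (by omega)]; simp
    · by_cases h2 : τ < (β + L + K) * B
      · have hτ : τ ∈ Y := Finset.mem_Ico.2 ⟨by omega, h2⟩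
        have := congrFun hz (⟨τ, hτ⟩, p)
        rw [map_add]
        change syndrome B K piv h τ p (ext z) = _ at this
        rw [this]
        exact CharTwo.add_self_eq_zero _
      · have hq : β + L + K ≤ τ / B := (Int.le_ediv_iff_mul_le hb).2 (by omega)
        have hle : (β + L) * B ≤ (τ / B - K) * (B : ℤ) :=
          mul_le_mul_of_nonneg_right (by omega) hb.le
        rw [syndrome_congr hB piv h τ p (w := 0)
          (fun τ' h3 _ => hhigh τ' (hle.trans h3)), map_zero]
  · refine hhigh τ ?_
    convert hτ using 2
    omega

end CheckCode

/-! ### Inserting zero tuples to adjust the memory exactly -/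

section Gap

variable {ι : Type}

/-- Insertion of `g` all-zero tuples at time `0`. -/
def gap (g : ℕ) : BinSeq ι →ₗ[ZMod 2] BinSeq ι where
  toFun v t := if t < 0 then v t else if t < g then 0 else v (t - g)
  map_add' v w := by funext t; simp only [Pi.add_apply]; split_ifs <;> simp
  map_smul' a v := by funext t; simp only [Pi.smul_apply, RingHom.id_apply]; split_ifs <;> simp

theorem gap_apply (g : ℕ) (v : BinSeq ι) (t : ℤ) :
    gap g v t = if t < 0 then v t else if t < g then 0 else v (t - g) := rfl

theorem gap_eq_zero (g : ℕ) (v : BinSeq ι) {t : ℤ} (h0 : 0 ≤ t) (hg : t < g) : gap g v t = 0 := by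
  rw [gap_apply, if_neg (by omega), if_pos hg]

/-- Removal of the tuples at the times in `[0, g)`. -/
def ungap (g : ℕ) (v : BinSeq ι) : BinSeq ι := fun t => if t < 0 then v t else v (t + g)

theorem ungap_gap (g : ℕ) (v : BinSeq ι) : ungap g (gap g v) = v := by
  funext t
  unfold ungap
  split_ifs with h
  · rw [gap_apply, if_pos h]
  · rw [gap_apply, if_neg (by omega), if_neg (by omega), add_sub_cancel_right]

theorem gap_ungap (g : ℕ) (v : BinSeq ι) (hv : ∀ t : ℤ, 0 ≤ t → t < g → v t = 0) :
    gap g (ungap g v) = v := by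
  funext t
  rw [gap_apply]
  unfold ungap
  split_ifs with h1 h2 h3
  · rfl
  · exact (hv t (by omega) h2).symm
  · omega
  · rw [sub_add_cancel]

theorem gap_injective (g : ℕ) : Function.Injective (gap g : BinSeq ι →ₗ[ZMod 2] BinSeq ι) :=
  fun v w h => by rw [← ungap_gap g v, h, ungap_gap]

theorem gap_zero (v : BinSeq ι) : gap 0 v = v := by
  funext t
  rw [gap_apply]
  split_ifs
  · rfl
  · omega
  · simp

theorem gap_gap (g : ℕ) (v : BinSeq ι) : gap 1 (gap g v) = gap (g + 1) v := by
  funext t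
  simp only [gap_apply]
  push_cast
  split_ifs <;> first | rfl | omega | (congr 1; omega)

theorem map_gap_succ (g : ℕ) (C : Submodule (ZMod 2) (BinSeq ι)) :
    (C.map (gap g)).map (gap 1) = C.map (gap (g + 1)) := by
  rw [← Submodule.map_comp]
  congr 1
  ext1 v
  exact gap_gap g v

theorem weight_gap (g : ℕ) (v : BinSeq ι) : weight (gap g v) = weight v := by
  unfold weight
  have hinj : Function.Injective
      (fun p : ℤ × ι => ((if p.1 < 0 then p.1 else p.1 + g, p.2) : ℤ × ι)) := by
    rintro ⟨a, i⟩ ⟨b, j⟩ h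
    simp only [Prod.mk.injEq] at h ⊢
    refine ⟨?_, h.2⟩
    have := h.1
    split_ifs at this <;> omega
  rw [← hinj.encard_image {p : ℤ × ι | v p.1 p.2 ≠ 0}]
  congr 1
  ext ⟨t, i⟩
  simp only [Set.mem_ofPred_eq, Set.mem_image, Prod.mk.injEq, Prod.exists, gap_apply]
  constructor
  · intro h
    by_cases h1 : t < 0
    · rw [if_pos h1] at h
      exact ⟨t, i, h, by rw [if_pos h1], rfl⟩
    · rw [if_neg h1] at h
      by_cases h2 : t < g
      · rw [if_pos h2] at h; exact absurd rfl h
      · rw [if_neg h2] at h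
        exact ⟨t - g, i, h, by rw [if_neg (by omega)]; omega, rfl⟩
  · rintro ⟨a, j, h, rfl, rfl⟩
    by_cases h1 : a < 0
    · rw [if_pos h1, if_pos h1]; exact h
    · rw [if_neg h1, if_neg (by omega), if_neg (by omega), add_sub_cancel_right]; exact h

theorem freeDistance_map_gap (g : ℕ) (C : Submodule (ZMod 2) (BinSeq ι)) :
    freeDistance (C.map (gap g)) = freeDistance C := by
  unfold freeDistance
  refine le_antisymm (le_iInf₂ fun v hv => ?_) (le_iInf₂ fun v hv => ?_)
  · rw [← weight_gap g v]
    refine iInf₂_le (gap g v) ⟨Submodule.mem_map_of_mem hv.1, fun h => hv.2 ?_⟩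
    exact gap_injective g (h.trans (map_zero _).symm)
  · obtain ⟨⟨w, hw, rfl⟩, h0⟩ := hv
    rw [weight_gap g w]
    exact iInf₂_le w ⟨hw, fun h => h0 (by rw [h, map_zero])⟩

theorem IsGenerator.mono {k m m' : ℕ} {G : ℕ → ℤ → Matrix (Fin k) ι (ZMod 2)}
    {C : Submodule (ZMod 2) (BinSeq ι)} (hG : IsGenerator m G C) (hm : m ≤ m') :
    ∃ G' : ℕ → ℤ → Matrix (Fin k) ι (ZMod 2), IsGenerator m' G' C := by
  have h : ∀ u, encode m' (fun a t => if a ≤ m then G a t else 0) u = encode m G u := by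
    intro u
    funext t
    unfold encode
    symm
    rw [← Finset.sum_subset (Finset.range_subset_range.2 (Nat.succ_le_succ hm))]
    · refine Finset.sum_congr rfl fun a ha => ?_
      beta_reduce
      rw [if_pos (by rw [Finset.mem_range] at ha; omega)]
    · intro a _ ha
      beta_reduce
      rw [if_neg (by rw [Finset.mem_range] at ha; omega), Matrix.vecMul_zero]
  exact ⟨_, fun u hu h0 => hG.1 u hu (by rwa [h] at h0), fun v => by simp only [h]; exact hG.2 v⟩

/-- Inserting one zero tuple raises the memory by at most one. -/
theorem IsGenerator.gap_one {k m : ℕ} {G : ℕ → ℤ → Matrix (Fin k) ι (ZMod 2)}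
    {C : Submodule (ZMod 2) (BinSeq ι)} (hG : IsGenerator m G C) :
    ∃ G' : ℕ → ℤ → Matrix (Fin k) ι (ZMod 2), IsGenerator (m + 1) G' (C.map (gap 1)) := by
  let G' : ℕ → ℤ → Matrix (Fin k) ι (ZMod 2) := fun a t =>
    if t < 0 then (if a ≤ m then G a t else 0)
    else if t < 1 then 0 else (if a = 0 then 0 else G (a - 1) (t - 1))
  have h : ∀ u, encode (m + 1) G' u = gap 1 (encode m G u) := by
    intro u
    funext t
    rw [gap_apply]
    unfold encode
    simp only [G']
    by_cases h1 : t < 0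
    · simp only [h1, if_true]
      rw [Finset.sum_range_succ, if_neg (by omega), Matrix.vecMul_zero, add_zero]
      refine Finset.sum_congr rfl fun a ha => ?_
      rw [if_pos (by rw [Finset.mem_range] at ha; omega)]
    · by_cases h2 : t < 1
      · simp [h1, h2]
      · simp only [h1, h2, if_false, Nat.cast_one]
        rw [Finset.sum_range_succ', if_pos rfl, Matrix.vecMul_zero, add_zero]
        refine Finset.sum_congr rfl fun a _ => ?_
        rw [if_neg (by omega), Nat.add_sub_cancel]
        congr 2
        push_cast
        ring
  refine ⟨G', fun u hu h0 => hG.1 u hu (gap_injective 1 ?_), fun v => ?_⟩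
  · rw [← h, h0, map_zero]
  · simp only [h, Submodule.mem_map, hG.2]
    constructor
    · rintro ⟨w, ⟨u, hu, rfl⟩, rfl⟩; exact ⟨u, hu, rfl⟩
    · rintro ⟨u, hu, rfl⟩; exact ⟨_, ⟨u, hu, rfl⟩, rfl⟩

/-- With memory m, an impulse at time 0 can only produce output at times 0 to m, all inside the gap,
so it would be encoded as zero. -/
theorem not_isGenerator_map_gap {k m : ℕ} (hk : 0 < k) (C : Submodule (ZMod 2) (BinSeq ι))
    (G : ℕ → ℤ → Matrix (Fin k) ι (ZMod 2)) : ¬ IsGenerator m G (C.map (gap (m + 1))) := by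
  intro hG
  have hL : IsLaurent (impulse 0 (⟨0, hk⟩ : Fin k)) := ⟨0, fun t ht => impulse_of_ne (by omega) _⟩
  have h0 : encode m G (impulse 0 (⟨0, hk⟩ : Fin k)) = 0 := by
    obtain ⟨w, -, hw⟩ := (hG.2 _).2 ⟨_, hL, rfl⟩
    funext t
    by_cases ht : 0 ≤ t ∧ t < ((m + 1 : ℕ) : ℤ)
    · rw [← hw, gap_eq_zero _ _ ht.1 ht.2]; rfl
    · unfold encode
      refine Finset.sum_eq_zero fun a ha => ?_
      rw [Finset.mem_range] at ha
      rw [impulse_of_ne (by push_cast at ht; omega), Matrix.zero_vecMul]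
  have := congrFun (congrFun (hG.1 _ hL h0) 0) ⟨0, hk⟩
  rw [impulse_apply] at this
  simp at this

/-- Every memory above that of a given generator is the exact memory of a gapped version. -/
theorem exists_hasMemory_map_gap {k M m : ℕ} (hk : 0 < k) {C : Submodule (ZMod 2) (BinSeq ι)}
    {G : ℕ → ℤ → Matrix (Fin k) ι (ZMod 2)} (hG : IsGenerator M G C) (hM : M < m) :
    ∃ g : ℕ, HasMemory k (C.map (gap g)) m := by
  classical
  let Q : ℕ → ℕ → Prop := fun g μ =>
    ∃ G : ℕ → ℤ → Matrix (Fin k) ι (ZMod 2), IsGenerator μ G (C.map (gap g))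
  have hmono : ∀ g μ μ', μ ≤ μ' → Q g μ → Q g μ' := fun g μ μ' h ⟨G, hG⟩ => hG.mono h
  have hstep : ∀ g μ, Q g μ → Q (g + 1) (μ + 1) := by
    rintro g μ ⟨G, hG⟩
    have := hG.gap_one
    rwa [map_gap_succ] at this
  have hzero : Q 0 M := by
    refine ⟨G, ?_⟩
    have : (gap 0 : BinSeq ι →ₗ[ZMod 2] BinSeq ι) = LinearMap.id := LinearMap.ext gap_zero
    rw [this, Submodule.map_id]
    exact hG
  have hex : ∃ g, ¬ Q g (m - 1) := by
    refine ⟨m - 1 + 1, ?_⟩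
    rintro ⟨G, hG⟩
    exact not_isGenerator_map_gap hk C G hG
  -- The least gap length g for which memory m - 1 no longer suffices is positive. With g - 1 zero
  -- tuples memory m - 1 suffices, hence memory m suffices with g.
  have hfind := Nat.find_spec hex
  refine ⟨Nat.find hex, ?_, ?_⟩
  · obtain ⟨g, hg⟩ : ∃ g, Nat.find hex = g + 1 := by
      refine Nat.exists_eq_succ_of_ne_zero fun h0 => ?_
      rw [h0] at hfind
      exact hfind (hmono 0 M _ (by omega) hzero)
    have hQ : Q g (m - 1) := by
      by_contra hc
      have := Nat.find_min' hex hc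
      omega
    have := hstep g _ hQ
    rw [hg]
    change Q (g + 1) m
    rwa [Nat.sub_add_cancel (by omega)] at this
  · rintro μ hμ
    by_contra hlt
    exact hfind (hmono _ μ _ (by omega) hμ)

theorem IsConvolutional.map_gap {k : ℕ} {C : Submodule (ZMod 2) (BinSeq ι)}
    (hC : IsConvolutional k C) (g : ℕ) : IsConvolutional k (C.map (gap g)) := by
  induction g with
  | zero =>
    have : (gap 0 : BinSeq ι →ₗ[ZMod 2] BinSeq ι) = LinearMap.id := LinearMap.ext gap_zero
    rwa [this, Submodule.map_id]
  | succ g ih =>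
    obtain ⟨m, G, hG⟩ := ih
    obtain ⟨G', hG'⟩ := hG.gap_one
    rw [map_gap_succ] at hG'
    exact ⟨_, G', hG'⟩

/-- The woven graph code with all constituent codes gapped at the same time. -/
def WovenGraphCode.gapped {s n b c : ℕ} (W : WovenGraphCode s n b c) (g : ℕ) :
    WovenGraphCode s n b c where
  graph := W.graph
  port := W.port
  constituent i t := (W.constituent i t).map (gap g)
  isConvolutional i t := (W.isConvolutional i t).map_gap g

theorem WovenGraphCode.localWord_gap {s n b c : ℕ} (W : WovenGraphCode s n b c) (g : ℕ)
    (i : Fin s) (t : Fin n) (v : BinSeq (Fin (n * c))) :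
    W.localWord i t (gap g v) = gap g (W.localWord i t v) := by
  funext τ j
  simp only [localWord, gap_apply]
  split_ifs <;> rfl

/-- Every hyperedge lies on a vertex of part 0, so local words that vanish in the gap force the
whole word to vanish there. -/
theorem WovenGraphCode.code_gapped {s n b c : ℕ} (hs : 0 < s) (W : WovenGraphCode s n b c)
    (g : ℕ) : (W.gapped g).code = W.code.map (gap g) := by
  ext v
  constructor
  · intro hv
    have h0 : ∀ τ : ℤ, 0 ≤ τ → τ < g → v τ = 0 := by
      intro τ h1 h2
      funext e
      obtain ⟨w, -, hw⟩ := hv ⟨0, hs⟩ (W.graph.vertex ⟨0, hs⟩ e)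
      obtain ⟨j, hj⟩ := (W.port ⟨0, hs⟩ (W.graph.vertex ⟨0, hs⟩ e)).surjective ⟨e, rfl⟩
      have h3 := congrFun (congrFun hw τ) j
      rw [gap_eq_zero g w h1 h2] at h3
      have h4 : (W.gapped g).localWord ⟨0, hs⟩ (W.graph.vertex ⟨0, hs⟩ e) v τ j =
          v τ (W.port ⟨0, hs⟩ (W.graph.vertex ⟨0, hs⟩ e) j).1 := rfl
      rw [h4, hj] at h3
      exact h3.symm
    refine ⟨ungap g v, fun i t => ?_, gap_ungap g v h0⟩
    obtain ⟨w, hw, hwv⟩ := hv i t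
    have h1 : gap g w = gap g (W.localWord i t (ungap g v)) := by
      rw [← W.localWord_gap, gap_ungap g v h0, hwv]; rfl
    rw [← gap_injective g h1]
    exact hw
  · rintro ⟨w, hw, rfl⟩ i t
    exact ⟨_, hw i t, (W.localWord_gap g i t w).symm⟩

end Gap

open Finset

/-! ### Counting blocks near a set of active blocks -/

section Runs

/-- The integers of `[0, M)` that follow an element of `S` within distance `K`. -/
noncomputable def followers (K M : ℕ) (S : Finset ℤ) : Finset ℤ :=
  {γ ∈ Ico 0 (M : ℤ) | ∃ a ∈ S, a < γ ∧ γ ≤ a + K}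

theorem mem_followers {K M : ℕ} {S : Finset ℤ} {γ : ℤ} :
    γ ∈ followers K M S ↔ (0 ≤ γ ∧ γ < M) ∧ ∃ a ∈ S, a < γ ∧ γ ≤ a + K := by
  simp [followers]

/-- The successors of the elements of S are followers, and the last element has K - 1 further ones.
Room for these below M is what termination means. -/
theorem card_add_le_card_followers {K M : ℕ} (hK : 0 < K) {S : Finset ℤ} (hS : S.Nonempty)
    (hSM : ∀ a ∈ S, 0 ≤ a ∧ a + K < M) : #S + K ≤ #(followers K M S) + 1 := by
  have hmax := S.max'_mem hS
  set a := S.max' hS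
  have hsub : (S.image (· + 1)) ∪ Ioc (a + 1) (a + K) ⊆ followers K M S := by
    intro γ hγ
    rw [mem_followers]
    rcases mem_union.1 hγ with h | h
    · obtain ⟨x, hx, rfl⟩ := mem_image.1 h
      have := hSM x hx
      exact ⟨by omega, x, hx, by omega, by omega⟩
    · rw [mem_Ioc] at h
      have := hSM a hmax
      exact ⟨by omega, a, hmax, by omega, by omega⟩
  have hdis : Disjoint (S.image (· + 1)) (Ioc (a + 1) (a + K)) := by
    rw [disjoint_left]
    intro γ h1 h2
    obtain ⟨x, hx, rfl⟩ := mem_image.1 h1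
    have := S.le_max' x hx
    rw [mem_Ioc] at h2
    omega
  have := card_le_card hsub
  rw [card_union_of_disjoint hdis, card_image_of_injective _ (add_left_injective 1),
    Int.card_Ioc] at this
  omega

/-- Without termination the successor of at most one element falls outside the window. -/
theorem card_le_card_followers {K M : ℕ} (hK : 0 < K) {S : Finset ℤ}
    (hSM : ∀ a ∈ S, 0 ≤ a ∧ a < M) : #S ≤ #(followers K M S) + 1 := by
  have hsub : S.image (· + 1) ⊆ insert (M : ℤ) (followers K M S) := by
    intro γ hγ
    obtain ⟨x, hx, rfl⟩ := mem_image.1 hγ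
    have := hSM x hx
    rw [mem_insert, mem_followers]
    by_cases h : x + 1 = M
    · exact Or.inl h
    · exact Or.inr ⟨by omega, x, hx, by omega, by omega⟩
  have := card_le_card hsub
  rw [card_image_of_injective _ (add_left_injective 1)] at this
  exact this.trans (card_insert_le _ _)

/-- The integers of `[0, L)` that precede an element of `S` within distance `K`. -/
noncomputable def predecessors (K L : ℕ) (S : Finset ℤ) : Finset ℤ :=
  {γ ∈ Ico 0 (L : ℤ) | ∃ a ∈ S, γ < a ∧ a ≤ γ + K}

theorem mem_predecessors {K L : ℕ} {S : Finset ℤ} {γ : ℤ} :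
    γ ∈ predecessors K L S ↔ (0 ≤ γ ∧ γ < L) ∧ ∃ a ∈ S, γ < a ∧ a ≤ γ + K := by
  simp [predecessors]

/-- This is the per-vertex count behind the independence of the checks. If every block of [0, L)
precedes S, the claim is the choice of L. Otherwise take the last block γ that does not: S avoids
the K blocks after γ, so above γ it has at most as many elements as there are predecessors, and ρ <
c suffices. -/
theorem mul_card_lt_mul_card_predecessors {K L ρ c : ℕ} (hρc : ρ < c)
    (hL : ρ * (L + K) < c * L) {S : Finset ℤ} (hS : S ⊆ Ico 0 ((L : ℤ) + K))
    (hfin : {a ∈ S | (L : ℤ) ≤ a}.Nonempty) :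
    ρ * (#{a ∈ S | a ∈ predecessors K L S} + #{a ∈ S | (L : ℤ) ≤ a}) <
      c * #(predecessors K L S) := by
  set U := predecessors K L S with hU
  have hUsub : U ⊆ Ico 0 (L : ℤ) := filter_subset _ _
  by_cases hall : U = Ico 0 (L : ℤ)
  · have hcard : #U = L := by rw [hall, Int.card_Ico]; omega
    rw [hcard]
    refine lt_of_le_of_lt (Nat.mul_le_mul_left ρ ?_) hL
    have h1 : #{a ∈ S | a ∈ U} ≤ L := by
      rw [← hcard]; exact card_le_card fun a ha => (mem_filter.1 ha).2
    have h2 : #{a ∈ S | (L : ℤ) ≤ a} ≤ K := by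
      calc _ ≤ #(Ico (L : ℤ) (L + K)) := card_le_card fun a ha => by
            rw [mem_filter] at ha
            exact mem_Ico.2 ⟨ha.2, (mem_Ico.1 (hS ha.1)).2⟩
        _ = K := by rw [Int.card_Ico]; omega
    omega
  · obtain ⟨hne⟩ : Nonempty ((Ico 0 (L : ℤ)) \ U).Nonempty := by
      refine ⟨sdiff_nonempty.2 fun h => hall (hUsub.antisymm h)⟩
    have hmem := max'_mem _ hne
    set γ := ((Ico 0 (L : ℤ)) \ U).max' hne with hγ
    rw [mem_sdiff, mem_Ico] at hmem
    have hgap : ∀ a ∈ S, γ < a → γ + K < a := by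
      intro a ha h1
      by_contra h2
      exact hmem.2 (mem_predecessors.2 ⟨hmem.1, a, ha, h1, by omega⟩)
    have habove : Ico (γ + 1) (L : ℤ) ⊆ U := by
      intro x hx
      rw [mem_Ico] at hx
      by_contra h
      have := le_max' ((Ico 0 (L : ℤ)) \ U) x (mem_sdiff.2 ⟨mem_Ico.2 (by omega), h⟩)
      omega
    -- the elements of `S` above the last gap, and those of `U` there
    have hA : #{a ∈ S | γ < a} ≤ #{a ∈ U | γ < a} := by
      have h1 : {a ∈ S | γ < a} ⊆ Ico (γ + K + 1) ((L : ℤ) + K) := by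
        intro a ha
        rw [mem_filter] at ha
        have := hgap a ha.1 ha.2
        have := mem_Ico.1 (hS ha.1)
        exact mem_Ico.2 ⟨by omega, by omega⟩
      have h2 : Ico (γ + 1) (L : ℤ) ⊆ {a ∈ U | γ < a} := fun x hx =>
        mem_filter.2 ⟨habove hx, by rw [mem_Ico] at hx; omega⟩
      have h3 := card_le_card h1
      have h4 := card_le_card h2
      rw [Int.card_Ico] at h3 h4
      omega
    have hpos : 0 < #{a ∈ S | γ < a} := by
      obtain ⟨a, ha⟩ := hfin
      rw [mem_filter] at ha
      exact card_pos.2 ⟨a, mem_filter.2 ⟨ha.1, by omega⟩⟩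
    have hB : #{a ∈ S | a ∈ U} + #{a ∈ S | (L : ℤ) ≤ a} ≤
        #{a ∈ U | ¬ γ < a} + #{a ∈ S | γ < a} := by
      rw [← card_union_of_disjoint, ← card_union_of_disjoint]
      · refine card_le_card fun a ha => ?_
        simp only [mem_union, mem_filter] at ha ⊢
        by_cases h : γ < a
        · rcases ha with ha | ha
          · exact Or.inr ⟨ha.1, h⟩
          · exact Or.inr ⟨ha.1, h⟩
        · rcases ha with ha | ha
          · exact Or.inl ⟨ha.2, h⟩
          · omega
      · rw [disjoint_left]; intro a h1 h2
        exact (mem_filter.1 h1).2 (mem_filter.1 h2).2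
      · rw [disjoint_left]; intro a h1 h2
        have h3 := mem_Ico.1 (hUsub (mem_filter.1 h1).2)
        have h4 := (mem_filter.1 h2).2
        omega
    have hsplit : #{a ∈ U | γ < a} + #{a ∈ U | ¬ γ < a} = #U :=
      card_filter_add_card_filter_not _
    calc _ ≤ ρ * #U := Nat.mul_le_mul_left ρ (by omega)
      _ < c * #U := Nat.mul_lt_mul_of_pos_right hρc (by omega)

end Runs

/-! ### Activity patterns on a hypergraph: how many checks, or symbols, they reach -/

/-- A regular partite hypergraph on the edge set `E` in which `r` incident edges, the pivots, are
assigned to each vertex in such a way that they are distinct and that all vertices have the same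
number of incident edges that are not pivots. -/
structure PivotedHypergraph (E : Type) [Fintype E] [DecidableEq E] (s n c r : ℕ) where
  vx : Fin s → E → Fin n
  piv : (Fin s × Fin n) × Fin r → E
  card_fiber : ∀ i τ, #{e | vx i e = τ} = c
  piv_injective : Function.Injective piv
  vx_piv : ∀ p, vx p.1.1 (piv p) = p.1.2
  card_free : ∀ i τ, #{e | vx i e = τ ∧ e ∉ Set.range piv} + s * r = c

namespace PivotedHypergraph

variable {E : Type} [Fintype E] [DecidableEq E] {s n c r : ℕ} (H : PivotedHypergraph E s n c r)

/-- Incidence of the vertex `x` and the edge `e`. -/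
abbrev Inc (x : Fin s × Fin n) (e : E) : Prop := H.vx x.1 e = x.2

/-- The vertices incident to some edge of `A`. -/
def touched (A : Finset E) : Finset (Fin s × Fin n) := {x | ∃ e ∈ A, H.Inc x e}

theorem mem_touched {A : Finset E} {x : Fin s × Fin n} :
    x ∈ H.touched A ↔ ∃ e ∈ A, H.Inc x e := by simp [touched]

/-- The blocks of `[0, M)` and the vertices whose checks see the activity pattern `S`. -/
noncomputable def seen (K M : ℕ) (S : Finset (ℤ × E)) : Finset (ℤ × (Fin s × Fin n)) :=
  {q ∈ Ico 0 (M : ℤ) ×ˢ univ | ∃ a ∈ S, H.Inc q.2 a.2 ∧ a.1 < q.1 ∧ q.1 ≤ a.1 + K}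

/-- The active blocks at the vertex `x`. -/
def activeBlocks (S : Finset (ℤ × E)) (x : Fin s × Fin n) : Finset ℤ :=
  {a ∈ S | H.Inc x a.2}.image Prod.fst

theorem mem_activeBlocks {S : Finset (ℤ × E)} {x : Fin s × Fin n} {γ : ℤ} :
    γ ∈ H.activeBlocks S x ↔ ∃ e, (γ, e) ∈ S ∧ H.Inc x e := by
  simp [activeBlocks]

theorem card_seen (K M : ℕ) (S : Finset (ℤ × E)) :
    #(H.seen K M S) = ∑ x, #(followers K M (H.activeBlocks S x)) := by
  rw [card_eq_sum_card_fiberwise (f := Prod.snd) (t := univ) (fun _ _ => by simp)]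
  refine sum_congr rfl fun x _ => ?_
  refine card_nbij' Prod.fst (fun γ => (γ, x)) ?_ ?_ ?_ ?_
  · rintro ⟨γ, y⟩ h
    simp only [seen, coe_filter, mem_filter, mem_product, mem_univ, and_true,
      Set.mem_ofPred_eq, mem_Ico] at h
    obtain ⟨⟨h1, a, ha, h2, h3⟩, rfl⟩ := h
    exact mem_followers.2 ⟨h1, a.1, H.mem_activeBlocks.2 ⟨a.2, ha, h2⟩, h3⟩
  · intro γ h
    obtain ⟨h1, a, ha, h3⟩ := mem_followers.1 h
    obtain ⟨e, he, h2⟩ := H.mem_activeBlocks.1 ha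
    simp only [seen, coe_filter, mem_filter, mem_product, mem_univ, and_true,
      Set.mem_ofPred_eq, mem_Ico]
    exact ⟨h1, (a, e), he, h2, h3⟩
  · rintro ⟨γ, y⟩ h
    simp only [coe_filter, Set.mem_ofPred_eq] at h
    rw [h.2]
  · intro γ _; rfl

theorem sum_card_filter_inc (S : Finset (ℤ × E)) : ∑ x, #{a ∈ S | H.Inc x a.2} = s * #S := by
  simp only [card_filter]
  rw [sum_comm]
  have : ∀ a ∈ S, ∑ x, (if H.Inc x a.2 then 1 else 0) = s := by
    intro a _
    rw [Fintype.sum_prod_type]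
    simp [Inc]
  rw [sum_congr rfl this, sum_const, smul_eq_mul, mul_comm]

theorem card_filter_inc_le (S : Finset (ℤ × E)) (x : Fin s × Fin n) :
    #{a ∈ S | H.Inc x a.2} ≤ c * #(H.activeBlocks S x) := by
  refine le_of_le_of_eq ?_ (congrArg (· * #(H.activeBlocks S x)) (H.card_fiber x.1 x.2))
  rw [mul_comm, ← card_product]
  refine card_le_card fun a ha => mem_product.2 ⟨?_, ?_⟩
  · exact mem_image_of_mem _ ha
  · exact mem_filter.2 ⟨mem_univ _, (mem_filter.1 ha).2⟩

theorem mem_touched_iff (S : Finset (ℤ × E)) (x : Fin s × Fin n) :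
    x ∈ H.touched (S.image Prod.snd) ↔ (H.activeBlocks S x).Nonempty := by
  simp only [touched, mem_filter, mem_univ, true_and, mem_image, Finset.Nonempty,
    mem_activeBlocks]
  constructor
  · rintro ⟨e, ⟨a, ha, rfl⟩, h⟩; exact ⟨a.1, a.2, ha, h⟩
  · rintro ⟨γ, e, he, h⟩; exact ⟨e, ⟨_, he, rfl⟩, h⟩

/-- Terminated patterns: each touched vertex sees `K - 1` blocks more than it carries. -/
theorem le_card_seen_of_terminated {K M : ℕ} (hK : 0 < K) {S : Finset (ℤ × E)}
    (hS : ∀ a ∈ S, 0 ≤ a.1 ∧ a.1 + K < M) :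
    s * #S + c * ((K - 1) * #(H.touched (S.image Prod.snd))) ≤ c * #(H.seen K M S) := by
  rw [H.card_seen, ← H.sum_card_filter_inc S, mul_sum, card_eq_sum_ones, mul_sum, mul_sum,
    ← sum_filter_add_sum_filter_not univ (fun x => x ∈ H.touched (S.image Prod.snd))
      (fun x => c * #(followers K M (H.activeBlocks S x)))]
  have hsplit := sum_filter_add_sum_filter_not univ (fun x => x ∈ H.touched (S.image Prod.snd))
      (fun x => #{a ∈ S | H.Inc x a.2})
  have hzero : ∑ x with x ∉ H.touched (S.image Prod.snd), #{a ∈ S | H.Inc x a.2} = 0 := by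
    refine sum_eq_zero fun x hx => ?_
    have h1 : ¬ (H.activeBlocks S x).Nonempty := fun h =>
      (mem_filter.1 hx).2 ((H.mem_touched_iff S x).2 h)
    have h2 := H.card_filter_inc_le S x
    rw [not_nonempty_iff_eq_empty.1 h1, card_empty, mul_zero] at h2
    omega
  rw [← hsplit, hzero, add_zero]
  -- Untouched vertices carry nothing and are dropped on both sides.
  refine le_trans ?_ (Nat.le_add_right _ _)
  rw [filter_mem_eq_inter, univ_inter, ← sum_add_distrib]
  refine sum_le_sum fun x hx => ?_
  have h1 := card_add_le_card_followers (M := M) hK ((H.mem_touched_iff S x).1 hx) (by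
    intro γ hγ
    obtain ⟨e, he, -⟩ := H.mem_activeBlocks.1 hγ
    exact hS _ he)
  calc _ ≤ c * #(H.activeBlocks S x) + c * ((K - 1) * 1) :=
        Nat.add_le_add_right (H.card_filter_inc_le S x) _
    _ = c * (#(H.activeBlocks S x) + (K - 1)) := by ring
    _ ≤ _ := Nat.mul_le_mul_left c (by omega)

/-- Without termination each vertex loses at most one block at the end of the window; the total loss
does not grow with S. -/
theorem le_card_seen {K M : ℕ} (hK : 0 < K) {S : Finset (ℤ × E)}
    (hS : ∀ a ∈ S, 0 ≤ a.1 ∧ a.1 < M) :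
    s * #S ≤ c * #(H.seen K M S) + c * (s * n) := by
  rw [H.card_seen, ← H.sum_card_filter_inc S, mul_sum]
  have hsn : c * (s * n) = ∑ _x : Fin s × Fin n, c := by simp [mul_comm]
  rw [hsn, ← sum_add_distrib]
  refine sum_le_sum fun x _ => (H.card_filter_inc_le S x).trans ?_
  have h1 := card_le_card_followers (S := H.activeBlocks S x) (M := M) hK (by
    intro γ hγ
    obtain ⟨e, he, -⟩ := H.mem_activeBlocks.1 hγ
    exact hS _ he)
  calc _ ≤ c * (#(followers K M (H.activeBlocks S x)) + 1) := Nat.mul_le_mul_left c h1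
    _ = _ := by ring

/-- Terminated patterns on few edges. -/
theorem le_card_seen_of_card_le {K M : ℕ} (hK : 0 < K) {S : Finset (ℤ × E)} (hne : S.Nonempty)
    (hS : ∀ a ∈ S, 0 ≤ a.1 ∧ a.1 + K < M) (hA : #(S.image Prod.snd) ≤ s * r) :
    #S + s * r * (K - 1) ≤ r * #(H.seen K M S) := by
  set Γ := S.image Prod.fst with hΓ
  have hU := card_add_le_card_followers (M := M) (S := Γ) hK (hne.image _) (by
    intro γ hγ
    obtain ⟨a, ha, rfl⟩ := mem_image.1 hγ
    exact hS a ha)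
  have hcard : #S ≤ #Γ * #(S.image Prod.snd) := by
    rw [← card_product]
    exact card_le_card fun a ha => mem_product.2 ⟨mem_image_of_mem _ ha, mem_image_of_mem _ ha⟩
  -- Each edge has a vertex in part i, so every block following an active one is seen by some vertex
  -- of each part.
  have hpart : ∀ i : Fin s, #(followers K M Γ) ≤
      ∑ τ, #(followers K M (H.activeBlocks S (i, τ))) := by
    intro i
    refine le_trans (card_le_card fun γ hγ => ?_) card_biUnion_le
    obtain ⟨h1, b, hb, h2⟩ := mem_followers.1 hγ
    obtain ⟨a, ha, rfl⟩ := mem_image.1 hb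
    exact mem_biUnion.2 ⟨H.vx i a.2, mem_univ _, mem_followers.2
      ⟨h1, a.1, H.mem_activeBlocks.2 ⟨a.2, ha, rfl⟩, h2⟩⟩
  have hseen : s * #(followers K M Γ) ≤ #(H.seen K M S) := by
    rw [H.card_seen, Fintype.sum_prod_type]
    calc s * #(followers K M Γ) = ∑ _i : Fin s, #(followers K M Γ) := by simp
      _ ≤ _ := sum_le_sum fun i _ => hpart i
  calc #S + s * r * (K - 1) ≤ #Γ * (s * r) + s * r * (K - 1) :=
        Nat.add_le_add_right (hcard.trans (Nat.mul_le_mul_left _ hA)) _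
    _ = r * (s * (#Γ + (K - 1))) := by ring
    _ ≤ r * (s * #(followers K M Γ)) :=
        Nat.mul_le_mul_left r (Nat.mul_le_mul_left s (by omega))
    _ ≤ _ := Nat.mul_le_mul_left r hseen

/-- The blocks of `[0, L)` and the edges that are seen by a check of the pattern `S`. -/
noncomputable def columns (K L : ℕ) (S : Finset (ℤ × ((Fin s × Fin n) × Fin r))) :
    Finset (ℤ × E) :=
  {q ∈ Ico 0 (L : ℤ) ×ˢ univ | ∃ a ∈ S, H.Inc a.2.1 q.2 ∧ q.1 < a.1 ∧ a.1 ≤ q.1 + K}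

theorem mem_columns {K L : ℕ} {S : Finset (ℤ × ((Fin s × Fin n) × Fin r))} {q : ℤ × E} :
    q ∈ H.columns K L S ↔ (0 ≤ q.1 ∧ q.1 < L) ∧
      ∃ a ∈ S, H.Inc a.2.1 q.2 ∧ q.1 < a.1 ∧ a.1 ≤ q.1 + K := by
  simp [columns]

/-- The blocks in which the pattern `S` contains a check of the vertex `x`. -/
def checkBlocks (S : Finset (ℤ × ((Fin s × Fin n) × Fin r))) (x : Fin s × Fin n) : Finset ℤ :=
  {a ∈ S | a.2.1 = x}.image Prod.fst

theorem mem_checkBlocks {S : Finset (ℤ × ((Fin s × Fin n) × Fin r))} {x : Fin s × Fin n} {γ : ℤ} :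
    γ ∈ checkBlocks S x ↔ ∃ a ∈ S, a.2.1 = x ∧ a.1 = γ := by
  simp only [checkBlocks, mem_image, mem_filter, and_assoc]

/-- A vertex sees its c - s r free edges in each predecessor block, and a cell is counted once for
each of the s vertices of its edge. -/
theorem sum_card_predecessors_le (K L : ℕ) (S : Finset (ℤ × ((Fin s × Fin n) × Fin r))) :
    (c - s * r) * ∑ x, #(predecessors K L (checkBlocks S x)) ≤
      s * #{q ∈ H.columns K L S | q.2 ∉ Set.range H.piv} := by
  classical
  rw [← H.sum_card_filter_inc, mul_sum]
  refine sum_le_sum fun x _ => ?_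
  have hfree : #{e | H.vx x.1 e = x.2 ∧ e ∉ Set.range H.piv} = c - s * r := by
    have := H.card_free x.1 x.2
    convert Nat.eq_sub_of_add_eq this
  rw [← hfree, mul_comm, ← card_product]
  refine card_le_card fun q hq => ?_
  rw [mem_product, mem_filter] at hq
  obtain ⟨h1, a, ha, h2, h3⟩ := mem_predecessors.1 hq.1
  obtain ⟨b, hb, rfl, rfl⟩ := mem_checkBlocks.1 ha
  exact mem_filter.2 ⟨mem_filter.2 ⟨H.mem_columns.2 ⟨h1, b, hb, hq.2.2.1, h2, h3⟩, hq.2.2.2⟩,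
    hq.2.2.1⟩

theorem card_product_univ_fin {α : Type} (F : Finset α) (r : ℕ) :
    #(F ×ˢ (univ : Finset (Fin r))) = #F * r := by simp

/-- Two disjoint families of pivot cells are seen: the pivots of checks in S, by feasibility, and
all r pivots of a vertex in predecessor blocks where it has no check. -/
theorem card_add_sum_le_card_pivot_columns {K L : ℕ} {S : Finset (ℤ × ((Fin s × Fin n) × Fin r))}
    (hfeas : ∀ a ∈ S, a.1 < L → (a.1, H.piv a.2) ∈ H.columns K L S) :
    #{a ∈ S | a.1 < (L : ℤ)} +
      r * ∑ x, #{γ ∈ predecessors K L (checkBlocks S x) | γ ∉ checkBlocks S x} ≤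
      #{q ∈ H.columns K L S | ¬ q.2 ∉ Set.range H.piv} := by
  classical
  set D : Finset (ℤ × ((Fin s × Fin n) × Fin r)) :=
    {a ∈ Ico 0 (L : ℤ) ×ˢ univ | a.1 ∈ predecessors K L (checkBlocks S a.2.1) ∧
      a.1 ∉ checkBlocks S a.2.1} with hD
  have hDcard : #D =
      r * ∑ x, #{γ ∈ predecessors K L (checkBlocks S x) | γ ∉ checkBlocks S x} := by
    rw [card_eq_sum_card_fiberwise (f := fun a => a.2.1) (t := univ) (fun _ _ => by simp), mul_sum]
    refine sum_congr rfl fun x _ => ?_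
    rw [mul_comm, ← card_product_univ_fin]
    refine card_nbij' (fun a => (a.1, a.2.2)) (fun b => (b.1, (x, b.2))) ?_ ?_ ?_ ?_
    · rintro ⟨γ, y, l⟩ h
      simp only [hD, coe_filter, mem_filter, mem_product, Set.mem_ofPred_eq, mem_univ,
        and_true, coe_product, Set.mem_prod] at h ⊢
      obtain ⟨⟨_, h2⟩, rfl⟩ := h
      exact ⟨h2, by simp⟩
    · rintro ⟨γ, l⟩ h
      simp only [hD, coe_filter, mem_filter, mem_product, Set.mem_ofPred_eq, mem_univ,
        and_true, coe_product, Set.mem_prod] at h ⊢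
      exact ⟨filter_subset _ _ h.1.1, h.1⟩
    · rintro ⟨γ, y, l⟩ h
      simp only [coe_filter, Set.mem_ofPred_eq] at h
      simp [← h.2]
    · rintro ⟨γ, l⟩ _; rfl
  have hinj : Function.Injective
      (fun a : ℤ × ((Fin s × Fin n) × Fin r) => (a.1, H.piv a.2)) := by
    rintro ⟨γ, p⟩ ⟨γ', p'⟩ h
    simp only [Prod.mk.injEq] at h ⊢
    exact ⟨h.1, H.piv_injective h.2⟩
  have hdis : Disjoint {a ∈ S | a.1 < (L : ℤ)} D := by
    rw [disjoint_left]
    intro a h1 h2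
    exact (mem_filter.1 h2).2.2 (mem_checkBlocks.2 ⟨a, (mem_filter.1 h1).1, rfl, rfl⟩)
  rw [← hDcard, ← card_union_of_disjoint hdis, ← card_image_of_injective _ hinj]
  refine card_le_card fun q hq => ?_
  obtain ⟨a, ha, rfl⟩ := mem_image.1 hq
  refine mem_filter.2 ⟨?_, fun h => h ⟨_, rfl⟩⟩
  rcases mem_union.1 ha with h | h
  · exact hfeas a (mem_filter.1 h).1 (mem_filter.1 h).2
  · obtain ⟨h1, b, hb, h2, h3⟩ := mem_predecessors.1 (mem_filter.1 h).2.1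
    obtain ⟨d, hd, h4, rfl⟩ := mem_checkBlocks.1 hb
    exact H.mem_columns.2 ⟨h1, d, hd, by rw [h4]; exact H.vx_piv a.2, h2, h3⟩

/-- A pattern of checks whose pivots in the first `L` blocks are all seen by later checks of the
pattern sees more columns there than it has elements. -/
theorem card_lt_card_columns {K L : ℕ} (hsr : s * r < c) (hL : s * r * (L + K) < c * L)
    {S : Finset (ℤ × ((Fin s × Fin n) × Fin r))} (hne : S.Nonempty)
    (hS : ∀ a ∈ S, 0 ≤ a.1 ∧ a.1 < (L : ℤ) + K)
    (hfeas : ∀ a ∈ S, a.1 < L → (a.1, H.piv a.2) ∈ H.columns K L S) :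
    #S < #(H.columns K L S) := by
  classical
  have h1 := H.sum_card_predecessors_le K L S
  have h2 := H.card_add_sum_le_card_pivot_columns hfeas
  have hcols : #{q ∈ H.columns K L S | q.2 ∉ Set.range H.piv} +
      #{q ∈ H.columns K L S | ¬ q.2 ∉ Set.range H.piv} = #(H.columns K L S) :=
    card_filter_add_card_filter_not _
  have hScard : #{a ∈ S | a.1 < (L : ℤ)} + #{a ∈ S | ¬ a.1 < (L : ℤ)} = #S :=
    card_filter_add_card_filter_not _
  have h3 : #{a ∈ S | ¬ a.1 < (L : ℤ)} ≤
      r * ∑ x, #{γ ∈ checkBlocks S x | (L : ℤ) ≤ γ} := by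
    rw [card_eq_sum_card_fiberwise (f := fun a => a.2.1) (t := univ) (fun _ _ => by simp), mul_sum]
    refine sum_le_sum fun x _ => ?_
    rw [mul_comm, ← card_product_univ_fin]
    refine card_le_card_of_injOn (fun a => (a.1, a.2.2)) ?_ ?_
    · intro a ha
      simp only [coe_filter, mem_filter, Set.mem_ofPred_eq] at ha
      simp only [coe_product, Set.mem_prod, coe_filter, Set.mem_ofPred_eq]
      exact ⟨⟨mem_checkBlocks.2 ⟨a, ha.1.1, ha.2, rfl⟩, by omega⟩, by simp⟩
    · rintro ⟨γ, y, l⟩ h ⟨γ', y', l'⟩ h' heq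
      simp only [coe_filter, mem_filter, Set.mem_ofPred_eq] at h h'
      simp only [Prod.mk.injEq] at heq ⊢
      exact ⟨heq.1, h.2.trans h'.2.symm, heq.2⟩
  have hsub : ∀ x, checkBlocks S x ⊆ Ico 0 ((L : ℤ) + K) := by
    intro x γ hγ
    obtain ⟨a, ha, -, rfl⟩ := mem_checkBlocks.1 hγ
    exact mem_Ico.2 (hS a ha)
  have hU : ∀ x, #{a ∈ checkBlocks S x | a ∈ predecessors K L (checkBlocks S x)} +
      #{γ ∈ predecessors K L (checkBlocks S x) | γ ∉ checkBlocks S x} =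
      #(predecessors K L (checkBlocks S x)) := by
    intro x
    rw [filter_mem_eq_inter, inter_comm, ← filter_mem_eq_inter]
    exact card_filter_add_card_filter_not _
  have hle : ∀ x, s * r * (#{a ∈ checkBlocks S x | a ∈ predecessors K L (checkBlocks S x)} +
      #{γ ∈ checkBlocks S x | (L : ℤ) ≤ γ}) ≤ c * #(predecessors K L (checkBlocks S x)) := by
    intro x
    by_cases hx : {γ ∈ checkBlocks S x | (L : ℤ) ≤ γ}.Nonempty
    · exact (mul_card_lt_mul_card_predecessors hsr hL (hsub x) hx).le
    · rw [not_nonempty_iff_eq_empty.1 hx, card_empty, add_zero]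
      refine Nat.mul_le_mul hsr.le ?_
      have := hU x
      omega
  have hlt : ∃ x ∈ univ, s * r * (#{a ∈ checkBlocks S x | a ∈ predecessors K L (checkBlocks S x)} +
      #{γ ∈ checkBlocks S x | (L : ℤ) ≤ γ}) < c * #(predecessors K L (checkBlocks S x)) := by
    -- A check in the last block of S cannot lie below L: its pivot would have to be seen by a still
    -- later check. Its vertex gives the strict inequality.
    obtain ⟨a, ha, hmax⟩ := exists_max_image S (fun a => a.1) hne
    refine ⟨a.2.1, mem_univ _, mul_card_lt_mul_card_predecessors hsr hL (hsub _)
      ⟨a.1, mem_filter.2 ⟨mem_checkBlocks.2 ⟨a, ha, rfl, rfl⟩, ?_⟩⟩⟩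
    by_contra h
    obtain ⟨-, b, hb, -, h5, -⟩ := H.mem_columns.1 (hfeas a ha (by omega))
    have := hmax b hb
    simp only at h5
    omega
  have hsum := sum_lt_sum (fun x _ => hle x) hlt
  rw [← mul_sum, ← mul_sum, sum_add_distrib] at hsum
  have hUsum := sum_congr (rfl : (univ : Finset (Fin s × Fin n)) = univ) (fun x _ => hU x)
  rw [sum_add_distrib] at hUsum
  obtain ⟨q, hq⟩ := Nat.exists_eq_add_of_lt hsr
  generalize ∑ x, #{a ∈ checkBlocks S x | a ∈ predecessors K L (checkBlocks S x)} = α at *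
  generalize ∑ x, #{γ ∈ checkBlocks S x | (L : ℤ) ≤ γ} = φ at *
  generalize ∑ x, #{γ ∈ predecessors K L (checkBlocks S x) | γ ∉ checkBlocks S x} = δ at *
  generalize ∑ x, #(predecessors K L (checkBlocks S x)) = υ at *
  have hcs : c - s * r = q + 1 := by omega
  rw [hcs] at h1
  rw [← hcols, ← hScard]
  generalize #{q ∈ H.columns K L S | q.2 ∉ Set.range H.piv} = f at *
  generalize #{q ∈ H.columns K L S | ¬ q.2 ∉ Set.range H.piv} = g at *
  generalize #{a ∈ S | a.1 < (L : ℤ)} = x at *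
  generalize #{a ∈ S | ¬ a.1 < (L : ℤ)} = z at *
  -- With υ = α + δ the two column bounds give s(f + g) ≥ cυ - s r α + s x. The strict sum gives cυ
  -- - s r α > s r φ ≥ s z, so s(f + g) > s(x + z).
  by_contra hcon
  have hcon' : s * (f + g) ≤ s * (x + z) := Nat.mul_le_mul_left s (by omega)
  have h2' := Nat.mul_le_mul_left s h2
  have h3' := Nat.mul_le_mul_left s h3
  rw [hq, ← hUsum] at hsum
  rw [← hUsum] at h1
  nlinarith

end PivotedHypergraph

/-! ### Counting solutions, light words, and the union bound -/

section Counting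

/-- Affine conditions on binary vectors that can be changed independently of each other by flipping
single coordinates divide the number of vectors by two each. -/
theorem card_solutions_mul_le {I J : Type} [Fintype I] [DecidableEq I] [DecidableEq J]
    (s : Finset J) (f : J → (I → ZMod 2) →ₗ[ZMod 2] ZMod 2) (z : J → ZMod 2)
    (hf : ∀ j' ∈ s, ∃ i, ∀ j ∈ s, f j (Pi.single i 1) = if j = j' then 1 else 0) :
    #{ω : I → ZMod 2 | ∀ j ∈ s, f j ω = z j} * 2 ^ #s ≤ 2 ^ Fintype.card I := by
  rcases s.eq_empty_or_nonempty with rfl | ⟨j₀, hj₀⟩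
  · simp
  have hne : Nonempty I := ⟨(hf j₀ hj₀).choose⟩
  choose! q hq' using hf
  have hq : ∀ j ∈ s, ∀ j' ∈ s, f j (Pi.single (q j') 1) = if j = j' then 1 else 0 :=
    fun j hj j' hj' => hq' j' hj' j hj
  rw [← card_powerset, ← card_product]
  have hI : 2 ^ Fintype.card I = #(univ : Finset (I → ZMod 2)) := by simp
  rw [hI]
  -- Flipping the coordinates of a subset D violates exactly the conditions in D, so both the
  -- solution and D can be recovered.
  refine card_le_card_of_injOn (fun a => a.1 + ∑ j ∈ a.2, Pi.single (q j) 1)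
    (fun _ _ => mem_coe.2 (mem_univ _)) ?_
  have hval : ∀ ω : I → ZMod 2, (∀ j ∈ s, f j ω = z j) → ∀ D ⊆ s, ∀ j ∈ s,
      f j (ω + ∑ i ∈ D, Pi.single (q i) 1) = z j + if j ∈ D then 1 else 0 := by
    intro ω hω D hD j hj
    rw [map_add, hω j hj, map_sum, sum_congr rfl (fun i hi => hq j hj i (hD hi)), sum_ite_eq]
  rintro ⟨ω, D⟩ h ⟨ω', D'⟩ h' heq
  simp only [coe_product, Set.mem_prod, coe_filter, mem_univ, true_and, Set.mem_ofPred_eq,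
    mem_coe, mem_powerset] at h h'
  simp only at heq
  have hD : D = D' := by
    ext j
    by_cases hj : j ∈ s
    · have h1 := hval ω h.1 D h.2 j hj
      rw [heq, hval ω' h'.1 D' h'.2 j hj, add_right_inj] at h1
      by_cases a : j ∈ D <;> by_cases b : j ∈ D' <;> simp [a, b] at h1 ⊢
    · exact ⟨fun a => absurd (h.2 a) hj, fun a => absurd (h'.2 a) hj⟩
  subst hD
  rw [add_left_inj] at heq
  rw [heq]

/-- Chernoff's argument: evaluate the weight enumerator (1 + λ)^|F| and keep only the light terms.
-/
theorem card_words_mul_pow_le {α : Type} [DecidableEq α] (F : Finset α) (d : ℕ) {lam : ℝ}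
    (h0 : 0 < lam) (h1 : lam ≤ 1) :
    (#{w ∈ F.powerset | #w < d} : ℝ) * lam ^ d ≤ (1 + lam) ^ #F := by
  have hsum : ∑ w ∈ F.powerset, lam ^ #w = (1 + lam) ^ #F := by
    have := Finset.sum_pow_mul_eq_add_pow lam 1 F
    simp only [one_pow, mul_one] at this
    rw [this, add_comm]
  rw [← hsum, ← nsmul_eq_mul, ← sum_const]
  calc _ ≤ ∑ w ∈ F.powerset with #w < d, lam ^ #w :=
        sum_le_sum fun w hw => pow_le_pow_of_le_one h0.le h1 (mem_filter.1 hw).2.le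
    _ ≤ _ := sum_le_sum_of_subset_of_nonneg (filter_subset _ _) fun _ _ _ => by positivity

/-- A two-level union bound: over patterns, then over the words with that pattern. The exponent of
two saved per word depends only on its pattern. -/
theorem card_le_of_cover {Ω W S : Type} [DecidableEq Ω] (bad : Finset Ω) (𝒮 : Finset S)
    (Wd : S → Finset W) (Sol : W → Finset Ω) (a : S → ℕ) (N δ : ℝ)
    (hcov : ∀ ω ∈ bad, ∃ S ∈ 𝒮, ∃ w ∈ Wd S, ω ∈ Sol w)
    (hsol : ∀ S ∈ 𝒮, ∀ w ∈ Wd S, (#(Sol w) : ℝ) * 2 ^ a S ≤ N)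
    (hW : ∀ S ∈ 𝒮, (#(Wd S) : ℝ) ≤ δ * 2 ^ a S) (hN : 0 ≤ N) : (#bad : ℝ) ≤ #𝒮 * δ * N := by
  have h1 : #bad ≤ ∑ S ∈ 𝒮, ∑ w ∈ Wd S, #(Sol w) := by
    calc #bad ≤ #(𝒮.biUnion fun S => (Wd S).biUnion Sol) := card_le_card fun ω hω => by
          obtain ⟨S, hS, w, hw, h⟩ := hcov ω hω
          exact mem_biUnion.2 ⟨S, hS, mem_biUnion.2 ⟨w, hw, h⟩⟩
      _ ≤ ∑ S ∈ 𝒮, #((Wd S).biUnion Sol) := card_biUnion_le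
      _ ≤ _ := sum_le_sum fun S _ => card_biUnion_le
  calc (#bad : ℝ) ≤ ∑ S ∈ 𝒮, ∑ w ∈ Wd S, (#(Sol w) : ℝ) := by exact_mod_cast h1
    _ ≤ ∑ S ∈ 𝒮, δ * N := sum_le_sum fun S hS => ?_
    _ = _ := by rw [sum_const, nsmul_eq_mul, mul_assoc]
  have hpos : (0 : ℝ) < 2 ^ a S := by positivity
  calc ∑ w ∈ Wd S, (#(Sol w) : ℝ) ≤ ∑ w ∈ Wd S, N / 2 ^ a S :=
        sum_le_sum fun w hw => (le_div_iff₀ hpos).2 (hsol S hS w hw)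
    _ = #(Wd S) * (N / 2 ^ a S) := by rw [sum_const, nsmul_eq_mul]
    _ ≤ δ * 2 ^ a S * (N / 2 ^ a S) :=
        mul_le_mul_of_nonneg_right (hW S hS) (div_nonneg hN hpos.le)
    _ = δ * N := by field_simp

end Counting

/-! ### Blocks, cells and finitely supported words -/

section Blocks

variable {α : Type} [DecidableEq α]

/-- The pairs of a block and a position in which `w` has an element. -/
def blockPattern (B : ℕ) (w : Finset (ℤ × α)) : Finset (ℤ × α) := w.image fun a => (a.1 / B, a.2)

/-- The union of the cells of a pattern, a cell consisting of the `B` times of a block. -/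
noncomputable def cells (B : ℕ) (S : Finset (ℤ × α)) : Finset (ℤ × α) :=
  (S ×ˢ Ico (0 : ℤ) B).image fun a => (a.1.1 * B + a.2, a.1.2)

theorem mem_cells {B : ℕ} (hB : 0 < B) {S : Finset (ℤ × α)} {a : ℤ × α} :
    a ∈ cells B S ↔ (a.1 / B, a.2) ∈ S := by
  have hb : (0 : ℤ) < B := by exact_mod_cast hB
  simp only [cells, mem_image, mem_product, mem_Ico, Prod.exists]
  constructor
  · rintro ⟨γ, e, i, ⟨h1, h2, h3⟩, rfl⟩
    have : (γ * B + i) / B = γ := by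
      rw [add_comm, Int.add_mul_ediv_right _ _ hb.ne', Int.ediv_eq_zero_of_lt h2 h3, zero_add]
    rwa [this]
  · intro h
    refine ⟨a.1 / B, a.2, a.1 % B, ⟨h, Int.emod_nonneg _ hb.ne', Int.emod_lt_of_pos _ hb⟩, ?_⟩
    rw [Int.ediv_mul_add_emod]

theorem card_cells {B : ℕ} (S : Finset (ℤ × α)) : #(cells B S) = B * #S := by
  unfold cells
  rw [card_image_of_injOn, card_product, Int.card_Ico, mul_comm]
  · simp
  · rintro ⟨⟨γ, e⟩, i⟩ h ⟨⟨γ', e'⟩, i'⟩ h' heq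
    simp only [coe_product, Set.mem_prod, mem_coe, mem_Ico] at h h'
    simp only [Prod.mk.injEq] at heq ⊢
    have hb : (0 : ℤ) < B := by omega
    have hd : ∀ γ i : ℤ, 0 ≤ i → i < B → (γ * B + i) / B = γ := fun γ i h2 h3 => by
      rw [add_comm, Int.add_mul_ediv_right _ _ hb.ne', Int.ediv_eq_zero_of_lt h2 h3, zero_add]
    have h1 := hd γ i h.2.1 h.2.2
    rw [heq.1, hd γ' i' h'.2.1 h'.2.2] at h1
    subst h1
    exact ⟨⟨rfl, heq.2⟩, by omega⟩

theorem subset_cells_blockPattern {B : ℕ} (hB : 0 < B) (w : Finset (ℤ × α)) :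
    w ⊆ cells B (blockPattern B w) := fun _ ha =>
  (mem_cells hB).2 (mem_image_of_mem _ ha)

theorem mem_window {B : ℕ} (hB : 0 < B) (K : ℕ) (t τ : ℤ) :
    τ ∈ Ico ((t / B - K) * B) (t / B * B) ↔ τ / B < t / B ∧ t / B ≤ τ / B + K := by
  have hb : (0 : ℤ) < B := by exact_mod_cast hB
  rw [mem_Ico, ← Int.le_ediv_iff_mul_le hb, ← Int.ediv_lt_iff_lt_mul hb]
  omega

theorem div_mem_Ico {B M : ℕ} (hB : 0 < B) (t : ℤ) :
    (0 ≤ t ∧ t < M * B) ↔ (0 ≤ t / B ∧ t / B < M) := by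
  have hb : (0 : ℤ) < B := by exact_mod_cast hB
  rw [Int.ediv_lt_iff_lt_mul hb, Int.ediv_nonneg_iff_of_pos hb]

end Blocks

section Words

variable {E P : Type} [Fintype E] [DecidableEq E]

/-- The sequence with support `w`. -/
def word (w : Finset (ℤ × E)) : BinSeq E := fun t e => if (t, e) ∈ w then 1 else 0

theorem syndrome_word {B : ℕ} (hB : 0 < B) (K : ℕ) (piv : P → E) (h : ℤ → P → ℤ → E → ZMod 2)
    (t : ℤ) (p : P) (w : Finset (ℤ × E)) :
    syndrome B K piv h t p (word w) = (if (t, piv p) ∈ w then 1 else 0) +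
      ∑ a ∈ w with a.1 / B < t / B ∧ t / B ≤ a.1 / B + K, h t p a.1 a.2 := by
  rw [syndrome_apply]
  unfold word
  congr 1
  simp only [mul_ite, mul_one, mul_zero]
  rw [← sum_product' (f := fun τ e => if (τ, e) ∈ w then h t p τ e else 0), ← sum_filter]
  refine sum_congr ?_ fun _ _ => rfl
  ext ⟨τ, e⟩
  simp only [mem_filter, mem_product, mem_window hB, mem_univ, and_true]
  tauto

theorem syndrome_impulse {B : ℕ} (hB : 0 < B) (K : ℕ) (piv : P → E)
    (h : ℤ → P → ℤ → E → ZMod 2) (t : ℤ) (p : P) (τ : ℤ) (e : E) :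
    syndrome B K piv h t p (impulse τ e) = (if t = τ ∧ piv p = e then 1 else 0) +
      if τ / B < t / B ∧ t / B ≤ τ / B + K then h t p τ e else 0 := by
  have : impulse τ e = word {(τ, e)} := by
    funext t' e'
    rw [impulse_apply]
    simp [word]
  rw [this, syndrome_word hB]
  congr 1
  · simp
  · rw [sum_filter, sum_singleton]

end Words

/-! ### Coefficient arrays that accept a given word or annihilate given checks -/

namespace PivotedHypergraph

variable {E : Type} [Fintype E] [DecidableEq E] {s n c r : ℕ} (H : PivotedHypergraph E s n c r)

/-- The check coefficients, with period `N` in both times, as functions of the binary vector that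
lists them. -/
def coeff (N : ℕ) (t : ℤ) (p : (Fin s × Fin n) × Fin r) (τ : ℤ) (e : E) :
    (ZMod N × ((Fin s × Fin n) × Fin r) × ZMod N × E → ZMod 2) →ₗ[ZMod 2] ZMod 2 :=
  if H.Inc p.1 e then LinearMap.proj ((t : ZMod N), p, (τ : ZMod N), e) else 0

theorem intCast_inj_of_lt {N : ℕ} {a b : ℤ} (ha : 0 ≤ a ∧ a < N) (hb : 0 ≤ b ∧ b < N) :
    (a : ZMod N) = b ↔ a = b := by
  rw [ZMod.intCast_eq_intCast_iff, Int.ModEq, Int.emod_eq_of_lt ha.1 ha.2,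
    Int.emod_eq_of_lt hb.1 hb.2]

theorem coeff_single {N : ℕ} {t t₀ τ τ₀ : ℤ} (ht : 0 ≤ t ∧ t < N) (ht₀ : 0 ≤ t₀ ∧ t₀ < N)
    (hτ : 0 ≤ τ ∧ τ < N) (hτ₀ : 0 ≤ τ₀ ∧ τ₀ < N) (p p₀ : (Fin s × Fin n) × Fin r) (e e₀ : E) :
    H.coeff N t p τ e (Pi.single ((t₀ : ZMod N), p₀, (τ₀ : ZMod N), e₀) 1) =
      if H.Inc p.1 e ∧ t = t₀ ∧ p = p₀ ∧ τ = τ₀ ∧ e = e₀ then 1 else 0 := by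
  unfold coeff
  by_cases h : H.Inc p.1 e
  · rw [if_pos h, LinearMap.proj_apply, Pi.single_apply]
    simp only [Prod.mk.injEq, intCast_inj_of_lt ht ht₀, intCast_inj_of_lt hτ hτ₀,
      show H.Inc p.1 e ↔ True from iff_true_intro h, true_and]
  · rw [if_neg h, if_neg (fun h' => h h'.1)]; rfl

/-- The coefficient array determined by a binary vector. -/
def array {N : ℕ} (ω : ZMod N × ((Fin s × Fin n) × Fin r) × ZMod N × E → ZMod 2) :
    ℤ → (Fin s × Fin n) × Fin r → ℤ → E → ZMod 2 := fun t p τ e => H.coeff N t p τ e ω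

theorem card_primal_solutions {B K M N : ℕ} [NeZero N] (hB : 0 < B) (hMN : M * B ≤ N)
    {w : Finset (ℤ × E)} (hw : ∀ a ∈ w, 0 ≤ a.1 ∧ a.1 < M * B) :
    #{ω : ZMod N × ((Fin s × Fin n) × Fin r) × ZMod N × E → ZMod 2 | ∀ t : ℤ, 0 ≤ t → t < M * B →
      ∀ p, syndrome B K H.piv (H.array ω) t p (word w) = 0} *
      2 ^ (B * (r * #(H.seen K M (blockPattern B w)))) ≤
      2 ^ Fintype.card (ZMod N × ((Fin s × Fin n) × Fin r) × ZMod N × E) := by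
  classical
  have hMN' : (M * B : ℤ) ≤ N := by exact_mod_cast hMN
  set S' : Finset (ℤ × ((Fin s × Fin n) × Fin r)) :=
    (H.seen K M (blockPattern B w) ×ˢ univ).image fun a => (a.1.1, (a.1.2, a.2)) with hS'
  have hcard : #(cells B S') = B * (r * #(H.seen K M (blockPattern B w))) := by
    rw [card_cells, hS', card_image_of_injective, card_product_univ_fin, mul_comm _ r]
    rintro ⟨⟨γ, x⟩, l⟩ ⟨⟨γ', x'⟩, l'⟩ h
    simp only [Prod.mk.injEq] at h ⊢
    tauto
  have hJ : ∀ j ∈ cells B S', (0 ≤ j.1 ∧ j.1 < M * B) ∧ ∃ a ∈ w, H.Inc j.2.1 a.2 ∧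
      a.1 / B < j.1 / B ∧ j.1 / B ≤ a.1 / B + K := by
    intro j hj
    obtain ⟨⟨⟨γ, x⟩, l⟩, h1, h2⟩ := mem_image.1 ((mem_cells hB).1 hj)
    rw [mem_product, seen, mem_filter] at h1
    obtain ⟨⟨h3, b, hb, h4, h5⟩, -⟩ := h1
    obtain ⟨a, ha, rfl⟩ := mem_image.1 hb
    rw [mem_product, mem_Ico] at h3
    simp only [Prod.mk.injEq] at h2 h3 h4 h5
    rw [← h2.1, ← h2.2]
    exact ⟨(div_mem_Ico hB _).2 (h2.1 ▸ h3.1), a, ha, h4, h5⟩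
  have hN : ∀ a ∈ w, 0 ≤ a.1 ∧ a.1 < (N : ℤ) := fun a ha =>
    ⟨(hw a ha).1, (hw a ha).2.trans_le hMN'⟩
  have key := card_solutions_mul_le (cells B S')
    (fun j => ∑ a ∈ w with a.1 / (B : ℤ) < j.1 / B ∧ j.1 / B ≤ a.1 / B + K,
      H.coeff N j.1 j.2 a.1 a.2)
    (fun j => if (j.1, H.piv j.2) ∈ w then 1 else 0)
    (by
      intro j' hj'
      obtain ⟨b, hb1, hb2, hb3, hb4⟩ := (hJ j' hj').2
      -- The coefficient of the check j' at one active symbol b that it sees occurs in no other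
      -- check. The bound on N keeps the times of the window distinct modulo N.
      refine ⟨((j'.1 : ZMod N), j'.2, (b.1 : ZMod N), b.2), fun j hj => ?_⟩
      have hjN : 0 ≤ j.1 ∧ j.1 < (N : ℤ) := ⟨(hJ j hj).1.1, (hJ j hj).1.2.trans_le hMN'⟩
      have hjN' : 0 ≤ j'.1 ∧ j'.1 < (N : ℤ) := ⟨(hJ j' hj').1.1, (hJ j' hj').1.2.trans_le hMN'⟩
      rw [LinearMap.sum_apply]
      rw [sum_congr rfl fun a ha => H.coeff_single hjN hjN' (hN a (mem_filter.1 ha).1)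
        (hN b hb1) j.2 j'.2 a.2 b.2]
      by_cases hjj : j = j'
      · subst hjj
        rw [if_pos rfl, sum_eq_single b]
        · exact if_pos ⟨hb2, rfl, rfl, rfl, rfl⟩
        · intro a _ ha
          rw [if_neg]
          rintro ⟨-, -, -, h1, h2⟩
          exact ha (Prod.ext h1 h2)
        · intro h
          exact absurd (mem_filter.2 ⟨hb1, hb3, hb4⟩) h
      · rw [if_neg hjj]
        refine sum_eq_zero fun a _ => if_neg ?_
        rintro ⟨-, h1, h2, -⟩
        exact hjj (Prod.ext h1 h2))
  rw [hcard] at key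
  refine le_trans (Nat.mul_le_mul_right _ (card_le_card fun ω hω => ?_)) key
  rw [mem_filter] at hω ⊢
  refine ⟨mem_univ _, fun j hj => ?_⟩
  have h1 := hω.2 j.1 (hJ j hj).1.1 (hJ j hj).1.2 j.2
  rw [syndrome_word hB, CharTwo.add_eq_zero] at h1
  rw [LinearMap.sum_apply, h1]
  rfl

theorem card_dual_solutions {B K L N : ℕ} [NeZero N] (hB : 0 < B) (hLN : (L + K) * B ≤ N)
    {y : Finset (ℤ × ((Fin s × Fin n) × Fin r))} (hy : ∀ a ∈ y, 0 ≤ a.1 ∧ a.1 < (L + K : ℕ) * B) :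
    #{ω : ZMod N × ((Fin s × Fin n) × Fin r) × ZMod N × E → ZMod 2 | ∀ τ : ℤ, 0 ≤ τ → τ < L * B →
      ∀ e, ∑ a ∈ y, syndrome B K H.piv (H.array ω) a.1 a.2 (impulse τ e) = 0} *
      2 ^ (B * #(H.columns K L (blockPattern B y))) ≤
      2 ^ Fintype.card (ZMod N × ((Fin s × Fin n) × Fin r) × ZMod N × E) := by
  classical
  have hLN' : ((L + K : ℕ) * B : ℤ) ≤ N := by exact_mod_cast hLN
  have hLK : (L * B : ℤ) ≤ N := by
    refine le_trans ?_ hLN'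
    push_cast
    nlinarith [mul_nonneg (Nat.cast_nonneg (α := ℤ) K) (Nat.cast_nonneg (α := ℤ) B)]
  rw [← card_cells]
  have hJ : ∀ j ∈ cells B (H.columns K L (blockPattern B y)), (0 ≤ j.1 ∧ j.1 < L * B) ∧
      ∃ a ∈ y, H.Inc a.2.1 j.2 ∧ j.1 / B < a.1 / B ∧ a.1 / B ≤ j.1 / B + K := by
    intro j hj
    obtain ⟨h1, b, hb, h2, h3⟩ := H.mem_columns.1 ((mem_cells hB).1 hj)
    obtain ⟨a, ha, rfl⟩ := mem_image.1 hb
    exact ⟨(div_mem_Ico hB _).2 h1, a, ha, h2, h3⟩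
  have hN : ∀ a ∈ y, 0 ≤ a.1 ∧ a.1 < (N : ℤ) := fun a ha =>
    ⟨(hy a ha).1, (hy a ha).2.trans_le hLN'⟩
  have key := card_solutions_mul_le (cells B (H.columns K L (blockPattern B y)))
    (fun j => ∑ a ∈ y with j.1 / (B : ℤ) < a.1 / B ∧ a.1 / B ≤ j.1 / B + K,
      H.coeff N a.1 a.2 j.1 j.2)
    (fun j => ∑ a ∈ y, if a.1 = j.1 ∧ H.piv a.2 = j.2 then 1 else 0)
    (by
      intro j' hj'
      obtain ⟨b, hb1, hb2, hb3, hb4⟩ := (hJ j' hj').2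
      -- In the dual count the conditions are indexed by symbols; the coefficient of a check b that
      -- sees the symbol j' affects no other symbol.
      refine ⟨((b.1 : ZMod N), b.2, (j'.1 : ZMod N), j'.2), fun j hj => ?_⟩
      have hjN : 0 ≤ j.1 ∧ j.1 < (N : ℤ) := ⟨(hJ j hj).1.1, (hJ j hj).1.2.trans_le hLK⟩
      have hjN' : 0 ≤ j'.1 ∧ j'.1 < (N : ℤ) := ⟨(hJ j' hj').1.1, (hJ j' hj').1.2.trans_le hLK⟩
      rw [LinearMap.sum_apply]
      rw [sum_congr rfl fun a ha => H.coeff_single (hN a (mem_filter.1 ha).1)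
        (hN b hb1) hjN hjN' a.2 b.2 j.2 j'.2]
      by_cases hjj : j = j'
      · subst hjj
        rw [if_pos rfl, sum_eq_single b]
        · exact if_pos ⟨hb2, rfl, rfl, rfl, rfl⟩
        · intro a _ ha
          rw [if_neg]
          rintro ⟨-, h1, h2, -⟩
          exact ha (Prod.ext h1 h2)
        · intro h
          exact absurd (mem_filter.2 ⟨hb1, hb3, hb4⟩) h
      · rw [if_neg hjj]
        refine sum_eq_zero fun a _ => if_neg ?_
        rintro ⟨-, -, -, h1, h2⟩
        exact hjj (Prod.ext h1 h2))
  refine le_trans (Nat.mul_le_mul_right _ (card_le_card fun ω hω => ?_)) key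
  rw [mem_filter] at hω ⊢
  refine ⟨mem_univ _, fun j hj => ?_⟩
  have h1 := hω.2 j.1 (hJ j hj).1.1 (hJ j hj).1.2 j.2
  simp only [syndrome_impulse hB] at h1
  rw [sum_add_distrib, CharTwo.add_eq_zero] at h1
  rw [LinearMap.sum_apply, h1, ← sum_filter]
  rfl

/-- The pivots of a combination of checks that vanishes on the first `L` blocks are seen there. -/
theorem pivot_mem_columns {B K L N : ℕ} (hB : 0 < B)
    {y : Finset (ℤ × ((Fin s × Fin n) × Fin r))} (hy : ∀ a ∈ y, 0 ≤ a.1)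
    {ω : ZMod N × ((Fin s × Fin n) × Fin r) × ZMod N × E → ZMod 2}
    (hω : ∀ τ : ℤ, 0 ≤ τ → τ < L * B →
      ∀ e, ∑ a ∈ y, syndrome B K H.piv (H.array ω) a.1 a.2 (impulse τ e) = 0) :
    ∀ a ∈ blockPattern B y, a.1 < L → (a.1, H.piv a.2) ∈ H.columns K L (blockPattern B y) := by
  have hb : (0 : ℤ) < B := by exact_mod_cast hB
  intro a ha haL
  obtain ⟨⟨t, p⟩, hx, rfl⟩ := mem_image.1 ha
  simp only at haL ⊢
  -- If no check of y saw the pivot symbol of (t, p), the coefficient of that symbol in the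
  -- combination would be exactly 1, since pivots are distinct.
  by_contra hcol
  have ht0 : 0 ≤ t := hy _ hx
  have h1 := hω t ht0 ((Int.ediv_lt_iff_lt_mul hb).1 haL) (H.piv p)
  simp only [syndrome_impulse hB] at h1
  rw [sum_add_distrib, sum_eq_single (t, p), sum_eq_zero, if_pos ⟨rfl, rfl⟩] at h1
  · simp at h1
  · rintro ⟨t', p'⟩ hy'
    split_ifs with hwin
    · unfold array coeff
      rw [if_neg]
      · rfl
      · intro hinc
        exact hcol (H.mem_columns.2 ⟨⟨Int.ediv_nonneg ht0 hb.le, haL⟩, (t' / B, p'),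
          mem_image_of_mem _ hy', hinc, hwin⟩)
    · rfl
  · rintro ⟨t', p'⟩ _ hne
    refine if_neg fun h => hne ?_
    exact Prod.ext h.1 (H.piv_injective h.2)
  · intro h; exact absurd hx h

end PivotedHypergraph

/-! ### Translation in time and the probability of bad arrays -/

section Shift

variable {E P : Type} [Fintype E]

theorem syndrome_shift {B : ℕ} (hB : 0 < B) (K : ℕ) (piv : P → E) (h : ℤ → P → ℤ → E → ZMod 2)
    (β t : ℤ) (p : P) (v : BinSeq E) :
    syndrome B K piv (fun t p τ e => h (t + β * B) p (τ + β * B) e) t p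
      (fun t => v (t + β * B)) = syndrome B K piv h (t + β * B) p v := by
  have hb : (B : ℤ) ≠ 0 := by exact_mod_cast hB.ne'
  rw [syndrome_apply, syndrome_apply, Int.add_mul_ediv_right _ _ hb]
  congr 1
  rw [sum_Ico_add' (fun τ => ∑ e, h (t + β * B) p τ e * v τ e)]
  congr 2 <;> ring

theorem impulse_shift {E : Type} [DecidableEq E] (b τ : ℤ) (e : E) :
    (fun t => impulse (τ + b) e (t + b)) = impulse τ e := by
  funext t e'
  rw [impulse_apply, impulse_apply]
  simp

end Shift

namespace PivotedHypergraph

variable {E : Type} [Fintype E] [DecidableEq E] {s n c r : ℕ} (H : PivotedHypergraph E s n c r)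

/-- Translation of the coefficient times by `z`. -/
def rotate {E : Type} {N : ℕ} (z : ZMod N) (ω : ZMod N × ((Fin s × Fin n) × Fin r) × ZMod N × E → ZMod 2) :
    ZMod N × ((Fin s × Fin n) × Fin r) × ZMod N × E → ZMod 2 :=
  fun i => ω (i.1 + z, i.2.1, i.2.2.1 + z, i.2.2.2)

theorem rotate_neg_rotate {E : Type} {N : ℕ} (z : ZMod N)
    (ω : ZMod N × ((Fin s × Fin n) × Fin r) × ZMod N × E → ZMod 2) :
    rotate (-z) (rotate z ω) = ω := by
  funext i
  simp [rotate]

theorem array_rotate {N : ℕ} (b : ℤ)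
    (ω : ZMod N × ((Fin s × Fin n) × Fin r) × ZMod N × E → ZMod 2) :
    H.array (rotate (b : ZMod N) ω) = fun t p τ e => H.array ω (t + b) p (τ + b) e := by
  funext t p τ e
  unfold array coeff
  split_ifs
  · simp [rotate]
  · rfl

/-- There is a word of weight below `d` on the first `M` blocks that satisfies all checks there and
has a terminated or a long activity pattern. -/
def LightWord (B K M Q d : ℕ) {N : ℕ}
    (ω : ZMod N × ((Fin s × Fin n) × Fin r) × ZMod N × E → ZMod 2) : Prop :=
  ∃ w : Finset (ℤ × E), w.Nonempty ∧ (∀ a ∈ w, 0 ≤ a.1 ∧ a.1 < M * B) ∧ #w < d ∧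
    ((∀ a ∈ blockPattern B w, a.1 + K < M) ∨ Q ≤ #(blockPattern B w)) ∧
    ∀ t : ℤ, 0 ≤ t → t < M * B → ∀ p, syndrome B K H.piv (H.array ω) t p (word w) = 0

/-- There is a combination of the checks of the first `L + K` blocks that vanishes on the first
`L` blocks. -/
def Dependent (B K L : ℕ) {N : ℕ}
    (ω : ZMod N × ((Fin s × Fin n) × Fin r) × ZMod N × E → ZMod 2) : Prop :=
  ∃ y : Finset (ℤ × ((Fin s × Fin n) × Fin r)), y.Nonempty ∧
    (∀ a ∈ y, 0 ≤ a.1 ∧ a.1 < (L + K : ℕ) * B) ∧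
    ∀ τ : ℤ, 0 ≤ τ → τ < L * B →
      ∀ e, ∑ a ∈ y, syndrome B K H.piv (H.array ω) a.1 a.2 (impulse τ e) = 0

theorem mem_blockPattern_bounds {α : Type} [DecidableEq α] {B M : ℕ} (hB : 0 < B)
    {w : Finset (ℤ × α)} (hw : ∀ a ∈ w, 0 ≤ a.1 ∧ a.1 < M * B) :
    ∀ a ∈ blockPattern B w, 0 ≤ a.1 ∧ a.1 < M := by
  intro a ha
  obtain ⟨x, hx, rfl⟩ := mem_image.1 ha
  exact (div_mem_Ico hB _).1 (hw x hx)

-- Union bound over activity patterns, whose number does not depend on B; the gain δ per pattern is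
-- to be supplied by `hcount`.
open Classical in
theorem card_lightWord_le {B K M Q d N : ℕ} [NeZero N] (hB : 0 < B) (hMN : M * B ≤ N) {δ : ℝ}
    (hδ : 0 ≤ δ)
    (hcount : ∀ S : Finset (ℤ × E), S.Nonempty → (∀ a ∈ S, 0 ≤ a.1 ∧ a.1 < M) →
      ((∀ a ∈ S, a.1 + K < M) ∨ Q ≤ #S) →
      (#{w ∈ (cells B S).powerset | #w < d} : ℝ) ≤ δ * 2 ^ (B * (r * #(H.seen K M S)))) :
    (#{ω : ZMod N × ((Fin s × Fin n) × Fin r) × ZMod N × E → ZMod 2 |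
      H.LightWord B K M Q d ω} : ℝ) ≤ 2 ^ (M * Fintype.card E) * δ *
      2 ^ Fintype.card (ZMod N × ((Fin s × Fin n) × Fin r) × ZMod N × E) := by
  set 𝒮 : Finset (Finset (ℤ × E)) := {S ∈ (Ico 0 (M : ℤ) ×ˢ univ).powerset |
    S.Nonempty ∧ ((∀ a ∈ S, a.1 + K < M) ∨ Q ≤ #S)} with h𝒮
  have hbd : ∀ S ∈ 𝒮, ∀ a ∈ S, 0 ≤ a.1 ∧ a.1 < M := fun S hS a ha => by
    have := (mem_powerset.1 (mem_filter.1 hS).1) ha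
    rw [mem_product, mem_Ico] at this
    exact this.1
  have key := card_le_of_cover
    {ω : ZMod N × ((Fin s × Fin n) × Fin r) × ZMod N × E → ZMod 2 | H.LightWord B K M Q d ω} 𝒮
    (fun S => {w ∈ (cells B S).powerset | #w < d ∧ blockPattern B w = S})
    (fun w => {ω | (∀ a ∈ w, 0 ≤ a.1 ∧ a.1 < M * B) ∧ ∀ t : ℤ, 0 ≤ t → t < M * B →
      ∀ p, syndrome B K H.piv (H.array ω) t p (word w) = 0})
    (fun S => B * (r * #(H.seen K M S)))
    (2 ^ Fintype.card (ZMod N × ((Fin s × Fin n) × Fin r) × ZMod N × E)) δ ?_ ?_ ?_ (by positivity)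
  · refine key.trans ?_
    have h1 : #𝒮 ≤ 2 ^ (M * Fintype.card E) := by
      calc #𝒮 ≤ #((Ico 0 (M : ℤ) ×ˢ (univ : Finset E)).powerset) := card_filter_le _ _
        _ = _ := by rw [card_powerset, card_product, Int.card_Ico, card_univ]; simp
    have h2 : (#𝒮 : ℝ) ≤ 2 ^ (M * Fintype.card E) := by exact_mod_cast h1
    gcongr
  · intro ω hω
    obtain ⟨w, hne, hw, hd, hpat, hs⟩ := (mem_filter.1 hω).2
    refine ⟨blockPattern B w, mem_filter.2 ⟨mem_powerset.2 fun a ha => ?_, hne.image _, hpat⟩, w,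
      mem_filter.2 ⟨mem_powerset.2 (subset_cells_blockPattern hB w), hd, rfl⟩,
      mem_filter.2 ⟨mem_univ _, hw, hs⟩⟩
    exact mem_product.2 ⟨mem_Ico.2 (mem_blockPattern_bounds hB hw a ha), mem_univ _⟩
  · intro S hS w hw
    rw [mem_filter] at hw
    have hwb : ∀ a ∈ w, 0 ≤ a.1 ∧ a.1 < M * B := by
      intro a ha
      refine (div_mem_Ico hB _).2 (hbd S hS (a.1 / B, a.2) ?_)
      rw [← hw.2.2]
      exact mem_image_of_mem _ ha
    have h1 := H.card_primal_solutions (K := K) (M := M) (N := N) hB hMN hwb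
    rw [hw.2.2] at h1
    have h2 : (#{ω : ZMod N × ((Fin s × Fin n) × Fin r) × ZMod N × E → ZMod 2 |
        (∀ a ∈ w, 0 ≤ a.1 ∧ a.1 < M * B) ∧ ∀ t : ℤ, 0 ≤ t → t < M * B →
        ∀ p, syndrome B K H.piv (H.array ω) t p (word w) = 0}) ≤
        #{ω : ZMod N × ((Fin s × Fin n) × Fin r) × ZMod N × E → ZMod 2 |
        ∀ t : ℤ, 0 ≤ t → t < M * B →
        ∀ p, syndrome B K H.piv (H.array ω) t p (word w) = 0} :=
      card_le_card fun ω hω => mem_filter.2 ⟨mem_univ _, (mem_filter.1 hω).2.2⟩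
    exact_mod_cast (Nat.mul_le_mul_right _ h2).trans (by convert h1)
  · intro S hS
    refine le_trans ?_ (hcount S (mem_filter.1 hS).2.1 (hbd S hS) (mem_filter.1 hS).2.2)
    exact_mod_cast card_le_card fun w hw => by
      rw [mem_filter] at hw ⊢
      exact ⟨hw.1, hw.2.1⟩

-- A feasible pattern sees at least one cell more than it has, so its 2^(B|S|) combinations meet at
-- least B(|S| + 1) independent conditions, a gain of 2^(-B).
open Classical in
theorem card_dependent_le {B K L N : ℕ} [NeZero N] (hB : 0 < B) (hLN : (L + K) * B ≤ N)
    (hsr : s * r < c) (hL : s * r * (L + K) < c * L) {δ : ℝ} (hδ : 1 ≤ δ * 2 ^ B) :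
    (#{ω : ZMod N × ((Fin s × Fin n) × Fin r) × ZMod N × E → ZMod 2 |
      H.Dependent B K L ω} : ℝ) ≤ 2 ^ ((L + K) * (s * n * r)) * δ *
      2 ^ Fintype.card (ZMod N × ((Fin s × Fin n) × Fin r) × ZMod N × E) := by
  have hδ0 : 0 ≤ δ := by
    by_contra h
    have : δ * 2 ^ B < 0 := mul_neg_of_neg_of_pos (by linarith) (by positivity)
    linarith
  set 𝒮 : Finset (Finset (ℤ × ((Fin s × Fin n) × Fin r))) :=
    {S ∈ (Ico 0 ((L + K : ℕ) : ℤ) ×ˢ univ).powerset | S.Nonempty ∧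
      ∀ a ∈ S, a.1 < L → (a.1, H.piv a.2) ∈ H.columns K L S} with h𝒮
  have hbd : ∀ S ∈ 𝒮, ∀ a ∈ S, 0 ≤ a.1 ∧ a.1 < (L + K : ℕ) := fun S hS a ha => by
    have := (mem_powerset.1 (mem_filter.1 hS).1) ha
    rw [mem_product, mem_Ico] at this
    exact this.1
  have key := card_le_of_cover
    {ω : ZMod N × ((Fin s × Fin n) × Fin r) × ZMod N × E → ZMod 2 | H.Dependent B K L ω} 𝒮
    (fun S => {y ∈ (cells B S).powerset | blockPattern B y = S})
    (fun y => {ω | ∀ τ : ℤ, 0 ≤ τ → τ < L * B →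
      ∀ e, ∑ a ∈ y, syndrome B K H.piv (H.array ω) a.1 a.2 (impulse τ e) = 0})
    (fun S => B * #(H.columns K L S))
    (2 ^ Fintype.card (ZMod N × ((Fin s × Fin n) × Fin r) × ZMod N × E)) δ ?_ ?_ ?_ (by positivity)
  · refine key.trans ?_
    have h1 : #𝒮 ≤ 2 ^ ((L + K) * (s * n * r)) := by
      calc #𝒮 ≤ #((Ico 0 ((L + K : ℕ) : ℤ) ×ˢ
            (univ : Finset ((Fin s × Fin n) × Fin r))).powerset) := card_filter_le _ _
        _ = _ := by
          rw [card_powerset, card_product, Int.card_Ico, card_univ, sub_zero, Int.toNat_natCast]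
          simp
    have h2 : (#𝒮 : ℝ) ≤ 2 ^ ((L + K) * (s * n * r)) := by exact_mod_cast h1
    gcongr
  · intro ω hω
    obtain ⟨y, hne, hy, hs⟩ := (mem_filter.1 hω).2
    refine ⟨blockPattern B y, mem_filter.2 ⟨mem_powerset.2 fun a ha => ?_, hne.image _,
      H.pivot_mem_columns hB (fun a ha => (hy a ha).1) hs⟩, y,
      mem_filter.2 ⟨mem_powerset.2 (subset_cells_blockPattern hB y), rfl⟩,
      mem_filter.2 ⟨mem_univ _, hs⟩⟩
    exact mem_product.2 ⟨mem_Ico.2 (mem_blockPattern_bounds hB hy a ha), mem_univ _⟩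
  · intro S hS y hy
    rw [mem_filter] at hy
    have hyb : ∀ a ∈ y, 0 ≤ a.1 ∧ a.1 < (L + K : ℕ) * B := by
      intro a ha
      refine (div_mem_Ico hB _).2 (hbd S hS (a.1 / B, a.2) ?_)
      rw [← hy.2]
      exact mem_image_of_mem _ ha
    have h1 := H.card_dual_solutions (K := K) (L := L) (N := N) hB hLN hyb
    rw [hy.2] at h1
    have h2 := (Nat.cast_le (α := ℝ)).2 h1
    rw [Nat.cast_mul, Nat.cast_pow, Nat.cast_pow, Nat.cast_ofNat] at h2
    convert h2
  · intro S hS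
    have h1 : #{y ∈ (cells B S).powerset | blockPattern B y = S} ≤ 2 ^ (B * #S) := by
      calc _ ≤ #(cells B S).powerset := card_filter_le _ _
        _ = _ := by rw [card_powerset, card_cells]
    have h2 : #S + 1 ≤ #(H.columns K L S) :=
      H.card_lt_card_columns hsr hL (mem_filter.1 hS).2.1
        (fun a ha => by have := hbd S hS a ha; push_cast at this; exact this) (mem_filter.1 hS).2.2
    calc (#{y ∈ (cells B S).powerset | blockPattern B y = S} : ℝ) ≤ 2 ^ (B * #S) := by
          exact_mod_cast h1
      _ ≤ δ * 2 ^ B * 2 ^ (B * #S) := le_mul_of_one_le_left (by positivity) hδ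
      _ = δ * 2 ^ (B * (#S + 1)) := by rw [mul_add, pow_add]; ring
      _ ≤ δ * 2 ^ (B * #(H.columns K L S)) := by
          gcongr
          norm_num

theorem card_rotate {N : ℕ} [NeZero N] (z : ZMod N)
    (p : (ZMod N × ((Fin s × Fin n) × Fin r) × ZMod N × E → ZMod 2) → Prop) [DecidablePred p] :
    #{ω | p (rotate z ω)} = #{ω | p ω} := by
  refine card_nbij' (rotate z) (rotate (-z)) ?_ ?_ ?_ ?_
  · intro ω hω; simpa using hω
  · intro ω hω
    have := rotate_neg_rotate (-z) ω
    rw [neg_neg] at this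
    simpa [this] using hω
  · intro ω _; exact rotate_neg_rotate z ω
  · intro ω _
    have := rotate_neg_rotate (-z) ω
    rwa [neg_neg] at this

/-- If bad vectors are rare then some vector has only good translates. -/
theorem exists_forall_rotate {B T : ℕ} (hT : 0 < T) [NeZero (T * B)] {κ : ℝ}
    (bad : (ZMod (T * B) × ((Fin s × Fin n) × Fin r) × ZMod (T * B) × E → ZMod 2) → Prop)
    [DecidablePred bad]
    (hbad : (#{ω | bad ω} : ℝ) ≤ κ *
      2 ^ Fintype.card (ZMod (T * B) × ((Fin s × Fin n) × Fin r) × ZMod (T * B) × E))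
    (hκ : T * κ < 1) :
    ∃ ω, ∀ β : ℤ, ¬ bad (rotate ((β * B : ℤ) : ZMod (T * B)) ω) := by
  classical
  by_contra hcon
  push Not at hcon
  -- Arrays have period T blocks, so only T translates matter, and all of them are equally often
  -- bad.
  have hcov : (univ : Finset (ZMod (T * B) × ((Fin s × Fin n) × Fin r) × ZMod (T * B) × E →
      ZMod 2)) ⊆ (range T).biUnion fun b =>
        {ω | bad (rotate (((b : ℤ) * B : ℤ) : ZMod (T * B)) ω)} := by
    intro ω _
    obtain ⟨β, hβ⟩ := hcon ω
    have hTz : (0 : ℤ) < T := by exact_mod_cast hT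
    have h0 := Int.emod_nonneg β hTz.ne'
    have h1 := Int.emod_lt_of_pos β hTz
    refine mem_biUnion.2 ⟨(β % T).toNat, mem_range.2 (by omega), mem_filter.2 ⟨mem_univ _, ?_⟩⟩
    have h2 : (((((β % T).toNat : ℕ) : ℤ) * B : ℤ) : ZMod (T * B)) = ((β * B : ℤ) : ZMod (T * B)) := by
      rw [ZMod.intCast_eq_intCast_iff, Int.toNat_of_nonneg h0, Nat.cast_mul]
      exact Int.ModEq.mul_right' (Int.mod_modEq β T)
    rw [h2]
    exact hβ
  have h1 := (card_le_card hcov).trans card_biUnion_le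
  rw [sum_congr rfl fun b _ => card_rotate _ bad, sum_const, card_range, smul_eq_mul] at h1
  have hI : #(univ : Finset (ZMod (T * B) × ((Fin s × Fin n) × Fin r) × ZMod (T * B) × E →
      ZMod 2)) = 2 ^ Fintype.card (ZMod (T * B) × ((Fin s × Fin n) × Fin r) × ZMod (T * B) × E) := by
    rw [card_univ, Fintype.card_fun, ZMod.card]
  rw [hI] at h1
  have h2 : (2 : ℝ) ^ Fintype.card (ZMod (T * B) × ((Fin s × Fin n) × Fin r) × ZMod (T * B) × E) ≤
      T * #{ω | bad ω} := by
    have : (((2 ^ Fintype.card (ZMod (T * B) × ((Fin s × Fin n) × Fin r) × ZMod (T * B) × E) : ℕ)) :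
      ℝ) ≤ ((T * #{ω | bad ω} : ℕ) : ℝ) := Nat.cast_le.2 (by convert h1)
    exact_mod_cast this
  have hpos : (0 : ℝ) <
      2 ^ Fintype.card (ZMod (T * B) × ((Fin s × Fin n) × Fin r) × ZMod (T * B) × E) := by positivity
  generalize (2 : ℝ) ^ Fintype.card (ZMod (T * B) × ((Fin s × Fin n) × Fin r) × ZMod (T * B) × E) =
    x at *
  have h3 : (T : ℝ) * #{ω | bad ω} ≤ T * (κ * x) := by gcongr
  nlinarith

end PivotedHypergraph

/-! ### Good arrays: free distance and independence of the checks -/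

namespace PivotedHypergraph

variable {E : Type} [Fintype E] [DecidableEq E] {s n c r : ℕ} (H : PivotedHypergraph E s n c r)

/-- A codeword is translated to start in block 0 and inspected on Q groups of K blocks. Either every
group is active and the pattern is long, or the codeword can be cut at an inactive group, because
checks reach back only K blocks. -/
theorem le_weight_of_not_lightWord {B K Q d N : ℕ} (hB : 0 < B) (hK : 0 < K) (hQ : 0 < Q)
    {ω : ZMod N × ((Fin s × Fin n) × Fin r) × ZMod N × E → ZMod 2}
    (hω : ∀ β : ℤ, ¬ H.LightWord B K (K * Q) Q d (rotate ((β * B : ℤ) : ZMod N) ω))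
    {v : BinSeq E} (hv : v ∈ checkCode B K H.piv (H.array ω)) (hv0 : v ≠ 0) :
    (d : ℕ∞) ≤ weight v := by
  classical
  have hb : (0 : ℤ) < B := by exact_mod_cast hB
  obtain ⟨⟨t₀, ht₀⟩, hchk⟩ := hv
  obtain ⟨t₁, ht₁, hmin⟩ : ∃ t₁, v t₁ ≠ 0 ∧ ∀ t < t₁, v t = 0 := by
    obtain ⟨t₁, h1, h2⟩ := Int.exists_least_of_bdd (P := fun t => v t ≠ 0)
      ⟨t₀, fun z hz => by by_contra h; exact hz (ht₀ z (by omega))⟩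
      (by by_contra h; push Not at h; exact hv0 (funext h))
    exact ⟨t₁, h1, fun t ht => by by_contra h; have := h2 t h; omega⟩
  set β := t₁ / B with hβ
  set v' : BinSeq E := fun t => v (t + β * B) with hv'
  have hβt : β * B ≤ t₁ := Int.ediv_mul_le _ hb.ne'
  have hβt' : t₁ < (β + 1) * B := Int.lt_ediv_add_one_mul_self _ hb
  have hneg : ∀ t < 0, v' t = 0 := fun t ht => hmin _ (by omega)
  have hchk' : ∀ t p, syndrome B K H.piv
      (H.array (rotate ((β * B : ℤ) : ZMod N) ω)) t p v' = 0 := by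
    intro t p
    rw [array_rotate, syndrome_shift hB]
    exact hchk _ p
  obtain ⟨e₁, he₁⟩ : ∃ e₁, v' (t₁ - β * B) e₁ ≠ 0 := by
    by_contra h
    push Not at h
    refine ht₁ (funext fun e => ?_)
    have := h e
    simp only [hv', sub_add_cancel] at this
    exact this
  set w₀ : Finset (ℤ × E) :=
    {a ∈ Ico (0 : ℤ) ((K * Q : ℕ) * B) ×ˢ univ | v' a.1 a.2 ≠ 0} with hw₀
  have hmem₀ : ∀ a, a ∈ w₀ ↔ (0 ≤ a.1 ∧ a.1 < (K * Q : ℕ) * B) ∧ v' a.1 a.2 ≠ 0 := by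
    intro a; simp [hw₀]
  have hone : (1 : ℤ) ≤ (K * Q : ℕ) := by exact_mod_cast Nat.mul_pos hK hQ
  have hfirst : (t₁ - β * B, e₁) ∈ w₀ := by
    refine (hmem₀ _).2 ⟨⟨by simp only; omega, ?_⟩, he₁⟩
    simp only
    nlinarith
  have hword : ∀ (w : Finset (ℤ × E)) (τ : ℤ), (∀ e, (τ, e) ∈ w ↔ v' τ e ≠ 0) →
      word w τ = v' τ := by
    intro w τ h
    funext e
    unfold word
    by_cases he : v' τ e = 0
    · rw [if_neg (by rw [h]; simp [he]), he]
    · rw [if_pos ((h e).2 he)]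
      generalize v' τ e = x at he
      revert he x
      decide
  have hweight : ∀ w ⊆ w₀, (#w : ℕ∞) ≤ weight v := by
    intro w hw
    have hinj : Function.Injective (fun a : ℤ × E => (a.1 + β * B, a.2)) := by
      rintro ⟨a, e⟩ ⟨a', e'⟩ h
      simp only [Prod.mk.injEq] at h ⊢
      exact ⟨by omega, h.2⟩
    unfold weight
    rw [← Set.encard_coe_eq_coe_finsetCard, ← hinj.encard_image]
    refine Set.encard_le_encard ?_
    rintro _ ⟨a, ha, rfl⟩
    exact ((hmem₀ a).1 (hw ha)).2
  have hconcl : ∀ w ⊆ w₀, (t₁ - β * B, e₁) ∈ w →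
      ((∀ a ∈ blockPattern B w, a.1 + K < (K * Q : ℕ)) ∨ Q ≤ #(blockPattern B w)) →
      (∀ t : ℤ, 0 ≤ t → t < (K * Q : ℕ) * B → ∀ p, syndrome B K H.piv
        (H.array (rotate ((β * B : ℤ) : ZMod N) ω)) t p (word w) = 0) → (d : ℕ∞) ≤ weight v := by
    intro w hw hne hpat hs
    have hd : ¬ #w < d := fun hlt =>
      hω β ⟨w, ⟨_, hne⟩, fun a ha => ((hmem₀ a).1 (hw ha)).1, hlt, hpat, hs⟩
    exact le_trans (by exact_mod_cast not_lt.1 hd) (hweight w hw)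
  by_cases hall : ∀ q ∈ range Q, ∃ a ∈ w₀, (q * K : ℕ) ≤ a.1 / B ∧ a.1 / B < ((q + 1) * K : ℕ)
  · -- every window of `K` blocks is active
    refine hconcl w₀ subset_rfl hfirst (Or.inr ?_) fun t h0 h1 p => ?_
    · have : Nonempty E := ⟨e₁⟩
      choose! f hf1 hf2 hf3 using fun q hq => hall q hq
      have hcard := card_le_card_of_injOn (s := range Q) (t := blockPattern B w₀)
        (fun q => ((f q).1 / B, (f q).2)) (fun q hq => mem_image_of_mem _ (hf1 q hq)) ?_
      · rwa [card_range] at hcard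
      · intro q hq q' hq' heq
        simp only [Prod.mk.injEq] at heq
        have h1 := hf2 q hq
        have h2 := hf3 q hq
        have h3 := hf2 q' hq'
        have h4 := hf3 q' hq'
        rw [heq.1] at h1 h2
        have h5 : q * K < (q' + 1) * K := by exact_mod_cast h1.trans_lt h4
        have h6 : q' * K < (q + 1) * K := by exact_mod_cast h3.trans_lt h2
        have := Nat.lt_of_mul_lt_mul_right h5
        have := Nat.lt_of_mul_lt_mul_right h6
        omega
    · rw [← hchk' t p]
      refine syndrome_congr hB _ _ t p fun τ _ hτ => hword w₀ τ fun e => ?_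
      rw [hmem₀]
      by_cases hτ0 : τ < 0
      · simp [hneg τ hτ0]
      · have : τ < (K * Q : ℕ) * B := by omega
        simp only [this, and_true, not_lt.1 hτ0, true_and]
  · push Not at hall
    obtain ⟨q, hq, hgap⟩ := hall
    rw [mem_range] at hq
    set w : Finset (ℤ × E) := {a ∈ w₀ | a.1 / (B : ℤ) < (q * K : ℕ)} with hw
    have hgap' : ∀ τ : ℤ, (q * K : ℕ) ≤ τ / B → τ / B < ((q + 1) * K : ℕ) → v' τ = 0 := by
      intro τ h1 h2
      funext e
      by_contra h
      refine absurd h2 (not_lt.2 (hgap (τ, e) ((hmem₀ _).2 ⟨(div_mem_Ico hB _).2 ⟨?_, ?_⟩, h⟩) h1))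
      · exact le_trans (by positivity) h1
      · refine lt_of_lt_of_le h2 ?_
        rw [mul_comm K Q]
        exact_mod_cast Nat.mul_le_mul_right K hq
    have hblk : (t₁ - β * B) / B = 0 :=
      Int.ediv_eq_zero_of_lt (by omega) (by linarith)
    have hqpos : 0 < q := by
      rcases Nat.eq_zero_or_pos q with h | h
      · subst h
        exact absurd (congrFun (hgap' (t₁ - β * B) (by rw [hblk]; simp) (by
          rw [hblk]; simpa using hK)) e₁) he₁
      · exact h
    refine hconcl w (filter_subset _ _) (mem_filter.2 ⟨hfirst, ?_⟩) (Or.inl ?_)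
      fun t h0 h1 p => ?_
    · simp only
      rw [hblk]
      exact_mod_cast Nat.mul_pos hqpos hK
    · intro a ha
      obtain ⟨x, hx, rfl⟩ := mem_image.1 ha
      have h2 := (mem_filter.1 hx).2
      have h3 : ((q * K : ℕ) : ℤ) + K ≤ (K * Q : ℕ) := by
        rw [mul_comm K Q]
        have := Nat.mul_le_mul_right K hq
        rw [Nat.succ_mul] at this
        exact_mod_cast this
      simp only
      omega
    -- Checks up to the end of the inactive group cannot tell the cut word from the codeword; later
    -- ones look back at most to the start of that group and see only zeros.
    · by_cases ht : t / B < ((q + 1) * K : ℕ)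
      · rw [← hchk' t p]
        refine syndrome_congr hB _ _ t p fun τ _ hτ => hword w τ fun e => ?_
        rw [hw, mem_filter, hmem₀]
        have hτt : τ / B ≤ t / B := Int.ediv_le_ediv hb hτ
        by_cases hτ0 : τ < 0
        · simp [hneg τ hτ0]
        · by_cases h2 : τ / B < (q * K : ℕ)
          · have : τ < (K * Q : ℕ) * B := by omega
            simp only [this, and_true, not_lt.1 hτ0, true_and, h2]
          · simp [hgap' τ (not_lt.1 h2) (by omega)]
      · rw [← map_zero (syndrome B K H.piv (H.array (rotate ((β * B : ℤ) : ZMod N) ω)) t p)]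
        refine syndrome_congr hB _ _ t p fun τ hτ _ => ?_
        funext e
        refine if_neg fun hmem => ?_
        have h2 := (mem_filter.1 hmem).2
        have h3 : t / B - K ≤ τ / B := (Int.le_ediv_iff_mul_le hb).2 hτ
        simp only at h2
        push_cast at h2 ht
        linarith

theorem dualInjective_of_not_dependent {B K L N : ℕ} (hB : 0 < B)
    {ω : ZMod N × ((Fin s × Fin n) × Fin r) × ZMod N × E → ZMod 2}
    (hω : ∀ β : ℤ, ¬ H.Dependent B K L (rotate ((β * B : ℤ) : ZMod N) ω)) :
    DualInjective B K L H.piv (H.array ω) := by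
  classical
  intro β y hy
  by_contra hcon
  push Not at hcon
  obtain ⟨t₁, ht₁, p₁, hp₁⟩ := hcon
  rw [mem_Ico] at ht₁
  set Y : Finset (ℤ × ((Fin s × Fin n) × Fin r)) :=
    {a ∈ Ico (0 : ℤ) ((L + K : ℕ) * B) ×ˢ univ | y (a.1 + β * B) a.2 ≠ 0} with hY
  have hlen : (β + L + K) * (B : ℤ) = (L + K : ℕ) * B + β * B := by push_cast; ring
  refine hω β ⟨Y, ⟨(t₁ - β * B, p₁), ?_⟩, fun a ha => ?_, fun τ h0 h1 e => ?_⟩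
  · refine mem_filter.2 ⟨mem_product.2 ⟨mem_Ico.2 ⟨?_, ?_⟩, mem_univ _⟩, ?_⟩
    · simp only; omega
    · simp only; omega
    · simpa using hp₁
  · have := (mem_product.1 (mem_filter.1 ha).1).1
    rwa [mem_Ico] at this
  · have h2 := hy (τ + β * B) (mem_Ico.2 ⟨by omega, by rw [add_mul]; omega⟩) e
    rw [hlen] at h2
    have h3 := sum_Ico_add' (fun t => ∑ p, y t p *
      syndrome B K H.piv (H.array ω) t p (impulse (τ + β * B) e)) 0 ((L + K : ℕ) * B : ℤ) (β * B)
    rw [zero_add] at h3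
    rw [← h3, ← sum_product' (f := fun t p => y (t + β * B) p *
      syndrome B K H.piv (H.array ω) (t + β * B) p (impulse (τ + β * B) e))] at h2
    rw [← h2, hY, sum_filter]
    refine sum_congr rfl fun a _ => ?_
    rw [array_rotate, ← impulse_shift (β * B) τ e, syndrome_shift hB]
    generalize y (a.1 + β * B) a.2 = x
    generalize syndrome B K H.piv (H.array ω) (a.1 + β * B) a.2 (impulse (τ + β * B) e) = z
    revert x z
    decide

/-- Existence of check coefficients with large free distance and independent checks. -/
theorem exists_coefficients {B K L Q T d : ℕ} (hB : 0 < B) (hK : 0 < K) (hQ : 0 < Q)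
    (hMT : K * Q ≤ T) (hLT : L + K ≤ T) (hsr : s * r < c) (hL : s * r * (L + K) < c * L) {δ : ℝ}
    (hδ : 1 ≤ δ * 2 ^ B)
    (hcount : ∀ S : Finset (ℤ × E), S.Nonempty → (∀ a ∈ S, 0 ≤ a.1 ∧ a.1 < (K * Q : ℕ)) →
      ((∀ a ∈ S, a.1 + K < (K * Q : ℕ)) ∨ Q ≤ #S) →
      (#{w ∈ (cells B S).powerset | #w < d} : ℝ) ≤ δ * 2 ^ (B * (r * #(H.seen K (K * Q) S))))
    (hsmall : T * ((2 ^ (K * Q * Fintype.card E) + 2 ^ ((L + K) * (s * n * r))) * δ) < 1) :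
    ∃ h : ℤ → (Fin s × Fin n) × Fin r → ℤ → E → ZMod 2,
      (∀ t p τ e, ¬ H.Inc p.1 e → h t p τ e = 0) ∧
      (∀ v ∈ checkCode B K H.piv h, v ≠ 0 → (d : ℕ∞) ≤ weight v) ∧
      DualInjective B K L H.piv h := by
  classical
  have hT : 0 < T := by have := Nat.mul_pos hK hQ; omega
  have hNZ : NeZero (T * B) := ⟨(Nat.mul_pos hT hB).ne'⟩
  have hδ0 : 0 ≤ δ := by
    by_contra h
    have : δ * 2 ^ B < 0 := mul_neg_of_neg_of_pos (by linarith) (by positivity)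
    linarith
  have h1 := H.card_lightWord_le (N := T * B) (d := d) hB (Nat.mul_le_mul_right B hMT) hδ0 hcount
  have h2 := H.card_dependent_le (N := T * B) hB (Nat.mul_le_mul_right B hLT) hsr hL hδ
  obtain ⟨ω, hω⟩ := exists_forall_rotate (s := s) (n := n) (r := r) (E := E) (B := B) hT
    (κ := (2 ^ (K * Q * Fintype.card E) + 2 ^ ((L + K) * (s * n * r))) * δ)
    (fun ω => H.LightWord B K (K * Q) Q d ω ∨ H.Dependent B K L ω) (by
      rw [filter_or]
      refine le_trans (Nat.cast_le.2 (card_union_le _ _)) ?_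
      push_cast
      linarith) hsmall
  refine ⟨H.array ω, fun t p τ e he => ?_,
    fun v hv hv0 => H.le_weight_of_not_lightWord hB hK hQ (fun β hβ => hω β (Or.inl hβ)) hv hv0,
    H.dualInjective_of_not_dependent hB fun β hβ => hω β (Or.inr hβ)⟩
  unfold array coeff
  rw [if_neg he]
  rfl

end PivotedHypergraph

/-! ### Check codes as woven graph codes -/

namespace PivotedHypergraph

section Woven

variable {s n b c r : ℕ} (H : PivotedHypergraph (Fin (n * c)) s n c r)

/-- The underlying hypergraph. -/
def toPartite : PartiteHypergraph s n c where
  vertex := H.vx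
  regular i t := by rw [Fintype.card_subtype]; exact H.card_fiber i t

/-- A numbering of the edges at each vertex. -/
noncomputable def port (i : Fin s) (t : Fin n) : Fin c ≃ {e : Fin (n * c) // H.vx i e = t} :=
  (Fintype.equivFinOfCardEq (H.toPartite.regular i t)).symm

/-- The pivots at a vertex, as ports. -/
noncomputable def localPiv (i : Fin s) (t : Fin n) (l : Fin r) : Fin c :=
  (H.port i t).symm ⟨H.piv ((i, t), l), H.vx_piv ((i, t), l)⟩

theorem port_localPiv (i : Fin s) (t : Fin n) (l : Fin r) :
    (H.port i t (H.localPiv i t l)).1 = H.piv ((i, t), l) := by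
  simp [localPiv]

theorem localPiv_injective (i : Fin s) (t : Fin n) : Function.Injective (H.localPiv i t) := by
  intro l l' h
  have h1 := H.port_localPiv i t l
  rw [h, H.port_localPiv] at h1
  have := H.piv_injective h1
  simp only [Prod.mk.injEq, true_and] at this
  exact this.symm

/-- The check coefficients at a vertex. -/
noncomputable def localCoeff (h : ℤ → (Fin s × Fin n) × Fin r → ℤ → Fin (n * c) → ZMod 2)
    (i : Fin s) (t : Fin n) : ℤ → Fin r → ℤ → Fin c → ZMod 2 :=
  fun τ l τ' j => h τ ((i, t), l) τ' (H.port i t j).1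

-- Combinations of the checks of a single vertex are special combinations of all checks, so each
-- constituent code inherits independence and is itself convolutional.
variable {H} in
theorem dualInjective_local {B K L : ℕ} (hB : 0 < B)
    {h : ℤ → (Fin s × Fin n) × Fin r → ℤ → Fin (n * c) → ZMod 2}
    (hinc : ∀ t p τ e, ¬ H.Inc p.1 e → h t p τ e = 0) (hd : DualInjective B K L H.piv h)
    (i : Fin s) (t : Fin n) : DualInjective B K L (H.localPiv i t) (H.localCoeff h i t) := by
  intro β y hy τ hτ l
  have key := hd β (fun t' p => if p.1 = (i, t) then y t' p.2 else 0) ?_ τ hτ ((i, t), l)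
  · simpa using key
  · intro τ' hτ' e
    have hsum : ∀ t' : ℤ, ∑ p : (Fin s × Fin n) × Fin r, (if p.1 = (i, t) then y t' p.2 else 0) *
        syndrome B K H.piv h t' p (impulse τ' e) =
        ∑ l, y t' l * syndrome B K H.piv h t' ((i, t), l) (impulse τ' e) := by
      intro t'
      rw [Fintype.sum_prod_type, sum_eq_single (i, t)]
      · simp
      · intro x _ hx; simp [hx]
      · simp
    simp only [hsum]
    by_cases he : H.vx i e = t
    · obtain ⟨j, hj⟩ := (H.port i t).surjective ⟨e, he⟩
      rw [← hy τ' hτ' j]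
      refine sum_congr rfl fun t' _ => sum_congr rfl fun l' _ => ?_
      rw [syndrome_impulse hB, syndrome_impulse hB]
      have h1 : H.piv ((i, t), l') = e ↔ H.localPiv i t l' = j := by
        rw [← H.port_localPiv, ← (H.port i t).apply_eq_iff_eq, Subtype.ext_iff, hj]
      have h2 : h t' ((i, t), l') τ' e = H.localCoeff h i t t' l' τ' j := by
        unfold localCoeff
        rw [hj]
      simp only [h1, h2]
    · refine sum_eq_zero fun t' _ => sum_eq_zero fun l' _ => ?_
      rw [syndrome_impulse hB, hinc _ _ _ _ he, if_neg]
      · simp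
      · rintro ⟨-, rfl⟩
        exact he (H.vx_piv ((i, t), l'))

theorem card_compl_range {α β : Type} [Fintype α] [Fintype β] [DecidableEq β] {f : α → β}
    (hf : Function.Injective f) :
    Fintype.card {e : β // e ∉ Set.range f} + Fintype.card α = Fintype.card β := by
  classical
  rw [Fintype.card_subtype_compl (fun e => e ∈ Set.range f)]
  have h1 := Set.card_range_of_injective hf
  have h2 := Fintype.card_subtype_le (fun e => e ∈ Set.range f)
  have h3 : Fintype.card {e // e ∈ Set.range f} = Fintype.card α := by convert h1
  omega

variable {H} in
/-- The woven graph code with given check coefficients. -/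
noncomputable def woven {B K L : ℕ} (hB : 0 < B) (hbr : b + r = c)
    {h : ℤ → (Fin s × Fin n) × Fin r → ℤ → Fin (n * c) → ZMod 2}
    (hinc : ∀ t p τ e, ¬ H.Inc p.1 e → h t p τ e = 0) (hd : DualInjective B K L H.piv h) :
    WovenGraphCode s n b c where
  graph := H.toPartite
  port := H.port
  constituent i t := checkCode B K (H.localPiv i t) (H.localCoeff h i t)
  isConvolutional i t := by
    have hcard : Fintype.card {e : Fin c // e ∉ Set.range (H.localPiv i t)} = b := by
      have := card_compl_range (H.localPiv_injective i t)
      rw [Fintype.card_fin, Fintype.card_fin] at this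
      omega
    obtain ⟨G, hG⟩ := (dualInjective_local hB hinc hd i t).controllable hB |>.exists_isGenerator hB
      (Fintype.equivFinOfCardEq hcard).symm
    exact ⟨_, G, hG⟩

theorem syndrome_local {B K : ℕ}
    {h : ℤ → (Fin s × Fin n) × Fin r → ℤ → Fin (n * c) → ZMod 2}
    (hinc : ∀ t p τ e, ¬ H.Inc p.1 e → h t p τ e = 0) (i : Fin s) (t : Fin n) (l : Fin r) (τ : ℤ)
    (v : BinSeq (Fin (n * c))) :
    syndrome B K (H.localPiv i t) (H.localCoeff h i t) τ l (fun τ j => v τ (H.port i t j).1) =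
      syndrome B K H.piv h τ ((i, t), l) v := by
  rw [syndrome_apply, syndrome_apply, H.port_localPiv]
  congr 1
  refine sum_congr rfl fun τ' _ => ?_
  unfold localCoeff
  rw [(H.port i t).sum_comp (fun e => h τ ((i, t), l) τ' e.1 * v τ' e.1)]
  rw [← sum_subtype (p := fun e => H.vx i e = t) {e | H.vx i e = t} (by simp)
    (fun e => h τ ((i, t), l) τ' e * v τ' e)]
  refine sum_subset (subset_univ _) fun e _ he => ?_
  rw [hinc _ _ _ _ fun hh => he (mem_filter.2 ⟨mem_univ _, hh⟩), zero_mul]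

/-- Each check involves edges of one vertex only, so it can be tested locally. A common starting
time exists because part 0 has finitely many vertices and covers all edges. -/
theorem code_woven {B K L : ℕ} (hs : 0 < s) (hB : 0 < B) (hbr : b + r = c)
    {h : ℤ → (Fin s × Fin n) × Fin r → ℤ → Fin (n * c) → ZMod 2}
    (hinc : ∀ t p τ e, ¬ H.Inc p.1 e → h t p τ e = 0) (hd : DualInjective B K L H.piv h) :
    (woven hB hbr hinc hd).code = checkCode B K H.piv h := by
  ext v
  constructor
  · intro hv
    have hv' : ∀ i t, IsLaurent (fun τ j => v τ (H.port i t j).1) ∧ ∀ τ l,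
      syndrome B K (H.localPiv i t) (H.localCoeff h i t) τ l
        (fun τ j => v τ (H.port i t j).1) = 0 := hv
    refine ⟨?_, fun τ p => ?_⟩
    · choose T hT using fun t => (hv' ⟨0, hs⟩ t).1
      obtain ⟨T₀, hT₀⟩ : ∃ T₀, ∀ t, T₀ ≤ T t := (Set.finite_range T).bddBelow.imp
        fun T₀ h t => h ⟨t, rfl⟩
      refine ⟨T₀, fun τ hτ => funext fun e => ?_⟩
      obtain ⟨j, hj⟩ := (H.port ⟨0, hs⟩ (H.vx ⟨0, hs⟩ e)).surjective ⟨e, rfl⟩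
      have h1 := congrFun (hT (H.vx ⟨0, hs⟩ e) τ (lt_of_lt_of_le hτ (hT₀ _))) j
      simp only [hj] at h1
      exact h1
    · rw [← H.syndrome_local hinc p.1.1 p.1.2 p.2 τ v]
      exact (hv' p.1.1 p.1.2).2 τ p.2
  · rintro ⟨⟨T₀, hT₀⟩, hv⟩ i t
    refine ⟨⟨T₀, fun τ hτ => funext fun j => ?_⟩, fun τ l => ?_⟩
    · exact congrFun (hT₀ τ hτ) _
    · exact (H.syndrome_local hinc i t l τ v).trans (hv τ _)

end Woven

end PivotedHypergraph

/-! ### Hypergraphs of shifted rows with disjoint pivot columns -/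

section Shifted

variable {s n c r : ℕ}

/-- The column with which the edge of the shifted hypergraph that is the pivot number `l` of a
vertex of part `i` is listed. -/
def pivotColumn (hsr : s * r ≤ c) (i : Fin s) (l : Fin r) : Fin c :=
  ⟨i * r + l, by
    have h1 : (i : ℕ) * r + r ≤ s * r := by
      rw [← Nat.succ_mul]; exact Nat.mul_le_mul_right r i.2
    have := l.2
    omega⟩

theorem pivotColumn_injective (hsr : s * r ≤ c) {i i' : Fin s} {l l' : Fin r}
    (h : pivotColumn hsr i l = pivotColumn hsr i' l') : i = i' ∧ l = l' := by
  have h1 : (i : ℕ) * r + l = i' * r + l' := congrArg Fin.val h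
  have hl := l.2
  have hl' := l'.2
  have hr : 0 < r := by omega
  have h2 : (i : ℕ) = i' := by
    have := congrArg (· / r) h1
    simp only [mul_comm _ r] at this
    rwa [Nat.mul_add_div hr, Nat.mul_add_div hr, Nat.div_eq_of_lt hl, Nat.div_eq_of_lt hl'] at this
  rw [h2] at h1
  exact ⟨Fin.ext h2, Fin.ext (by omega)⟩

theorem exists_pivotColumn (hsr : s * r ≤ c) {j : Fin c} (hj : (j : ℕ) < s * r) :
    ∃ (i : Fin s) (l : Fin r), pivotColumn hsr i l = j := by
  have hr : 0 < r := by
    rcases Nat.eq_zero_or_pos r with h | h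
    · subst h; simp at hj
    · exact h
  refine ⟨⟨j / r, (Nat.div_lt_iff_lt_mul hr).2 hj⟩, ⟨j % r, Nat.mod_lt _ hr⟩, Fin.ext ?_⟩
  change (j : ℕ) / r * r + j % r = j
  rw [mul_comm]
  exact Nat.div_add_mod _ _

theorem pivotColumn_lt (hsr : s * r ≤ c) (i : Fin s) (l : Fin r) :
    (pivotColumn hsr i l : ℕ) < s * r := by
  change (i : ℕ) * r + l < s * r
  have h1 : (i : ℕ) * r + r ≤ s * r := by
    rw [← Nat.succ_mul]; exact Nat.mul_le_mul_right r i.2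
  have := l.2
  omega

/-- The vertex of part `i` on the edge `e`: edges are pairs of a row and a column, and the row is
shifted by an amount depending on the part and the column. -/
def shiftedVertex (σ : Fin s → Fin c → Fin n) (i : Fin s) (e : Fin (n * c)) : Fin n :=
  (finProdFinEquiv.symm e).1 + σ i (finProdFinEquiv.symm e).2

/-- The edge in column `j` on the vertex `τ` of part `i`. -/
def shiftedEdge (σ : Fin s → Fin c → Fin n) (i : Fin s) (τ : Fin n) (j : Fin c) : Fin (n * c) :=
  finProdFinEquiv (τ - σ i j, j)

theorem shiftedVertex_shiftedEdge [NeZero n] (σ : Fin s → Fin c → Fin n) (i : Fin s) (τ : Fin n) (j : Fin c) :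
    shiftedVertex σ i (shiftedEdge σ i τ j) = τ := by
  simp only [shiftedVertex, shiftedEdge, Equiv.symm_apply_apply]
  exact sub_add_cancel _ _

theorem column_shiftedEdge (σ : Fin s → Fin c → Fin n) (i : Fin s) (τ : Fin n) (j : Fin c) :
    (finProdFinEquiv.symm (shiftedEdge σ i τ j)).2 = j := by
  simp only [shiftedEdge, Equiv.symm_apply_apply]

theorem shiftedEdge_column [NeZero n] (σ : Fin s → Fin c → Fin n) (i : Fin s) (e : Fin (n * c)) :
    shiftedEdge σ i (shiftedVertex σ i e) (finProdFinEquiv.symm e).2 = e := by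
  unfold shiftedEdge shiftedVertex
  rw [← Equiv.eq_symm_apply]
  exact Prod.ext (add_sub_cancel_right _ _) rfl

/-- The parts use consecutive groups of r columns for their pivots. Whether an edge is a pivot thus
depends on its column alone, and each vertex, having one edge per column, has exactly c - s r free
edges. -/
theorem mem_range_pivot [NeZero n] (hsr : s * r ≤ c) (σ : Fin s → Fin c → Fin n) (e : Fin (n * c)) :
    e ∈ Set.range (fun p : (Fin s × Fin n) × Fin r =>
      shiftedEdge σ p.1.1 p.1.2 (pivotColumn hsr p.1.1 p.2)) ↔
      ((finProdFinEquiv.symm e).2 : ℕ) < s * r := by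
  constructor
  · rintro ⟨p, rfl⟩
    simp only [column_shiftedEdge]
    exact pivotColumn_lt hsr _ _
  · intro h
    obtain ⟨i, l, hil⟩ := exists_pivotColumn hsr h
    refine ⟨((i, shiftedVertex σ i e), l), ?_⟩
    simp only [hil, shiftedEdge_column]

/-- The shifted hypergraph. -/
def shiftedHypergraph [NeZero n] (hsr : s * r ≤ c) (σ : Fin s → Fin c → Fin n) :
    PivotedHypergraph (Fin (n * c)) s n c r where
  vx := shiftedVertex σ
  piv p := shiftedEdge σ p.1.1 p.1.2 (pivotColumn hsr p.1.1 p.2)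
  card_fiber i τ := by
    have hc : c = #(univ : Finset (Fin c)) := by simp
    conv_rhs => rw [hc]
    refine card_nbij' (fun e => (finProdFinEquiv.symm e).2) (shiftedEdge σ i τ) ?_ ?_ ?_ ?_
    · intro e _; simp
    · intro j _; simp [shiftedVertex_shiftedEdge]
    · intro e he
      simp only [coe_filter, mem_univ, true_and, Set.mem_ofPred_eq] at he
      rw [← he, shiftedEdge_column]
    · intro j _; exact column_shiftedEdge σ i τ j
  piv_injective := by
    rintro ⟨⟨i, τ⟩, l⟩ ⟨⟨i', τ'⟩, l'⟩ h
    simp only at h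
    have h1 := congrArg (fun e => (finProdFinEquiv.symm e).2) h
    simp only [column_shiftedEdge] at h1
    obtain ⟨rfl, rfl⟩ := pivotColumn_injective hsr h1
    have h2 := congrArg (shiftedVertex σ i) h
    rw [shiftedVertex_shiftedEdge, shiftedVertex_shiftedEdge] at h2
    rw [h2]
  vx_piv p := shiftedVertex_shiftedEdge σ _ _ _
  card_free i τ := by
    have h1 : #{e | shiftedVertex σ i e = τ ∧ e ∉ Set.range (fun p : (Fin s × Fin n) × Fin r =>
        shiftedEdge σ p.1.1 p.1.2 (pivotColumn hsr p.1.1 p.2))} =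
        #{j : Fin c | ¬ (j : ℕ) < s * r} := by
      refine card_nbij' (fun e => (finProdFinEquiv.symm e).2) (shiftedEdge σ i τ) ?_ ?_ ?_ ?_
      · intro e he
        simp only [mem_range_pivot, coe_filter, mem_univ, true_and, Set.mem_ofPred_eq] at he ⊢
        exact he.2
      · intro j hj
        simp only [mem_range_pivot, coe_filter, mem_univ, true_and, Set.mem_ofPred_eq,
          column_shiftedEdge, shiftedVertex_shiftedEdge] at hj ⊢
        exact hj
      · intro e he
        simp only [coe_filter, mem_univ, true_and, Set.mem_ofPred_eq] at he
        rw [← he.1, shiftedEdge_column]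
      · intro j _; exact column_shiftedEdge σ i τ j
    have h2 : #{j : Fin c | (j : ℕ) < s * r} = s * r := by
      rw [Fin.card_filter_val_lt]
      omega
    have h3 := card_filter_add_card_filter_not (s := (univ : Finset (Fin c)))
      (fun j => (j : ℕ) < s * r)
    rw [card_univ, Fintype.card_fin] at h3
    rw [h1]
    omega

end Shifted

/-! ### Expansion -/

section Expansion

theorem card_filter_mod_mem_le {c q : ℕ} (hq : 0 < q) (F : Finset (Fin q)) :
    #{j : Fin c | (⟨j % q, Nat.mod_lt _ hq⟩ : Fin q) ∈ F} ≤ #F * (c / q + 1) := by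
  rw [← card_range (c / q + 1), ← card_product]
  refine card_le_card_of_injOn (fun j : Fin c => (⟨j % q, Nat.mod_lt _ hq⟩, (j : ℕ) / q)) ?_ ?_
  · intro j hj
    simp only [coe_filter, mem_univ, true_and, Set.mem_ofPred_eq] at hj
    simp only [coe_product, Set.mem_prod, mem_coe, mem_range]
    exact ⟨hj, Nat.lt_succ_of_le (Nat.div_le_div_right j.2.le)⟩
  · intro j _ j' _ h
    simp only [Prod.mk.injEq, Fin.mk.injEq] at h
    refine Fin.ext ?_
    rw [← Nat.div_add_mod j q, ← Nat.div_add_mod j' q, h.1, h.2]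

/-- There are shifts for which every large set of edges touches almost all vertices. -/
theorem exists_expanding_shifts (n : ℕ) [NeZero n] {ε η : ℝ} (hε : 0 < ε) (hη : 0 < η) :
    ∃ s : ℕ, 2 ≤ s ∧ ∀ c : ℕ, s < c → ∃ σ : Fin s → Fin c → Fin n,
      ∀ A : Finset (Fin n × Fin c),
        (#{x : Fin s × Fin n | ∃ a ∈ A, a.1 + σ x.1 a.2 = x.2} : ℝ) < (1 - ε) * (s * n) →
        (#A : ℝ) ≤ η * c := by
  classical
  have hn : 0 < n := Nat.pos_of_ne_zero (NeZero.ne n)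
  have hnR : (0 : ℝ) < n := by exact_mod_cast hn
  have hn1 : (1 : ℝ) ≤ n := by exact_mod_cast hn
  have hθ0 : (0 : ℝ) ≤ 1 - 1 / n := by
    rw [sub_nonneg, div_le_one hnR]; exact hn1
  have hθ1 : (1 : ℝ) - 1 / n < 1 := by
    have : (0 : ℝ) < 1 / n := by positivity
    linarith
  obtain ⟨M, hM⟩ : ∃ M : ℕ, (1 - 1 / (n : ℝ)) ^ M < η / (2 * n) :=
    exists_pow_lt_of_lt_one (by positivity) hθ1
  obtain ⟨k, hk⟩ : ∃ k : ℕ, (M : ℝ) / ε < k := exists_nat_gt _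
  have hk0 : 0 < k := by
    have : (0 : ℝ) < k := lt_of_le_of_lt (by positivity) hk
    exact_mod_cast this
  have hMk : (M : ℝ) < ε * k := by rwa [div_lt_iff₀' hε] at hk
  set q := n ^ k with hq
  have hq0 : 0 < q := pow_pos hn k
  -- A column is read modulo q = n^k as a string of k digits, and part i shifts by digit number i
  -- mod k. Each digit is used by 2q parts; s < c then gives q ≤ c, so rounding at most doubles the
  -- number of columns with a given string.
  refine ⟨k * (2 * q), by nlinarith, fun c hc => ?_⟩
  let dig : Fin c → Fin k → Fin n := fun j => finFunctionFinEquiv.symm ⟨j % q, Nat.mod_lt _ hq0⟩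
  let cls : Fin (k * (2 * q)) → Fin k := fun i => ⟨i % k, Nat.mod_lt _ hk0⟩
  refine ⟨fun i j => dig j (cls i), fun A hA => ?_⟩
  set D : Finset (Fin k) := {d | ∃ τ, ∀ a ∈ A, a.1 + dig a.2 d ≠ τ} with hD
  -- many digit positions have an untouched vertex
  have hDcard : M ≤ #D := by
    have hclass : #{i | cls i ∈ D} ≤ #D * (2 * q) := by
      refine le_of_le_of_eq (b := #(D ×ˢ range (2 * q))) ?_ (by simp)
      refine card_le_card_of_injOn (fun i => (cls i, (i : ℕ) / k)) ?_ ?_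
      · intro i hi
        simp only [coe_filter, mem_univ, true_and, Set.mem_ofPred_eq] at hi
        simp only [coe_product, Set.mem_prod, mem_coe, mem_range]
        exact ⟨hi, (Nat.div_lt_iff_lt_mul hk0).2 (i.2.trans_eq (mul_comm _ _))⟩
      · intro i _ i' _ h
        simp only [cls, Prod.mk.injEq, Fin.mk.injEq] at h
        refine Fin.ext ?_
        rw [← Nat.div_add_mod i k, ← Nat.div_add_mod i' k, h.1, h.2]
    have hmiss : #{x : Fin (k * (2 * q)) × Fin n | ¬ ∃ a ∈ A, a.1 + dig a.2 (cls x.1) = x.2} ≤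
        #D * (2 * q) * n := by
      calc _ ≤ #(({i | cls i ∈ D} : Finset (Fin (k * (2 * q)))) ×ˢ (univ : Finset (Fin n))) := card_le_card fun x hx => by
            refine mem_product.2 ⟨mem_filter.2 ⟨mem_univ _, mem_filter.2 ⟨mem_univ _, x.2, ?_⟩⟩,
              mem_univ _⟩
            intro a ha h
            exact (mem_filter.1 hx).2 ⟨a, ha, h⟩
        _ = #{i | cls i ∈ D} * n := by rw [card_product]; simp
        _ ≤ _ := Nat.mul_le_mul_right n hclass
    have htot := card_filter_add_card_filter_not
      (s := (univ : Finset (Fin (k * (2 * q)) × Fin n)))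
      (fun x => ∃ a ∈ A, a.1 + dig a.2 (cls x.1) = x.2)
    rw [card_univ, Fintype.card_prod, Fintype.card_fin, Fintype.card_fin] at htot
    have htotR : (#{x : Fin (k * (2 * q)) × Fin n | ∃ a ∈ A, a.1 + dig a.2 (cls x.1) = x.2} : ℝ) +
        #{x : Fin (k * (2 * q)) × Fin n | ¬ ∃ a ∈ A, a.1 + dig a.2 (cls x.1) = x.2} =
        k * (2 * q) * n := by exact_mod_cast htot
    have hmissR : (#{x : Fin (k * (2 * q)) × Fin n |
        ¬ ∃ a ∈ A, a.1 + dig a.2 (cls x.1) = x.2} : ℝ) ≤ #D * (2 * q) * n := by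
      exact_mod_cast hmiss
    have hqn : (0 : ℝ) < 2 * q * n := by
      have : (0 : ℝ) < q := by exact_mod_cast hq0
      positivity
    push_cast at hA
    have h1 : ε * k * (2 * q * n) < #D * (2 * q * n) := by linarith
    have h2 : ε * k < #D := lt_of_mul_lt_mul_right h1 hqn.le
    exact_mod_cast (hMk.trans h2).le
  choose! τ hτ using fun d (hd : d ∈ D) => (mem_filter.1 hd).2
  -- In row x, missing the vertex τ d forbids the value τ d - x for digit d. With at least M such
  -- digits, only a proportion (1 - 1/n)^M of the strings remains.
  let F : Fin n → Finset (Fin k → Fin n) := fun x =>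
    Fintype.piFinset fun d => if d ∈ D then univ.erase (τ d - x) else univ
  have hFcard : ∀ x, #(F x) = (n - 1) ^ #D * n ^ (k - #D) := by
    intro x
    rw [Fintype.card_piFinset, ← prod_filter_mul_prod_filter_not univ (fun d => d ∈ D)]
    congr 1
    · rw [prod_congr rfl (g := fun _ => n - 1), prod_const]
      · congr 2; ext; simp
      · intro d hd
        rw [if_pos (mem_filter.1 hd).2, card_erase_of_mem (mem_univ _)]
        simp
    · rw [prod_congr rfl (g := fun _ => n), prod_const]
      · congr 1
        rw [filter_not, card_sdiff_of_subset (filter_subset _ _)]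
        simp
      · intro d hd
        rw [if_neg (mem_filter.1 hd).2]
        simp
  have hsub : A ⊆ univ.biUnion fun x : Fin n =>
      ({x} : Finset (Fin n)) ×ˢ ({j : Fin c | (⟨j % q, Nat.mod_lt _ hq0⟩ : Fin q) ∈
        (F x).map finFunctionFinEquiv.toEmbedding} : Finset (Fin c)) := by
    intro a ha
    refine mem_biUnion.2 ⟨a.1, mem_univ _, mem_product.2 ⟨mem_singleton_self _,
      mem_filter.2 ⟨mem_univ _, mem_map.2 ⟨dig a.2, ?_, ?_⟩⟩⟩⟩
    · refine Fintype.mem_piFinset.2 fun d => ?_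
      split_ifs with hd
      · refine mem_erase.2 ⟨fun h => hτ d hd a ha ?_, mem_univ _⟩
        rw [h]
        exact add_sub_cancel _ _
      · exact mem_univ _
    · exact finFunctionFinEquiv.apply_symm_apply _
  have hcard : #A ≤ n * ((n - 1) ^ #D * n ^ (k - #D) * (c / q + 1)) := by
    calc #A ≤ _ := card_le_card hsub
      _ ≤ _ := card_biUnion_le
      _ ≤ ∑ _x : Fin n, (n - 1) ^ #D * n ^ (k - #D) * (c / q + 1) := sum_le_sum fun x _ => by
          rw [card_product, card_singleton, one_mul]
          refine (card_filter_mod_mem_le hq0 _).trans ?_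
          rw [card_map, hFcard]
      _ = _ := by simp
  have hDk : #D ≤ k := by simpa using card_le_univ D
  have hqR : (0 : ℝ) < q := by exact_mod_cast hq0
  have h1 : ((c / q + 1 : ℕ) : ℝ) ≤ 2 * c / q := by
    have h2 : ((c / q : ℕ) : ℝ) ≤ c / q := Nat.cast_div_le
    have h3 : (1 : ℝ) ≤ c / q := by
      rw [le_div_iff₀ hqR, one_mul]
      have : q ≤ c := by nlinarith
      exact_mod_cast this
    push_cast
    rw [mul_div_assoc]
    linarith
  have h2 : (((n - 1) ^ #D * n ^ (k - #D) : ℕ) : ℝ) = (1 - 1 / n) ^ #D * q := by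
    rw [hq]
    push_cast [Nat.cast_sub hn]
    have : (n : ℝ) ^ k = n ^ #D * n ^ (k - #D) := by rw [← pow_add, Nat.add_sub_cancel' hDk]
    rw [this, ← mul_assoc, ← mul_pow]
    congr 2
    field_simp
  calc (#A : ℝ) ≤ n * (((n - 1) ^ #D * n ^ (k - #D) : ℕ) * ((c / q + 1 : ℕ) : ℝ)) := by
        exact_mod_cast hcard
    _ ≤ n * ((1 - 1 / n) ^ #D * q * (2 * c / q)) := by rw [h2]; gcongr
    _ = 2 * n * c * (1 - 1 / n) ^ #D := by field_simp
    _ ≤ 2 * n * c * (1 - 1 / n) ^ M := by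
        gcongr ?_ * ?_
        exact pow_le_pow_of_le_one hθ0 hθ1.le hDcard
    _ ≤ 2 * n * c * (η / (2 * n)) := by gcongr
    _ = η * c := by field_simp

end Expansion

/-! ### Light words against seen checks, for long blocks -/

theorem freeDistance_ne_top {ι : Type} [Finite ι] {k m : ℕ} (hk : 0 < k)
    {G : ℕ → ℤ → Matrix (Fin k) ι (ZMod 2)} {C : Submodule (ZMod 2) (BinSeq ι)}
    (hG : IsGenerator m G C) : freeDistance C ≠ ⊤ := by
  have hL : IsLaurent (impulse 0 (⟨0, hk⟩ : Fin k)) := ⟨0, fun t ht => impulse_of_ne (by omega) _⟩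
  set v := encode m G (impulse 0 (⟨0, hk⟩ : Fin k)) with hv
  have hv0 : v ≠ 0 := by
    intro h0
    have := congrFun (congrFun (hG.1 _ hL h0) 0) ⟨0, hk⟩
    rw [impulse_apply] at this
    simp at this
  have hfin : weight v ≠ ⊤ := by
    refine Set.encard_ne_top_iff.2 ?_
    refine ((Set.finite_Icc (0 : ℤ) m).prod (Set.finite_univ (α := ι))).subset ?_
    rintro ⟨t, i⟩ h
    refine ⟨?_, trivial⟩
    by_contra hcon
    refine h ?_
    have : v t = 0 := by
      rw [hv]
      unfold encode
      refine sum_eq_zero fun a ha => ?_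
      rw [mem_range] at ha
      rw [impulse_of_ne (by simp only [Set.mem_Icc] at hcon; omega), Matrix.zero_vecMul]
    simp [this]
  refine ne_top_of_le_ne_top hfin (iInf₂_le v ⟨?_, hv0⟩)
  exact (hG.2 v).2 ⟨_, hL, rfl⟩

/-- The choice λ = 2^x - 1 makes 1 + λ = 2^x. Taking x = 1 - R cancels the |S| term exactly against
the seen checks and produces the constant of the theorem. -/
theorem card_light_words_le {α : Type} [DecidableEq α] (F : Finset α) (d : ℕ) {x : ℝ}
    (h0 : 0 < x) (h1 : x < 1) :
    (#{w ∈ F.powerset | #w < d} : ℝ) ≤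
      2 ^ (d * (-Real.logb 2 (2 ^ x - 1)) + x * #F : ℝ) := by
  have hl0 : (0 : ℝ) < 2 ^ x - 1 := by
    have := Real.one_lt_rpow (x := 2) (by norm_num) h0
    linarith
  have hl1 : (2 : ℝ) ^ x - 1 ≤ 1 := by
    have : (2 : ℝ) ^ x < 2 ^ (1 : ℝ) := Real.rpow_lt_rpow_of_exponent_lt (by norm_num) h1
    rw [Real.rpow_one] at this
    linarith
  have key := card_words_mul_pow_le F d hl0 hl1
  rw [add_sub_cancel, ← le_div_iff₀ (by positivity)] at key
  refine key.trans_eq ?_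
  have h2 : ((2 : ℝ) ^ x - 1) ^ d = 2 ^ (d * Real.logb 2 (2 ^ x - 1) : ℝ) := by
    rw [mul_comm, Real.rpow_mul (by norm_num), Real.rpow_logb (by norm_num) (by norm_num) hl0,
      Real.rpow_natCast]
  rw [h2, ← Real.rpow_natCast, ← Real.rpow_mul (by norm_num), ← Real.rpow_sub (by norm_num)]
  congr 1
  ring

namespace PivotedHypergraph

variable {E : Type} [Fintype E] [DecidableEq E] {s n c r : ℕ} (H : PivotedHypergraph E s n c r)

/-- The bound on the number of light words with a given activity pattern. -/
theorem card_light_words_le_seen {B K Q d : ℕ} (hK : 2 ≤ K) (hs : 0 < s) (hn : 0 < n)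
    (hr : 0 < r) {R ε : ℝ} (hR0 : 0 < R) (hR1 : R < 1) (hRc : (s * r : ℝ) = c * (1 - R))
    (hc : 0 < c)
    (hε : ε ≤ 1 / 2)
    (hexp : ∀ A : Finset E, (#(H.touched A) : ℝ) < (1 - ε) * (s * n) → #A ≤ s * r)
    (hd : d * (-Real.logb 2 (2 ^ (1 - R) - 1)) ≤ B * ((K - 2) * ((1 - ε) * (s * n * r))))
    (hd' : d * (-Real.logb 2 (2 ^ ((1 - R) / 2) - 1)) ≤
      B * ((1 - R) / 2 * Q - s * n * r - 1))
    {S : Finset (ℤ × E)} (hne : S.Nonempty) (hS : ∀ a ∈ S, 0 ≤ a.1 ∧ a.1 < (K * Q : ℕ))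
    (hpat : (∀ a ∈ S, a.1 + K < (K * Q : ℕ)) ∨ Q ≤ #S) :
    (#{w ∈ (cells B S).powerset | #w < d} : ℝ) ≤
      2 ^ (-(B : ℝ) / 2) * 2 ^ (B * (r * #(H.seen K (K * Q) S))) := by
  have hcR : (0 : ℝ) < c := by exact_mod_cast hc
  have hB0 : (0 : ℝ) ≤ B := Nat.cast_nonneg B
  have hKR : (2 : ℝ) ≤ K := by exact_mod_cast hK
  rw [← Real.rpow_natCast, ← Real.rpow_add (by norm_num)]
  push_cast
  have hcard : (#(cells B S) : ℝ) = B * #S := by rw [card_cells]; push_cast; ring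
  have hone : (1 : ℝ) ≤ s * n * r := by exact_mod_cast Nat.mul_pos (Nat.mul_pos hs hn) hr
  set σ : ℝ := ((#(H.seen K (K * Q) S) : ℕ) : ℝ) with hσ
  rcases hpat with hterm | hlong
  · have hS' : ∀ a ∈ S, 0 ≤ a.1 ∧ a.1 + K < (K * Q : ℕ) := fun a ha => ⟨(hS a ha).1, hterm a ha⟩
    by_cases htouch : (#(H.touched (S.image Prod.snd)) : ℝ) < (1 - ε) * (s * n)
    · -- few edges: there are fewer words than checks
      have h1 := H.le_card_seen_of_card_le (K := K) (by omega) hne hS' (hexp _ htouch)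
      have h2 : #S + 1 ≤ r * #(H.seen K (K * Q) S) := by
        have : 1 ≤ s * r * (K - 1) := Nat.mul_pos (Nat.mul_pos hs hr) (by omega)
        omega
      have h3 : (#S : ℝ) + 1 ≤ r * σ := by rw [hσ]; exact_mod_cast h2
      have h4 : #{w ∈ (cells B S).powerset | #w < d} ≤ 2 ^ (B * #S) := by
        calc _ ≤ #(cells B S).powerset := card_filter_le _ _
          _ = _ := by rw [card_powerset, card_cells]
      calc (#{w ∈ (cells B S).powerset | #w < d} : ℝ) ≤ 2 ^ (B * #S) := by exact_mod_cast h4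
        _ = 2 ^ (B * #S : ℝ) := by rw [← Real.rpow_natCast]; push_cast; rfl
        _ ≤ _ := Real.rpow_le_rpow_of_exponent_le (by norm_num) (by nlinarith)
    · have h1 := H.le_card_seen_of_terminated (K := K) (by omega) hS'
      have h2 : (s : ℝ) * #S + c * ((K - 1) * #(H.touched (S.image Prod.snd))) ≤ c * σ := by
        have : ((s * #S + c * ((K - 1) * #(H.touched (S.image Prod.snd))) : ℕ) : ℝ) ≤
          ((c * #(H.seen K (K * Q) S) : ℕ) : ℝ) := Nat.cast_le.2 h1
        push_cast [Nat.cast_sub (show 1 ≤ K by omega)] at this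
        exact this
      have h3 : (1 - R) * #S + (K - 1) * ((1 - ε) * (s * n * r)) ≤ r * σ := by
        have h4 : (K - 1) * ((1 - ε) * (s * n)) ≤
            ((K : ℝ) - 1) * #(H.touched (S.image Prod.snd)) :=
          mul_le_mul_of_nonneg_left (not_lt.1 htouch) (by linarith)
        have h5 : (s : ℝ) * #S + c * ((K - 1) * ((1 - ε) * (s * n))) ≤ c * σ := by
          have := mul_le_mul_of_nonneg_left h4 hcR.le
          linarith
        have h6 := mul_le_mul_of_nonneg_left h5 (Nat.cast_nonneg (α := ℝ) r)
        have h7 : c * ((1 - R) * #S + (K - 1) * ((1 - ε) * (s * n * r))) ≤ c * (r * σ) := by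
          calc _ = (c * (1 - R)) * #S + c * ((K - 1) * ((1 - ε) * (s * n * r))) := by ring
            _ = r * (s * #S + c * ((K - 1) * ((1 - ε) * (s * n)))) := by rw [← hRc]; ring
            _ ≤ _ := h6
            _ = _ := by ring
        exact le_of_mul_le_mul_left h7 hcR
      refine (card_light_words_le (cells B S) d (x := 1 - R) (by linarith) (by linarith)).trans ?_
      rw [hcard]
      refine Real.rpow_le_rpow_of_exponent_le (by norm_num) ?_
      have h4 := mul_le_mul_of_nonneg_left h3 hB0
      -- The checks supply K - 1 copies of this quantity and d uses K - 2; the remaining copy pays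
      -- for the factor 2^(-B/2).
      have h5 : (1 : ℝ) / 2 ≤ (1 - ε) * (s * n * r) := by nlinarith
      have h6 := mul_le_mul_of_nonneg_left h5 hB0
      nlinarith
  -- For long patterns half of the rate 1 - R is spent on counting words; the other half, times Q,
  -- covers the weight term and the boundary loss s n r.
  · have h1 := H.le_card_seen (K := K) (by omega) hS
    have h2 : (s : ℝ) * #S ≤ c * σ + c * (s * n) := by rw [hσ]; exact_mod_cast h1
    have h3 : (1 - R) * #S ≤ r * σ + s * n * r := by
      have h6 := mul_le_mul_of_nonneg_left h2 (Nat.cast_nonneg (α := ℝ) r)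
      have h7 : c * ((1 - R) * #S) ≤ c * (r * σ + s * n * r) := by
        calc _ = (c * (1 - R)) * #S := by ring
          _ = r * (s * #S) := by rw [← hRc]; ring
          _ ≤ _ := h6
          _ = _ := by ring
      exact le_of_mul_le_mul_left h7 hcR
    refine (card_light_words_le (cells B S) d (x := (1 - R) / 2) (by linarith)
      (by linarith)).trans ?_
    rw [hcard]
    refine Real.rpow_le_rpow_of_exponent_le (by norm_num) ?_
    have hQ : (Q : ℝ) ≤ #S := by exact_mod_cast hlong
    have h4 := mul_le_mul_of_nonneg_left h3 hB0
    have h5 : B * ((1 - R) / 2 * Q) ≤ B * ((1 - R) / 2 * #S) := by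
      have : 0 ≤ (1 - R) / 2 := by linarith
      gcongr
    nlinarith

/-- For long blocks there are check coefficients with the asymptotic free distance. -/
theorem exists_good_coefficients {K L : ℕ} (hK : 2 ≤ K) (hs : 0 < s) (hn : 0 < n)
    (hr : 0 < r) {R ε : ℝ} (hR0 : 0 < R) (hR1 : R < 1) (hRc : (s * r : ℝ) = c * (1 - R))
    (hc : 0 < c) (hε : ε ≤ 1 / 2)
    (hexp : ∀ A : Finset E, (#(H.touched A) : ℝ) < (1 - ε) * (s * n) → #A ≤ s * r)
    (hsr : s * r < c) (hL : s * r * (L + K) < c * L) :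
    ∃ B₀ : ℕ, ∀ B, B₀ ≤ B → 0 < B → ∀ d : ℕ,
      d * (-Real.logb 2 (2 ^ (1 - R) - 1)) ≤ B * ((K - 2) * ((1 - ε) * (s * n * r))) →
      ∃ h : ℤ → (Fin s × Fin n) × Fin r → ℤ → E → ZMod 2,
        (∀ t p τ e, ¬ H.Inc p.1 e → h t p τ e = 0) ∧
        (∀ v ∈ checkCode B K H.piv h, v ≠ 0 → (d : ℕ∞) ≤ weight v) ∧
        DualInjective B K L H.piv h := by
  have hneg : ∀ x : ℝ, 0 < x → x < 1 → 0 < -Real.logb 2 (2 ^ x - 1) := by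
    intro x h0 h1
    have hl0 : (1 : ℝ) < 2 ^ x := Real.one_lt_rpow (by norm_num) h0
    have hl1 : (2 : ℝ) ^ x < 2 ^ (1 : ℝ) := Real.rpow_lt_rpow_of_exponent_lt (by norm_num) h1
    rw [Real.rpow_one] at hl1
    have := Real.logb_neg (b := 2) (by norm_num) (show (0 : ℝ) < 2 ^ x - 1 by linarith)
      (by linarith)
    linarith
  set ℓ := -Real.logb 2 (2 ^ (1 - R) - 1) with hℓ
  set ℓ' := -Real.logb 2 (2 ^ ((1 - R) / 2) - 1) with hℓ'
  have hℓ0 : 0 < ℓ := hneg _ (by linarith) (by linarith)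
  have hℓ'0 : 0 < ℓ' := hneg _ (by linarith) (by linarith)
  set θ : ℝ := (K - 2) * ((1 - ε) * (s * n * r)) with hθ
  -- As d ≤ Bθ/ℓ, the weight term of long patterns is at most Bθℓ'/ℓ, so Q can be fixed before B.
  obtain ⟨Q, hQ⟩ : ∃ Q : ℕ, (θ / ℓ * ℓ' + s * n * r + 1) / ((1 - R) / 2) < Q := exists_nat_gt _
  have hKR : (2 : ℝ) ≤ K := by exact_mod_cast hK
  have hθ0 : 0 ≤ θ := by
    have h1 : (0 : ℝ) ≤ 1 - ε := by linarith
    have h2 : (0 : ℝ) ≤ K - 2 := by linarith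
    positivity
  have hQ0 : 0 < Q := by
    have h1 : (0 : ℝ) < (1 - R) / 2 := by linarith
    have : (0 : ℝ) < Q := lt_of_le_of_lt (by positivity) hQ
    exact_mod_cast this
  rw [div_lt_iff₀ (by linarith)] at hQ
  set T := K * Q + L + K with hT
  obtain ⟨B₀, hB₀⟩ : ∃ B₀ : ℕ, ∀ B, B₀ ≤ B →
      (T : ℝ) * (2 ^ (K * Q * Fintype.card E) + 2 ^ ((L + K) * (s * n * r))) *
        ((2 : ℝ) ^ (-(1 / 2 : ℝ))) ^ B < 1 := by
    have hlim : Filter.Tendsto (fun B : ℕ =>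
        (T : ℝ) * (2 ^ (K * Q * Fintype.card E) + 2 ^ ((L + K) * (s * n * r))) *
        ((2 : ℝ) ^ (-(1 / 2 : ℝ))) ^ B) Filter.atTop (nhds 0) := by
      rw [← mul_zero ((T : ℝ) * (2 ^ (K * Q * Fintype.card E) + 2 ^ ((L + K) * (s * n * r))))]
      refine Filter.Tendsto.const_mul _ (tendsto_pow_atTop_nhds_zero_of_lt_one (by positivity) ?_)
      exact Real.rpow_lt_one_of_one_lt_of_neg (by norm_num) (by norm_num)
    exact Filter.eventually_atTop.1 (hlim.eventually_lt_const zero_lt_one)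
  refine ⟨B₀, fun B hBB hB d hd => ?_⟩
  have hB0 : (0 : ℝ) < B := by exact_mod_cast hB
  have hpow : ((2 : ℝ) ^ (-(1 / 2 : ℝ))) ^ B = 2 ^ (-(B : ℝ) / 2) := by
    rw [← Real.rpow_natCast, ← Real.rpow_mul (by norm_num)]
    congr 1
    ring
  have hd' : d * ℓ' ≤ B * ((1 - R) / 2 * Q - s * n * r - 1) := by
    have h1 : (d : ℝ) ≤ B * θ / ℓ := (le_div_iff₀ hℓ0).2 hd
    calc d * ℓ' ≤ B * θ / ℓ * ℓ' := mul_le_mul_of_nonneg_right h1 hℓ'0.le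
      _ = B * (θ / ℓ * ℓ') := by ring
      _ ≤ _ := mul_le_mul_of_nonneg_left (by linarith) hB0.le
  refine H.exists_coefficients (δ := 2 ^ (-(B : ℝ) / 2)) (Q := Q) (T := T) hB (by omega) hQ0
    (by omega) (by omega) hsr hL ?_ (fun S hne hS hpat =>
      H.card_light_words_le_seen hK hs hn hr hR0 hR1 hRc hc hε hexp hd hd' hne hS hpat) ?_
  · rw [← Real.rpow_natCast, ← Real.rpow_add (by norm_num)]
    exact Real.one_le_rpow (by norm_num) (by linarith)
  · have := hB₀ B hBB
    rw [hpow] at this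
    linarith

end PivotedHypergraph

/-! ### Choice of parameters and conclusion -/

/-- Choice of the window length. -/
theorem exists_window {R ε ε₁ ℓ : ℝ} (hR0 : 0 < R) (hR1 : R < 1) (hε : 0 < ε) (hℓ : 0 < ℓ)
    (hε₁ : ε₁ ≤ 1 / 2) (hε₁' : ε₁ * (R / ℓ) ≤ ε / 2) :
    ∃ K : ℕ, 2 ≤ K ∧ max (R / ℓ - 3 * ε / 4) 0 * (K * (1 - R) / R + 2) ≤
      (K - 2) * ((1 - ε₁) * (1 - R)) / ℓ := by
  obtain ⟨K, hK⟩ : ∃ K : ℕ,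
      (2 * (R / ℓ) + 2 * ((1 - ε₁) * (1 - R) / ℓ)) / ((1 - R) / R * (ε / 4)) < K := exists_nat_gt _
  have h1R : 0 < 1 - R := by linarith
  -- K(1-R)/R + 2 will bound L + 1. Since ε₁ costs at most ε/2, a margin of ε/4 per unit of K(1-R)/R
  -- is left to absorb the additive constants.
  refine ⟨K + 2, by omega, ?_⟩
  have hK0 : (0 : ℝ) ≤ K := Nat.cast_nonneg K
  have h1ε : 0 < 1 - ε₁ := by linarith
  push_cast
  rcases le_total (R / ℓ - 3 * ε / 4) 0 with h | h
  · rw [max_eq_right h, zero_mul]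
    have : 0 ≤ (K + 2 - 2 : ℝ) := by linarith
    positivity
  · rw [max_eq_left h]
    have hX : 0 < (1 - R) / R := by positivity
    rw [div_lt_iff₀ (by positivity)] at hK
    have e1 : (K + 2 - 2 : ℝ) * ((1 - ε₁) * (1 - R)) / ℓ =
        (K + 2) * ((1 - R) / R) * ((1 - ε₁) * (R / ℓ)) - 2 * ((1 - ε₁) * (1 - R) / ℓ) := by
      field_simp
    have e2 : ((K : ℝ) + 2) * (1 - R) / R = (K + 2) * ((1 - R) / R) := by ring
    rw [e1, e2]
    have hKX : 0 ≤ (K + 2 : ℝ) * ((1 - R) / R) := by positivity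
    have h3 := mul_le_mul_of_nonneg_left
      (show R / ℓ - ε / 2 ≤ (1 - ε₁) * (R / ℓ) by linarith) hKX
    nlinarith

/-- The numerical estimate of the relative free distance. -/
theorem relative_distance_le {a' ε ψ N : ℝ} {L m B d : ℕ} (ha' : 0 ≤ a') (hN : 1 ≤ N)
    (hψ : a' * (L + 1) ≤ ψ) (hB : m ≤ B * (L + 1) + L + 1) (hd : B * (N * ψ) - 1 ≤ d)
    (hm : (a' * (L + 1) + 1) / (ε / 4) < m) (hε : 0 < ε) : a' - ε / 4 ≤ d / (N * m) := by
  have hm0 : (0 : ℝ) < m := lt_of_le_of_lt (by positivity) hm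
  rw [div_lt_iff₀ (by positivity)] at hm
  rw [le_div_iff₀ (by positivity)]
  have hBR : (m : ℝ) ≤ B * (L + 1) + L + 1 := by exact_mod_cast hB
  have h1 : a' * m ≤ a' * (B * (L + 1) + L + 1) := mul_le_mul_of_nonneg_left hBR ha'
  have h2 : (B : ℝ) * (a' * (L + 1)) ≤ B * ψ := mul_le_mul_of_nonneg_left hψ (Nat.cast_nonneg B)
  have h3 : a' * m - (a' * (L + 1)) ≤ B * ψ := by linarith
  have h4 := mul_le_mul_of_nonneg_left h3 (show (0 : ℝ) ≤ N by linarith)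
  have h5 : N * (a' * (L + 1) + 1) ≤ N * (m * (ε / 4)) :=
    mul_le_mul_of_nonneg_left hm.le (by linarith)
  nlinarith

theorem exists_woven_code (n : ℕ) (hn : 0 < n) (R : ℝ) (hR0 : 0 < R) (hR1 : R < 1)
    (ε : ℝ) (hε : 0 < ε) :
    ∃ s : ℕ, 2 ≤ s ∧
      ∀ b c : ℕ, 0 < c → (s : ℝ) * ((b : ℝ) / (c : ℝ) - 1) + 1 = R →
        ∃ m₀ : ℕ, 0 < m₀ ∧ ∀ m : ℕ, m₀ < m →
          ∃ (W : WovenGraphCode s n b c) (k d : ℕ),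
            (k : ℝ) / ((n : ℝ) * (c : ℝ)) = R ∧
            HasMemory k W.code m ∧
            freeDistance W.code = (d : ℕ∞) ∧
            -(R / Real.logb 2 ((2 : ℝ) ^ (1 - R) - 1)) - ε ≤
              (d : ℝ) / ((n : ℝ) * (c : ℝ) * (m : ℝ)) := by
  have : NeZero n := ⟨hn.ne'⟩
  have hl0 : (1 : ℝ) < 2 ^ (1 - R) := Real.one_lt_rpow (by norm_num) (by linarith)
  have hl1 : (2 : ℝ) ^ (1 - R) < 2 ^ (1 : ℝ) :=
    Real.rpow_lt_rpow_of_exponent_lt (by norm_num) (by linarith)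
  rw [Real.rpow_one] at hl1
  have hlog := Real.logb_neg (b := 2) (by norm_num)
    (show (0 : ℝ) < 2 ^ (1 - R) - 1 by linarith) (by linarith)
  obtain ⟨ℓ, hℓ⟩ : ∃ ℓ, ℓ = -Real.logb 2 ((2 : ℝ) ^ (1 - R) - 1) := ⟨_, rfl⟩
  have hℓ0 : 0 < ℓ := by linarith
  have hgoal : -(R / Real.logb 2 ((2 : ℝ) ^ (1 - R) - 1)) = R / ℓ := by
    rw [hℓ, div_neg]
  -- The error budget is ε/2 for untouched vertices, ε/4 for the additive constants in K and L, and
  -- ε/4 for rounding m and d.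
  obtain ⟨ε₁, hε₁0, hε₁, hε₁'⟩ : ∃ ε₁ : ℝ, 0 < ε₁ ∧ ε₁ ≤ 1 / 2 ∧ ε₁ * (R / ℓ) ≤ ε / 2 := by
    refine ⟨min (1 / 2) (ε / 2 / (R / ℓ)), by positivity, min_le_left _ _, ?_⟩
    rw [← le_div_iff₀ (by positivity)]
    exact min_le_right _ _
  obtain ⟨s, hs2, hs⟩ := exists_expanding_shifts n hε₁0 (show 0 < 1 - R by linarith)
  refine ⟨s, hs2, fun b c hc hbc => ?_⟩
  have hcR : (0 : ℝ) < c := by exact_mod_cast hc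
  have hsR : (0 : ℝ) < s := by exact_mod_cast (show 0 < s by omega)
  have hbc' : (s : ℝ) * (c - b) = c * (1 - R) := by
    rw [← hbc]; field_simp; ring
  have hblt : b < c := by
    have h1 : (0 : ℝ) < s * (c - b) := by rw [hbc']; exact mul_pos hcR (by linarith)
    have h2 : (0 : ℝ) < c - b := pos_of_mul_pos_right h1 hsR.le
    exact_mod_cast (sub_pos.1 h2)
  obtain ⟨r, hr⟩ : ∃ r, b + r = c := ⟨c - b, by omega⟩
  have hr0 : 0 < r := by omega
  have hrR : (r : ℝ) = c - b := by rw [← hr]; push_cast; ring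
  have hRc : (s * r : ℝ) = c * (1 - R) := by rw [hrR, hbc']
  have hsr : s * r < c := by
    have : (s * r : ℝ) < c := by rw [hRc]; nlinarith
    exact_mod_cast this
  -- The rate condition itself forces c to exceed s, as the expansion requires.
  have hsc : s < c := lt_of_le_of_lt (Nat.le_mul_of_pos_right s hr0) hsr
  obtain ⟨σ, hσ⟩ := hs c hsc
  set H := shiftedHypergraph (n := n) (r := r) hsr.le σ with hH
  have hexp : ∀ A : Finset (Fin (n * c)), (#(H.touched A) : ℝ) < (1 - ε₁) * (s * n) →
      #A ≤ s * r := by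
    intro A hA
    have h1 := hσ (A.map finProdFinEquiv.symm.toEmbedding) (by
      refine lt_of_le_of_lt ?_ hA
      refine Nat.cast_le.2 (card_le_card fun x hx => ?_)
      obtain ⟨a, ha, hax⟩ := (mem_filter.1 hx).2
      obtain ⟨e, he, rfl⟩ := mem_map.1 ha
      exact H.mem_touched.2 ⟨e, he, hax⟩)
    rw [card_map, mul_comm (1 - R), ← hRc] at h1
    exact_mod_cast h1
  obtain ⟨K, hK2, hK⟩ := exists_window hR0 hR1 hε hℓ0 hε₁ hε₁'
  obtain ⟨L, hL1, hL2⟩ : ∃ L : ℕ, s * r * (L + K) < c * L ∧ (L : ℝ) + 1 ≤ K * (1 - R) / R + 2 := by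
    -- As s r = c(1-R), the condition s r(L+K) < cL says L > K(1-R)/R; this is the least such L.
    refine ⟨⌊(K : ℝ) * (1 - R) / R⌋₊ + 1, ?_, ?_⟩
    · have h1 := Nat.lt_floor_add_one ((K : ℝ) * (1 - R) / R)
      rw [div_lt_iff₀ hR0] at h1
      have h2 : (s * r : ℝ) * ((⌊(K : ℝ) * (1 - R) / R⌋₊ + 1) + K) <
          c * (⌊(K : ℝ) * (1 - R) / R⌋₊ + 1) := by
        rw [hRc]
        have := mul_lt_mul_of_pos_left h1 hcR
        nlinarith
      exact_mod_cast h2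
    · have h1 : 0 ≤ (K : ℝ) * (1 - R) / R := by
        have : 0 < 1 - R := by linarith
        positivity
      have := Nat.floor_le h1
      push_cast
      linarith
  obtain ⟨B₀, hB₀⟩ := H.exists_good_coefficients (K := K) (L := L) hK2 (by omega) hn hr0 hR0 hR1 hRc
    hc hε₁ hexp hsr hL1
  set a' := max (R / ℓ - 3 * ε / 4) 0 with ha'
  have ha'0 : 0 ≤ a' := le_max_right _ _
  obtain ⟨m₁, hm₁⟩ : ∃ m₁ : ℕ, (a' * (L + 1) + 1) / (ε / 4) < m₁ := exists_nat_gt _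
  refine ⟨m₁ + (B₀ + 1) * (L + 1) + 1, by omega, fun m hm => ?_⟩
  -- the block length
  obtain ⟨B, hBdef⟩ : ∃ B, B = (m - 1) / (L + 1) := ⟨_, rfl⟩
  have hBle : (L + 1) * B ≤ m - 1 := by rw [hBdef]; exact Nat.mul_div_le _ _
  have hBge : m ≤ B * (L + 1) + L + 1 := by
    have := Nat.lt_div_mul_add (a := m - 1) (b := L + 1) (by omega)
    rw [← hBdef] at this
    omega
  have hB0 : B₀ + 1 ≤ B := by
    rw [hBdef, Nat.le_div_iff_mul_le (by omega)]
    omega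
  have hBpos : 0 < B := by omega
  have hNR : (1 : ℝ) ≤ n * c := by exact_mod_cast Nat.mul_pos hn hc
  obtain ⟨ψ, hψdef⟩ : ∃ ψ : ℝ, ψ = (K - 2) * ((1 - ε₁) * (1 - R)) / ℓ := ⟨_, rfl⟩
  have hψ : a' * (L + 1) ≤ ψ := by
    rw [hψdef]
    exact (mul_le_mul_of_nonneg_left hL2 ha'0).trans hK
  have hψ0 : 0 ≤ ψ := le_trans (by positivity) hψ
  obtain ⟨d, hd⟩ : ∃ d, d = ⌊(B : ℝ) * ((n * c) * ψ)⌋₊ := ⟨_, rfl⟩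
  have hdle : (d : ℝ) ≤ B * ((n * c) * ψ) := by rw [hd]; exact Nat.floor_le (by positivity)
  have hdge : B * ((n * c) * ψ) - 1 ≤ (d : ℝ) := by
    rw [hd]; linarith [Nat.lt_floor_add_one ((B : ℝ) * ((n * c) * ψ))]
  obtain ⟨h, hinc, hdist, hdual⟩ := hB₀ B (by omega) hBpos d (by
    rw [← hℓ]
    calc d * ℓ ≤ B * ((n * c) * ψ) * ℓ := mul_le_mul_of_nonneg_right hdle hℓ0.le
      _ = B * ((K - 2) * ((1 - ε₁) * (n * (c * (1 - R))))) := by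
          rw [hψdef]; field_simp
      _ = B * ((K - 2) * ((1 - ε₁) * (s * n * r))) := by rw [← hRc]; ring)
  -- the number of information symbols
  obtain ⟨k, hk⟩ : ∃ k, Fintype.card {e : Fin (n * c) // e ∉ Set.range H.piv} = k := ⟨_, rfl⟩
  have hkN : k + s * n * r = n * c := by
    have := PivotedHypergraph.card_compl_range H.piv_injective
    rw [hk] at this
    simpa using this
  have hkR : (k : ℝ) = n * c * R := by
    have h1 : (k : ℝ) + s * n * r = n * c := by exact_mod_cast hkN
    have h2 : (s * n * r : ℝ) = n * (c * (1 - R)) := by rw [← hRc]; ring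
    rw [h2] at h1
    linarith
  have hkpos : 0 < k := by
    have : (0 : ℝ) < k := by rw [hkR]; positivity
    exact_mod_cast this
  obtain ⟨G, hG⟩ := (hdual.controllable hBpos).exists_isGenerator hBpos
    (Fintype.equivFinOfCardEq hk).symm
  obtain ⟨g, hg⟩ := exists_hasMemory_map_gap (m := m) hkpos hG (by omega)
  let W := PivotedHypergraph.woven (H := H) hBpos hr hinc hdual
  have hcode : (W.gapped g).code = (checkCode B K H.piv h).map (gap g) := by
    rw [WovenGraphCode.code_gapped (by omega), H.code_woven (by omega) hBpos hr hinc hdual]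
  have hfree : (d : ℕ∞) ≤ freeDistance (checkCode B K H.piv h) :=
    le_iInf₂ fun v hv => hdist v hv.1 hv.2
  obtain ⟨D, hD⟩ := ENat.ne_top_iff_exists.1 (freeDistance_ne_top hkpos hG)
  refine ⟨W.gapped g, k, D, ?_, ?_, ?_, ?_⟩
  · rw [hkR]
    field_simp
  · rw [hcode]; exact hg
  · rw [hcode, freeDistance_map_gap, hD]
  · have hdD : d ≤ D := by
      rw [← hD] at hfree
      exact_mod_cast hfree
    have h1 := relative_distance_le (N := n * c) (d := D) ha'0 hNR hψ hBge
      (hdge.trans (by exact_mod_cast hdD)) (hm₁.trans (by exact_mod_cast (show m₁ < m by omega))) hε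
    have h2 : R / ℓ - 3 * ε / 4 ≤ a' := le_max_left _ _
    rw [hgoal]
    linarith

end WovenGraph

theorem theorem5 (n : ℕ) (hn : 0 < n) (R : ℝ) (hR0 : 0 < R) (hR1 : R < 1)
    (ε : ℝ) (hε : 0 < ε) :
    ∃ s : ℕ, 2 ≤ s ∧
      ∀ b c : ℕ, 0 < c → (s : ℝ) * ((b : ℝ) / (c : ℝ) - 1) + 1 = R →
        ∃ m₀ : ℕ, 0 < m₀ ∧ ∀ m : ℕ, m₀ < m →
          ∃ (W : WovenGraph.WovenGraphCode s n b c) (k d : ℕ),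
            (k : ℝ) / ((n : ℝ) * (c : ℝ)) = R ∧
            WovenGraph.HasMemory k W.code m ∧
            WovenGraph.freeDistance W.code = (d : ℕ∞) ∧
            -(R / Real.logb 2 ((2 : ℝ) ^ (1 - R) - 1)) - ε ≤
              (d : ℝ) / ((n : ℝ) * (c : ℝ) * (m : ℝ)) := by
  exact WovenGraph.exists_woven_code n hn R hR0 hR1 ε hε
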